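/- **Setting.** Let $\mathsf T=\mathrm{diag}(1,e^{i\pi/4})$, $\mathsf P=\mathrm{diag}(1,i)$, $|\mathsf T\rangle=\mathsf T|+\rangle$, $|\mathsf T^\perp\rangle=\mathsf T|-\rangle$, and let $\tau_\varepsilon=(1-\varepsilon)|\mathsf T\rangle\langle\mathsf T|+\varepsilon|\mathsf T^\perp\rangle\langle\mathsf T^\perp|$. For $n\ge 0$ let $D_n$ be a circuit consisting of gates $\mathsf H,\mathsf P,\mathrm{CNOT}$ and computational-basis measurements, where later gates may depend on earlier outcomes; it takes $n$ qubits and ancillas in state $|0\rangle$ as input and outputs one qubit (all other qubits are discarded). Write $\Phi_n$ for its channel. For real numbers $c,a,A,B,\delta>0$ with $B\delta<1$, the family $D=(D_n)_n$ is called *$(c,a,A,B,\delta)$-distilling* if $$1-\langle \mathsf T|\Phi_n(\tau_\varepsilon^{\otimes n})|\mathsf T\rangle\le A\,(B\varepsilon)^{a n^c}\qquad\text{for all } n\text{ and all } 0\le\varepsilon<\delta .$$ For $t\ge1$ and $m=tn$ with $t<m$, let $\Xi$ be the channel from $m$ to $t$ qubits that (1) applies $\hat{\mathsf Z}=\mathsf{PX}$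 to each qubit independently with probability $\tfrac12$, (2) permutes the qubits by a uniformly random $\pi\in S_m$, (3) divides the $m$ qubits into $t$ blocks of size $n=m/t$ and applies $\Phi_n$ to each block. Let $P_\pi$ be the unitary that permutes the $m$ qubits according to $\pi$, and let $\Pi_{LW}$ be the orthogonal projector onto $V_{LW}=\mathrm{span}\{P_\pi(|\mathsf T\rangle^{\otimes m-w}|\mathsf T^\perp\rangle^{\otimes w}):w\le \min(\ell,m),\ \pi\in S_m\}$. **Lemma.** 1. There are real numbers $c,a,A,B,\delta>0$ with $B\delta<1$ and a $(c,a,A,B,\delta)$-distilling family $(D_n)_n$ such that $D_n$ has CNOT-depth $O(\log n)$ and uses polynomially many (in $n$) ancillas, gates and measurements. 2. For all $c,a,A,B,\delta$ there are constants $K,C>0$, depending only on these five numbers, such that for every $(c,a,A,B,\delta)$-distilling family $D$, for all $t\ge 1$ and $m$ with $t\mid m$, $t<m$, all integers $\ell\ge0$ with $\ell/m<\delta$, all real $\varepsilon$, and every $m$-qubit state $\rho$ with $\mathrm{Tr}(\Pi_{LW}\rho)\ge 1-\varepsilon$, $$\left\|\Xi(\rho)-(|\mathsf T\rangle\langle \mathsf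 T|)^{\otimes t}\right\|_1\le C\left(m\sqrt t\left(\frac{\ell}{m}\right)^{K (m/t)^c/2}+\varepsilon\right),$$ where $\|\cdot\|_1$ is the trace norm. -/

import Mathlib

open scoped Matrix ComplexOrder

namespace MagicDistillation

noncomputable section

/-! ### Registers of qubits

A register with wire set `W` has computational basis `W → Fin 2`; operators on it are square
matrices over that basis. -/

/-- Operators on the register of qubits with wire set `W`. -/
abbrev Op (W : Type) : Type := Matrix (W → Fin 2) (W → Fin 2) ℂ

section Register

variable {W : Type} [Fintype W] [DecidableEq W]

/-- The product vector `⨂ i, v i`. -/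
def prodVec (v : W → Fin 2 → ℂ) : (W → Fin 2) → ℂ := fun x => ∏ i, v i (x i)

/-- The product operator `⨂ i, A i`. -/
def prodOp (A : W → Matrix (Fin 2) (Fin 2) ℂ) : Op W := fun x y => ∏ i, A i (x i) (y i)

/-- The single-qubit operator `G` acting on wire `i`, identity on all the other wires. -/
def onWire (i : W) (G : Matrix (Fin 2) (Fin 2) ℂ) : Op W :=
  prodOp fun k => if k = i then G else 1

/-- CNOT with control `i` and target `j`: `|y⟩ ↦ |y with y_j replaced by y_j + y_i⟩`. -/
def cnotOp (i j : W) : Op W := fun x y => if x = Function.update y j (y j + y i) then 1 else 0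

/-- The unitary `P_π` with `P_π |ψ₁⟩…|ψₘ⟩ = |ψ_{π 1}⟩…|ψ_{π m}⟩`. -/
def permOp (π : Equiv.Perm W) : Op W := fun x y => if y = x ∘ π.symm then 1 else 0

/-- Density operators. -/
def IsState {ι : Type} [Fintype ι] [DecidableEq ι] (ρ : Matrix ι ι ℂ) : Prop :=
  ρ.PosSemidef ∧ ρ.trace = 1

/-- The trace norm: the sum of the singular values of `A`. -/
def traceNorm {ι : Type} [Fintype ι] [DecidableEq ι] (A : Matrix ι ι ℂ) : ℝ :=
  ∑ i, Real.sqrt ((Matrix.isHermitian_conjTranspose_mul_self A).eigenvalues i)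

end Register

/-! ### Single-qubit gates and the magic states -/

/-- The Hadamard gate. -/
def gateH : Matrix (Fin 2) (Fin 2) ℂ := ((1 / Real.sqrt 2 : ℝ) : ℂ) • !![1, 1; 1, -1]

/-- The phase gate `P = diag(1, i)`. -/
def gateP : Matrix (Fin 2) (Fin 2) ℂ := !![1, 0; 0, Complex.I]

/-- The Pauli gate `X`. -/
def gateX : Matrix (Fin 2) (Fin 2) ℂ := !![0, 1; 1, 0]

/-- The gate `T = diag(1, e^{iπ/4})`. -/
def gateT : Matrix (Fin 2) (Fin 2) ℂ := !![1, 0; 0, Complex.exp (Complex.I * (Real.pi / 4))]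

/-- `|+⟩`. -/
def ketPlus : Fin 2 → ℂ := ((1 / Real.sqrt 2 : ℝ) : ℂ) • ![1, 1]

/-- `|−⟩`. -/
def ketMinus : Fin 2 → ℂ := ((1 / Real.sqrt 2 : ℝ) : ℂ) • ![1, -1]

/-- The magic state `|T⟩ = T|+⟩`. -/
def ketT : Fin 2 → ℂ := gateT *ᵥ ketPlus

/-- The orthogonal state `|T^⊥⟩ = T|−⟩`. -/
def ketTperp : Fin 2 → ℂ := gateT *ᵥ ketMinus

/-- `|ψ⟩⟨ψ|`. -/
def proj (ψ : Fin 2 → ℂ) : Matrix (Fin 2) (Fin 2) ℂ := Matrix.vecMulVec ψ (star ψ)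

/-- `Ẑ = P X`. -/
def gateZhat : Matrix (Fin 2) (Fin 2) ℂ := gateP * gateX

/-- The noisy magic state `(1 - ε)|T⟩⟨T| + ε|T^⊥⟩⟨T^⊥|`. -/
def noisyT (ε : ℝ) : Matrix (Fin 2) (Fin 2) ℂ :=
  ((1 - ε : ℝ) : ℂ) • proj ketT + ((ε : ℝ) : ℂ) • proj ketTperp

/-! ### Circuits of classically controlled Clifford gates and measurements -/

/-- Programs on the wires `W`: Clifford gates, computational-basis measurements whose outcome
controls the program that follows (`meas i k` measures wire `i` and continues with `k b` on
outcome `b`), sequential composition, and parallel composition. -/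
inductive Prog (W : Type) : Type
  | skip : Prog W
  | had (i : W) : Prog W
  | phase (i : W) : Prog W
  | cnot (i j : W) (hij : i ≠ j) : Prog W
  | meas (i : W) (k : Fin 2 → Prog W) : Prog W
  | seq (p q : Prog W) : Prog W
  | par (p q : Prog W) : Prog W

namespace Prog

variable {W : Type}

/-- The wires that a program touches. -/
def wires : Prog W → Set W
  | skip => ∅
  | had i => {i}
  | phase i => {i}
  | cnot i j _ => {i, j}
  | meas i k => {i} ∪ ⋃ b, (k b).wires
  | seq p q => p.wires ∪ q.wires
  | par p q => p.wires ∪ q.wires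

/-- Programs run in parallel act on disjoint sets of wires. -/
def WellFormed : Prog W → Prop
  | skip => True
  | had _ => True
  | phase _ => True
  | cnot _ _ _ => True
  | meas _ k => ∀ b, (k b).WellFormed
  | seq p q => p.WellFormed ∧ q.WellFormed
  | par p q => p.WellFormed ∧ q.WellFormed ∧ Disjoint p.wires q.wires

/-- The number of gates and measurements executed, in the worst case over the outcomes. -/
def size : Prog W → ℕ
  | skip => 0
  | had _ => 1
  | phase _ => 1
  | cnot _ _ _ => 1
  | meas _ k => 1 + max (k 0).size (k 1).size
  | seq p q => p.size + q.size
  | par p q => p.size + q.size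

/-- The number of CNOT layers, in the worst case over the outcomes. -/
def cnotDepth : Prog W → ℕ
  | skip => 0
  | had _ => 0
  | phase _ => 0
  | cnot _ _ _ => 1
  | meas _ k => max (k 0).cnotDepth (k 1).cnotDepth
  | seq p q => p.cnotDepth + q.cnotDepth
  | par p q => max p.cnotDepth q.cnotDepth

/-- The action of a program on operators. A measurement sums over its outcomes. In a well-formed
program, programs in parallel commute, so that their order is immaterial. -/
def run [Fintype W] [DecidableEq W] : Prog W → Op W → Op W
  | skip, ρ => ρ
  | had i, ρ => onWire i gateH * ρ * (onWire i gateH)ᴴ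
  | phase i, ρ => onWire i gateP * ρ * (onWire i gateP)ᴴ
  | cnot i j _, ρ => cnotOp i j * ρ * (cnotOp i j)ᴴ
  | meas i k, ρ =>
      ∑ b : Fin 2, (k b).run
        (onWire i (Matrix.single b b 1) * ρ * (onWire i (Matrix.single b b 1))ᴴ)
  | seq p q, ρ => q.run (p.run ρ)
  | par p q, ρ => q.run (p.run ρ)

end Prog

/-- A circuit with `n` input qubits, finitely many ancillas that start in `|0⟩`, and one output
wire; all the other wires are discarded at the end. -/
structure Circuit (n : ℕ) where
  anc : ℕ
  prog : Prog (Fin n ⊕ Fin anc)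
  wellFormed : prog.WellFormed
  out : Fin n ⊕ Fin anc

namespace Circuit

variable {n : ℕ}

/-- Number of ancillas, gates and measurements. -/
def size (D : Circuit n) : ℕ := D.anc + D.prog.size

/-- CNOT-depth. -/
def cnotDepth (D : Circuit n) : ℕ := D.prog.cnotDepth

/-- `ρ ⊗ |0…0⟩⟨0…0|`. -/
def addAncillas (a : ℕ) (ρ : Op (Fin n)) : Op (Fin n ⊕ Fin a) := fun x y =>
  if (∀ k, x (Sum.inr k) = 0) ∧ ∀ k, y (Sum.inr k) = 0 then
    ρ (x ∘ Sum.inl) (y ∘ Sum.inl) else 0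

/-- The partial trace over all the wires but `i`. -/
def reduceTo {W : Type} [Fintype W] [DecidableEq W] (i : W) (ρ : Op W) :
    Matrix (Fin 2) (Fin 2) ℂ := fun b b' =>
  ∑ x : W → Fin 2, ∑ y : W → Fin 2,
    if x i = b ∧ y i = b' ∧ ∀ k, k ≠ i → x k = y k then ρ x y else 0

/-- The map from `n` qubits to one qubit that the circuit induces. -/
def channel (D : Circuit n) (ρ : Op (Fin n)) : Matrix (Fin 2) (Fin 2) ℂ :=
  reduceTo D.out (D.prog.run (addAncillas D.anc ρ))

end Circuit

/-- The family `D` distills magic states: for every `0 ≤ ε < δ`, on `n` copies of the noisy magic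
state the circuit `D n` outputs `|T⟩` up to infidelity `A (B ε)^(a n^c)`. -/
structure Distills (D : (n : ℕ) → Circuit n) (c a A B δ : ℝ) : Prop where
  c_pos : 0 < c
  a_pos : 0 < a
  A_pos : 0 < A
  B_pos : 0 < B
  δ_pos : 0 < δ
  Bδ_lt_one : B * δ < 1
  infidelity_le : ∀ (n : ℕ) (ε : ℝ), 0 ≤ ε → ε < δ →
    1 - (star ketT ⬝ᵥ ((D n).channel (prodOp fun _ => noisyT ε) *ᵥ ketT)).re
      ≤ A * (B * ε) ^ (a * (n : ℝ) ^ c)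

/-! ### The distillation procedure on `m = t n` qubits -/

/-- Step 1: apply `Ẑ` to each qubit independently with probability `1/2`. -/
def dephase {m : ℕ} (ρ : Op (Fin m)) : Op (Fin m) :=
  ((2 : ℂ) ^ m)⁻¹ • ∑ s : Fin m → Fin 2,
    prodOp (fun i => gateZhat ^ (s i : ℕ)) * ρ * (prodOp fun i => gateZhat ^ (s i : ℕ))ᴴ

/-- Step 2: permute the qubits by a uniformly random permutation. -/
def randomPermute {m : ℕ} (ρ : Op (Fin m)) : Op (Fin m) :=
  ((m.factorial : ℂ))⁻¹ • ∑ π : Equiv.Perm (Fin m), permOp π * ρ * (permOp π)ᴴ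

/-- The `b`-th of the `t` consecutive blocks of size `n` of a bit string. -/
def block {t n : ℕ} (x : Fin (t * n) → Fin 2) (b : Fin t) : Fin n → Fin 2 :=
  fun j => x (finProdFinEquiv (b, j))

/-- Step 3: the map `Φ^{⊗ t}`, given by `⨂ b, E b ↦ ⨂ b, Φ (E b)` on matrix units. -/
def blockwise {t n : ℕ} (Φ : Op (Fin n) → Matrix (Fin 2) (Fin 2) ℂ) (ρ : Op (Fin (t * n))) :
    Op (Fin t) := fun u v =>
  ∑ x : Fin (t * n) → Fin 2, ∑ y : Fin (t * n) → Fin 2,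
    ρ x y * ∏ b, Φ (Matrix.single (block x b) (block y b) 1) (u b) (v b)

/-- The whole procedure `Ξ`, from `t n` qubits to `t` qubits. -/
def distill (D : (n : ℕ) → Circuit n) (t n : ℕ) (ρ : Op (Fin (t * n))) : Op (Fin t) :=
  blockwise (D n).channel (randomPermute (dephase ρ))

/-! ### The low-weight subspace -/

/-- `span {P_π (|T⟩^{⊗ (m-w)} ⊗ |T^⊥⟩^{⊗ w}) : w ≤ ℓ, π ∈ S_m}` (where `w ≤ m`). -/
def lowWeight (m ℓ : ℕ) : Submodule ℂ (EuclideanSpace ℂ (Fin m → Fin 2)) :=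
  Submodule.span ℂ {v | ∃ (w : ℕ) (π : Equiv.Perm (Fin m)), w ≤ ℓ ∧ w ≤ m ∧
    v = WithLp.toLp 2
      (permOp π *ᵥ prodVec fun i : Fin m => if (i : ℕ) < m - w then ketT else ketTperp)}

/-- The matrix of the orthogonal projector onto `lowWeight m ℓ`. -/
def lowWeightProj (m ℓ : ℕ) : Op (Fin m) :=
  Matrix.toEuclideanLin.symm
    ((lowWeight m ℓ).starProjection : EuclideanSpace ℂ (Fin m → Fin 2) →ₗ[ℂ]
      EuclideanSpace ℂ (Fin m → Fin 2))

end

end MagicDistillation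

open MagicDistillation

/-!
Errors are described in the magic basis: a register whose qubits are in the states `|T⟩` and
`|T^⊥⟩` is labelled by its error pattern, the bit string that marks the qubits in `|T^⊥⟩`. The
noisy state `noisyT ε` is the mixture of the two with independent errors of probability `ε`, so
that the infidelity of a circuit on `n` noisy inputs is an average over error patterns
(`infidelity_channel_noisyT`).

*Existence of a distilling family.* For `y ∈ 𝔽₂⁴`, the number of the fourteen linear functionals
`g` other than `0` and the sum `σ` of the coordinates with `g y = 1`, plus the bit `σ y`, is `0` or
`8` (`sum_eval_rotations`), and `T⁸ = 1`; hence a `T` rotation about each of the fourteen amounts to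
a `T⁻¹` rotation about `σ`, which one phase gate turns into a `T` rotation. Four of the magic
states are used as the data qubits, ten are consumed by gate injection, and three parity checks
detect each single error among these fourteen. When a check fails, a circuit without
post-selection has to output something: here it is a fifteenth, untouched magic state. An output
error therefore needs two input errors (`exists_ne_of_errorBit_eq_one`), and the gadget
(`mem_wp_gadget`) takes `ε` to `O(ε²)`. Concatenated `log₁₆ n` times it reaches
`(256 ε) ^ (2 ^ log₁₆ n)`, at logarithmic CNOT-depth and linear size
(`iidExp_concatErrorBit_le`, `exists_distilling_family`). The action of an adaptive circuit is
computed with weakest preconditions: the subspace that every Kraus operator maps into a given one.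

*The error of the procedure.* `Ẑ` is diagonal in the magic basis with distinct eigenvalues, so that
the first step leaves a mixture of error patterns (`dephase_eq`), and the second one makes the
pattern uniformly random given its weight. The low-weight subspace is spanned by magic basis
vectors, hence the weight exceeds `ℓ` with probability at most `ε` (`sum_magicProb_high_le`). The
uniform distribution on patterns of weight `w ≤ ℓ` is bounded by `m + 1` times that of independent
errors of probability `w / m < δ` (`permAvg_le_iidExp`), for which the hypothesis bounds the
infidelity of each block; a union bound over the blocks follows. The trace distance to the pure
target is `O(√infidelity)` (`re_trace_mul_sub_le`). It is taken separately for each pattern, before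
averaging, so that `ε` enters linearly and not through its square root.
-/

namespace MagicDistillation

set_option linter.unusedSectionVars false

/-! ### Operators on registers -/

section Register

variable {W : Type} [Fintype W] [DecidableEq W]

theorem prodOp_mul (A B : W → Matrix (Fin 2) (Fin 2) ℂ) :
    prodOp A * prodOp B = prodOp fun i => A i * B i := by
  ext x y
  simp only [prodOp, Matrix.mul_apply, ← Finset.prod_mul_distrib]
  rw [Finset.prod_univ_sum, Fintype.piFinset_univ]

theorem prodOp_conjTranspose (A : W → Matrix (Fin 2) (Fin 2) ℂ) :
    (prodOp A)ᴴ = prodOp fun i => (A i)ᴴ := by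
  ext x y
  simp [prodOp, Matrix.conjTranspose_apply]

theorem prodOp_one : prodOp (fun _ : W => (1 : Matrix (Fin 2) (Fin 2) ℂ)) = 1 := by
  ext x y
  simp only [prodOp, Matrix.one_apply]
  by_cases h : x = y
  · simp [h]
  · obtain ⟨i, hi⟩ := Function.ne_iff.mp h
    rw [if_neg h]
    exact Finset.prod_eq_zero (Finset.mem_univ i) (if_neg hi)

theorem trace_prodOp (A : W → Matrix (Fin 2) (Fin 2) ℂ) :
    (prodOp A).trace = ∏ i, (A i).trace := by
  simp only [Matrix.trace, Matrix.diag, prodOp]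
  rw [Finset.prod_univ_sum, Fintype.piFinset_univ]

theorem onWire_mul (i : W) (G G' : Matrix (Fin 2) (Fin 2) ℂ) :
    onWire i G * onWire i G' = onWire i (G * G') := by
  rw [onWire, onWire, prodOp_mul, onWire]
  congr 1
  ext1 k
  split_ifs <;> simp

theorem onWire_conjTranspose (i : W) (G : Matrix (Fin 2) (Fin 2) ℂ) :
    (onWire i G)ᴴ = onWire i Gᴴ := by
  rw [onWire, prodOp_conjTranspose, onWire]
  congr 1
  ext1 k
  split_ifs <;> simp

theorem onWire_one (i : W) : onWire i (1 : Matrix (Fin 2) (Fin 2) ℂ) = 1 := by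
  rw [onWire, ← prodOp_one]
  congr 1
  ext1 k
  split_ifs <;> rfl

theorem onWire_apply (i : W) (G : Matrix (Fin 2) (Fin 2) ℂ) (x y : W → Fin 2) :
    onWire i G x y = if ∀ k, k ≠ i → x k = y k then G (x i) (y i) else 0 := by
  simp only [onWire, prodOp]
  split_ifs with h
  · rw [Finset.prod_eq_single i]
    · simp
    · intro k _ hk
      rw [if_neg hk, h k hk, Matrix.one_apply_eq]
    · simp
  · push Not at h
    obtain ⟨k, hk, hxy⟩ := h
    apply Finset.prod_eq_zero (Finset.mem_univ k)
    simp [hk, hxy]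

theorem forall_ne_eq_iff (i : W) (x y : W → Fin 2) :
    (∀ k, k ≠ i → x k = y k) ↔ y = Function.update x i (y i) := by
  constructor
  · intro h
    ext1 k
    by_cases hk : k = i
    · subst hk; simp
    · simp [hk, h k hk]
  · intro h k hk
    rw [h]
    simp [hk]

theorem onWire_mulVec (i : W) (G : Matrix (Fin 2) (Fin 2) ℂ) (v : (W → Fin 2) → ℂ)
    (x : W → Fin 2) :
    (onWire i G *ᵥ v) x = ∑ c, G (x i) c * v (Function.update x i c) := by
  simp only [Matrix.mulVec, dotProduct, onWire_apply]
  have hinj : Function.Injective (Function.update x i) := Function.update_injective x i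
  rw [← Finset.sum_image (s := Finset.univ) (g := Function.update x i)
    (f := fun y => G (x i) (y i) * v y) (fun a _ b _ h => hinj h) |>.trans
      (Finset.sum_congr rfl fun c _ => by simp)]
  rw [← Finset.sum_subset (Finset.subset_univ (Finset.univ.image (Function.update x i)))]
  · apply Finset.sum_congr rfl
    intro y hy
    obtain ⟨c, -, rfl⟩ := Finset.mem_image.mp hy
    rw [if_pos]
    intro k hk
    simp [hk]
  · intro y _ hy
    rw [if_neg, zero_mul]
    intro h
    apply hy
    rw [forall_ne_eq_iff] at h
    exact Finset.mem_image.mpr ⟨y i, Finset.mem_univ _, h.symm⟩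

theorem update_add_involutive {i j : W} (hij : i ≠ j) (x y : W → Fin 2) :
    x = Function.update y j (y j + y i) ↔ y = Function.update x j (x j + x i) := by
  have key : ∀ x y : W → Fin 2, x = Function.update y j (y j + y i) →
      y = Function.update x j (x j + x i) := by
    rintro x y rfl
    have h2 : ∀ a b : Fin 2, a + b + b = a := by decide
    simp [Function.update_of_ne hij, h2]
  exact ⟨key x y, key y x⟩

theorem cnotOp_mulVec {i j : W} (hij : i ≠ j) (v : (W → Fin 2) → ℂ) (x : W → Fin 2) :
    (cnotOp i j *ᵥ v) x = v (Function.update x j (x j + x i)) := by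
  simp only [Matrix.mulVec, dotProduct, cnotOp, update_add_involutive hij x]
  simp

theorem cnotOp_conjTranspose {i j : W} (hij : i ≠ j) : (cnotOp i j)ᴴ = cnotOp i j := by
  ext x y
  simp only [Matrix.conjTranspose_apply, cnotOp, update_add_involutive hij x y]
  split_ifs <;> simp

theorem cnotOp_mul_self {i j : W} (hij : i ≠ j) : cnotOp i j * cnotOp i j = 1 := by
  have : ∀ v : (W → Fin 2) → ℂ, (cnotOp i j * cnotOp i j) *ᵥ v = v := by
    intro v
    rw [← Matrix.mulVec_mulVec]
    ext x
    rw [cnotOp_mulVec hij, cnotOp_mulVec hij]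
    have h2 : ∀ a b : Fin 2, a + b + b = a := by decide
    simp [Function.update_of_ne hij, h2]
  apply Matrix.mulVec_injective
  ext1 v
  simpa using this v

open scoped MatrixOrder Matrix.Norms.L2Operator in
theorem exists_eq_conjTranspose_mul_self {ι : Type*} [Fintype ι] [DecidableEq ι]
    {A : Matrix ι ι ℂ} (hA : A.PosSemidef) : ∃ B : Matrix ι ι ℂ, A = Bᴴ * B :=
  CStarAlgebra.nonneg_iff_eq_star_mul_self.mp hA.nonneg

theorem posSemidef_prodOp {A : W → Matrix (Fin 2) (Fin 2) ℂ} (hA : ∀ i, (A i).PosSemidef) :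
    (prodOp A).PosSemidef := by
  choose B hB using fun i => exists_eq_conjTranspose_mul_self (hA i)
  have : prodOp A = (prodOp B)ᴴ * prodOp B := by
    rw [prodOp_conjTranspose, prodOp_mul]
    exact congrArg _ (funext hB)
  rw [this]
  exact Matrix.posSemidef_conjTranspose_mul_self _

end Register

/-! ### Programs as maps on operators -/

theorem gateH_conjTranspose_mul_self : gateHᴴ * gateH = 1 := by
  have h : ((1 / Real.sqrt 2 : ℝ) : ℂ) * ((1 / Real.sqrt 2 : ℝ) : ℂ) = 1 / 2 := by
    rw [← Complex.ofReal_mul, div_mul_div_comm, Real.mul_self_sqrt (by norm_num)]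
    norm_num
  ext i j
  fin_cases i <;> fin_cases j <;>
    simp [gateH, Matrix.mul_apply, Fin.sum_univ_two] <;> simp at h <;> linear_combination 2 * h

theorem gateP_conjTranspose_mul_self : gatePᴴ * gateP = 1 := by
  ext i j
  fin_cases i <;> fin_cases j <;> simp [gateP, Matrix.mul_apply, Fin.sum_univ_two]

namespace Prog

variable {W : Type} [Fintype W] [DecidableEq W]

theorem run_add (p : Prog W) (ρ σ : Op W) : p.run (ρ + σ) = p.run ρ + p.run σ := by
  induction p generalizing ρ σ with
  | skip => rfl
  | had i => simp [run, mul_add, add_mul]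
  | phase i => simp [run, mul_add, add_mul]
  | cnot i j h => simp [run, mul_add, add_mul]
  | meas i k ih => simp only [run, mul_add, add_mul, ih, Finset.sum_add_distrib]
  | seq p q ihp ihq => simp [run, ihp, ihq]
  | par p q ihp ihq => simp [run, ihp, ihq]

theorem run_smul (p : Prog W) (c : ℂ) (ρ : Op W) : p.run (c • ρ) = c • p.run ρ := by
  induction p generalizing ρ with
  | skip => rfl
  | had i => simp [run]
  | phase i => simp [run]
  | cnot i j h => simp [run]
  | meas i k ih => simp only [run, Matrix.mul_smul, Matrix.smul_mul, ih, Finset.smul_sum]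
  | seq p q ihp ihq => simp [run, ihp, ihq]
  | par p q ihp ihq => simp [run, ihp, ihq]

theorem trace_conj_of_isometry {ι : Type*} [Fintype ι] [DecidableEq ι] {K : Matrix ι ι ℂ}
    (hK : Kᴴ * K = 1) (ρ : Matrix ι ι ℂ) : (K * ρ * Kᴴ).trace = ρ.trace := by
  rw [Matrix.trace_mul_comm, ← mul_assoc, hK, one_mul]

theorem trace_run (p : Prog W) (ρ : Op W) : (p.run ρ).trace = ρ.trace := by
  induction p generalizing ρ with
  | skip => rfl
  | had i =>
    apply trace_conj_of_isometry
    rw [onWire_conjTranspose, onWire_mul, gateH_conjTranspose_mul_self, onWire_one]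
  | phase i =>
    apply trace_conj_of_isometry
    rw [onWire_conjTranspose, onWire_mul, gateP_conjTranspose_mul_self, onWire_one]
  | cnot i j h =>
    apply trace_conj_of_isometry
    rw [cnotOp_conjTranspose h, cnotOp_mul_self h]
  | meas i k ih =>
    simp only [run, Matrix.trace_sum, ih]
    have h : ∀ b : Fin 2, (onWire i (Matrix.single b b 1) * ρ *
        (onWire i (Matrix.single b b (1 : ℂ)))ᴴ).trace =
        (onWire i (Matrix.single b b 1) * ρ).trace := by
      intro b
      rw [Matrix.trace_mul_comm, ← mul_assoc, onWire_conjTranspose, onWire_mul]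
      simp
    simp only [h]
    rw [← Matrix.trace_sum, ← Finset.sum_mul]
    congr 1
    convert one_mul ρ
    ext x y
    rw [Matrix.sum_apply]
    simp only [onWire_apply, Matrix.one_apply]
    by_cases hxy : x = y
    · subst hxy
      simp [Matrix.single_apply]
    · rw [if_neg hxy]
      apply Finset.sum_eq_zero
      intro b _
      split_ifs with hk
      · rw [Matrix.single_apply, if_neg]
        rintro ⟨h1, h2⟩
        apply hxy
        ext1 k
        by_cases hki : k = i
        · rw [hki, ← h1, ← h2]
        · exact hk k hki
      · rfl
  | seq p q ihp ihq => simp [run, ihp, ihq]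
  | par p q ihp ihq => simp [run, ihp, ihq]

theorem posSemidef_run (p : Prog W) {ρ : Op W} (hρ : ρ.PosSemidef) : (p.run ρ).PosSemidef := by
  induction p generalizing ρ with
  | skip => exact hρ
  | had i => exact hρ.mul_mul_conjTranspose_same _
  | phase i => exact hρ.mul_mul_conjTranspose_same _
  | cnot i j h => exact hρ.mul_mul_conjTranspose_same _
  | meas i k ih =>
    exact Matrix.posSemidef_sum _ fun b _ => ih b (hρ.mul_mul_conjTranspose_same _)
  | seq p q ihp ihq => exact ihq (ihp hρ)
  | par p q ihp ihq => exact ihq (ihp hρ)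

end Prog

/-! ### The channel of a circuit -/

namespace Circuit

section

variable {W : Type} [Fintype W] [DecidableEq W]

/-- The sum over all `x` visits every assignment of the wires other than `i` twice. -/
theorem reduceTo_eq_sum (i : W) (ρ : Op W) :
    reduceTo i ρ = (1 / 2 : ℂ) • ∑ x : W → Fin 2,
      ρ.submatrix (fun b => Function.update x i b) (fun b => Function.update x i b) := by
  ext b b'
  have h1 : reduceTo i ρ b b' =
      ∑ x : W → Fin 2, if x i = b then ρ x (Function.update x i b') else 0 := by
    unfold reduceTo
    apply Finset.sum_congr rfl
    intro x _
    rw [Finset.sum_eq_single (Function.update x i b')]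
    · apply if_congr _ rfl rfl
      constructor
      · exact fun h => h.1
      · intro h
        refine ⟨h, by simp, fun k hk => by simp [hk]⟩
    · intro y _ hy
      rw [if_neg]
      rintro ⟨_, h2, h3⟩
      apply hy
      rw [forall_ne_eq_iff] at h3
      rw [h3, h2]
    · simp
  let e : Fin 2 × (W → Fin 2) → Fin 2 × (W → Fin 2) :=
    fun p => (p.2 i, Function.update p.2 i p.1)
  have he : Function.Involutive e := by
    rintro ⟨c, x⟩
    simp [e]
  have h2 := Equiv.sum_comp he.toPerm
    (fun p : Fin 2 × (W → Fin 2) => if p.2 i = b then ρ p.2 (Function.update p.2 i b') else 0)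
  rw [Fintype.sum_prod_type, Fintype.sum_prod_type] at h2
  simp only [Function.Involutive.coe_toPerm, e, Function.update_self, Function.update_idem] at h2
  rw [Finset.sum_comm] at h2
  simp only [Finset.sum_ite_eq', Finset.mem_univ, if_true] at h2
  rw [Fin.sum_univ_two] at h2
  rw [h1, Matrix.smul_apply, Matrix.sum_apply]
  simp only [Matrix.submatrix_apply]
  rw [h2, smul_eq_mul]
  ring

theorem reduceTo_add (i : W) (ρ σ : Op W) :
    reduceTo i (ρ + σ) = reduceTo i ρ + reduceTo i σ := by
  simp [reduceTo_eq_sum, Finset.sum_add_distrib, Matrix.submatrix_add]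

theorem reduceTo_smul (i : W) (c : ℂ) (ρ : Op W) :
    reduceTo i (c • ρ) = c • reduceTo i ρ := by
  simp [reduceTo_eq_sum, Matrix.submatrix_smul, ← Finset.smul_sum, smul_comm c]

theorem posSemidef_reduceTo (i : W) {ρ : Op W} (hρ : ρ.PosSemidef) :
    (reduceTo i ρ).PosSemidef := by
  rw [reduceTo_eq_sum]
  refine Matrix.PosSemidef.smul (Matrix.posSemidef_sum _ fun x _ => hρ.submatrix _) ?_
  rw [Complex.le_def]; norm_num

theorem trace_reduceTo (i : W) (ρ : Op W) : (reduceTo i ρ).trace = ρ.trace := by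
  have : ∀ b, reduceTo i ρ b b = ∑ x : W → Fin 2, if x i = b then ρ x x else 0 := by
    intro b
    unfold reduceTo
    apply Finset.sum_congr rfl
    intro x _
    rw [Finset.sum_eq_single x]
    · simp
    · intro y _ hy
      rw [if_neg]
      rintro ⟨h1, h2, h3⟩
      apply hy
      rw [forall_ne_eq_iff] at h3
      rw [h3, h2, ← h1]
      simp
    · simp
  simp only [Matrix.trace, Matrix.diag, this]
  rw [Finset.sum_comm]
  simp

end

section

variable {n a : ℕ}

/-- The isometry `|u⟩ ↦ |u⟩|0…0⟩`. -/
noncomputable def ancillaIsometry (n a : ℕ) :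
    Matrix (Fin n ⊕ Fin a → Fin 2) (Fin n → Fin 2) ℂ :=
  Matrix.of fun x u => if (∀ k, x (Sum.inr k) = 0) ∧ x ∘ Sum.inl = u then 1 else 0

theorem addAncillas_eq (ρ : Op (Fin n)) :
    addAncillas a ρ = ancillaIsometry n a * ρ * (ancillaIsometry n a)ᴴ := by
  ext x y
  simp only [ancillaIsometry, Matrix.mul_apply,
    Matrix.conjTranspose_apply, Matrix.of_apply, addAncillas]
  by_cases hx : ∀ k, x (Sum.inr k) = 0 <;> by_cases hy : ∀ k, y (Sum.inr k) = 0 <;>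
    simp [hx, hy]

theorem ancillaIsometry_conjTranspose_mul_self :
    (ancillaIsometry n a)ᴴ * ancillaIsometry n a = 1 := by
  ext u v
  simp only [ancillaIsometry, Matrix.mul_apply, Matrix.conjTranspose_apply, Matrix.of_apply,
    Matrix.one_apply]
  rw [Finset.sum_eq_single (Sum.elim u 0)]
  · by_cases h : u = v <;> simp [h]
  · intro x _ hx
    rw [if_neg, star_zero, zero_mul]
    rintro ⟨h1, h2⟩
    apply hx
    ext1 k
    rcases k with k | k
    · simp [← h2]
    · simp [h1]
  · simp

theorem trace_addAncillas (ρ : Op (Fin n)) : (addAncillas a ρ).trace = ρ.trace := by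
  rw [addAncillas_eq, Matrix.trace_mul_comm, ← Matrix.mul_assoc,
    ancillaIsometry_conjTranspose_mul_self, Matrix.one_mul]

/-- The channel of a circuit as a linear map. -/
noncomputable def channelₗ (D : Circuit n) : Op (Fin n) →ₗ[ℂ] Matrix (Fin 2) (Fin 2) ℂ where
  toFun := D.channel
  map_add' ρ σ := by
    simp [channel, addAncillas_eq, Matrix.mul_add, Matrix.add_mul, Prog.run_add, reduceTo_add]
  map_smul' c ρ := by
    simp [channel, addAncillas_eq, Prog.run_smul, reduceTo_smul]

theorem channelₗ_apply (D : Circuit n) (ρ : Op (Fin n)) : D.channelₗ ρ = D.channel ρ := rfl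

theorem trace_channel (D : Circuit n) (ρ : Op (Fin n)) : (D.channel ρ).trace = ρ.trace := by
  rw [channel, trace_reduceTo, Prog.trace_run, trace_addAncillas]

theorem posSemidef_channel (D : Circuit n) {ρ : Op (Fin n)} (hρ : ρ.PosSemidef) :
    (D.channel ρ).PosSemidef := by
  rw [channel, addAncillas_eq]
  exact posSemidef_reduceTo _ (D.prog.posSemidef_run (hρ.mul_mul_conjTranspose_same _))

end

end Circuit

/-! ### The magic basis -/

/-- `e^{iπ/4}`. -/
noncomputable def omega : ℂ := Complex.exp (Complex.I * (Real.pi / 4))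

theorem omega_sq : omega ^ 2 = Complex.I := by
  rw [omega, ← Complex.exp_nat_mul]
  convert Complex.exp_pi_div_two_mul_I using 2
  push_cast; ring

theorem star_omega_mul_omega : star omega * omega = 1 := by
  rw [omega, Complex.star_def, ← Complex.exp_conj, ← Complex.exp_add]
  simp [map_ofNat (starRingEnd ℂ) 4]

theorem omega_mul_star_omega : omega * star omega = 1 := by
  rw [mul_comm, star_omega_mul_omega]

theorem omega_ne_zero : omega ≠ 0 := Complex.exp_ne_zero _

/-- The magic basis of one qubit: `|T⟩` for `0` and `|T^⊥⟩` for `1`. -/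
noncomputable def magicKet (s : Fin 2) : Fin 2 → ℂ := if s = 0 then ketT else ketTperp

/-- The relative phase `±e^{iπ/4}` of the basis state `magicKet s`. -/
noncomputable def magicPhase (s : Fin 2) : ℂ := (-1) ^ (s : ℕ) * omega

theorem magicKet_zero_apply (s : Fin 2) : magicKet s 0 = ((1 / Real.sqrt 2 : ℝ) : ℂ) := by
  fin_cases s <;> simp [magicKet, ketT, ketTperp, gateT, ketPlus, ketMinus]

theorem magicKet_one_apply (s : Fin 2) :
    magicKet s 1 = magicPhase s * ((1 / Real.sqrt 2 : ℝ) : ℂ) := by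
  fin_cases s <;>
    simp [magicKet, magicPhase, ketT, ketTperp, gateT, ketPlus, ketMinus, omega, mul_comm]

theorem magicPhase_ne_zero (s : Fin 2) : magicPhase s ≠ 0 := by
  simp [magicPhase, omega_ne_zero]

theorem inv_sqrt_two_mul_self :
    ((1 / Real.sqrt 2 : ℝ) : ℂ) * ((1 / Real.sqrt 2 : ℝ) : ℂ) = 1 / 2 := by
  rw [← Complex.ofReal_mul, div_mul_div_comm, Real.mul_self_sqrt (by norm_num)]
  norm_num

theorem star_magicKet_dotProduct (s s' : Fin 2) :
    star (magicKet s) ⬝ᵥ magicKet s' = if s = s' then 1 else 0 := by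
  have h := inv_sqrt_two_mul_self
  have ho := star_omega_mul_omega
  simp only [dotProduct, Fin.sum_univ_two, Pi.star_apply, magicKet_zero_apply, magicKet_one_apply,
    map_mul, Complex.star_def, Complex.conj_ofReal, magicPhase] at *
  fin_cases s <;> fin_cases s' <;>
    simp only [Fin.zero_eta, Fin.mk_one, Fin.isValue, pow_zero, pow_one, if_true, zero_ne_one,
      one_ne_zero, if_false, map_neg, map_one]
  · linear_combination (1 + (starRingEnd ℂ) omega * omega) * h + 1 / 2 * ho
  · linear_combination (1 - (starRingEnd ℂ) omega * omega) * h - 1 / 2 * ho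
  · linear_combination (1 - (starRingEnd ℂ) omega * omega) * h - 1 / 2 * ho
  · linear_combination (1 + (starRingEnd ℂ) omega * omega) * h + 1 / 2 * ho

theorem proj_posSemidef (ψ : Fin 2 → ℂ) : (proj ψ).PosSemidef :=
  Matrix.posSemidef_vecMulVec_self_star ψ

theorem trace_proj_magicKet (s : Fin 2) : (proj (magicKet s)).trace = 1 := by
  rw [proj, Matrix.trace_vecMulVec, dotProduct_comm, star_magicKet_dotProduct, if_pos rfl]

section

variable {W : Type} [Fintype W] [DecidableEq W]

/-- The product state with `|T⟩` on the wires where `s` is `0` and `|T^⊥⟩` where it is `1`. -/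
noncomputable def magicState (s : W → Fin 2) : Op W := prodOp fun i => proj (magicKet (s i))

theorem magicState_posSemidef (s : W → Fin 2) : (magicState s).PosSemidef :=
  posSemidef_prodOp fun _ => proj_posSemidef _

theorem trace_magicState (s : W → Fin 2) : (magicState s).trace = 1 := by
  simp [magicState, trace_prodOp, trace_proj_magicKet]

/-- The probability of `s` when the coordinates are independent and equal `1` with
probability `ε`. -/
noncomputable def iidWeight (ε : ℝ) (s : W → Fin 2) : ℝ := ∏ i, if s i = 0 then 1 - ε else ε

/-- The expectation of `X` when the coordinates are independent and equal `1` with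
probability `ε`. -/
noncomputable def iidExp (ε : ℝ) (X : (W → Fin 2) → ℝ) : ℝ := ∑ s, iidWeight ε s * X s

theorem prodOp_noisyT (ε : ℝ) :
    prodOp (fun _ : W => noisyT ε) = ∑ s, ((iidWeight ε s : ℝ) : ℂ) • magicState s := by
  have hn : ∀ a b, noisyT ε a b =
      ∑ c : Fin 2, ((if c = 0 then 1 - ε else ε : ℝ) : ℂ) * proj (magicKet c) a b := by
    intro a b
    simp [noisyT, magicKet]
  ext x y
  rw [Matrix.sum_apply]
  simp only [prodOp, Matrix.smul_apply, magicState, iidWeight, Complex.ofReal_prod, smul_eq_mul,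
    ← Finset.prod_mul_distrib, hn]
  rw [Finset.prod_univ_sum, Fintype.piFinset_univ]

theorem iidWeight_nonneg {ε : ℝ} (h0 : 0 ≤ ε) (h1 : ε ≤ 1) (s : W → Fin 2) :
    0 ≤ iidWeight ε s :=
  Finset.prod_nonneg fun i _ => by split_ifs <;> linarith

theorem sum_iidWeight (ε : ℝ) : ∑ s : W → Fin 2, iidWeight ε s = 1 := by
  simp only [iidWeight]
  rw [← Fintype.piFinset_univ, ← Finset.prod_univ_sum (fun _ => Finset.univ)
    (fun (_ : W) (b : Fin 2) => if b = 0 then 1 - ε else ε)]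
  simp

theorem iidExp_mono {ε : ℝ} (h0 : 0 ≤ ε) (h1 : ε ≤ 1) {X Y : (W → Fin 2) → ℝ}
    (h : ∀ s, X s ≤ Y s) : iidExp ε X ≤ iidExp ε Y :=
  Finset.sum_le_sum fun s _ => mul_le_mul_of_nonneg_left (h s) (iidWeight_nonneg h0 h1 s)

theorem iidExp_const (ε c : ℝ) : iidExp ε (fun _ : W → Fin 2 => c) = c := by
  rw [iidExp, ← Finset.sum_mul, sum_iidWeight, one_mul]

theorem iidExp_sum {ι : Type*} (ε : ℝ) (t : Finset ι) (X : ι → (W → Fin 2) → ℝ) :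
    iidExp ε (fun s => ∑ j ∈ t, X j s) = ∑ j ∈ t, iidExp ε (X j) := by
  simp only [iidExp, Finset.mul_sum]
  exact Finset.sum_comm

theorem iidExp_const_mul (ε c : ℝ) (X : (W → Fin 2) → ℝ) :
    iidExp ε (fun s => c * X s) = c * iidExp ε X := by
  simp only [iidExp, Finset.mul_sum]
  exact Finset.sum_congr rfl fun s _ => by ring

/-- Functions of disjoint sets of coordinates are independent: exchanging the coordinates outside
`A` between two independent samples preserves their joint weight. -/
theorem iidExp_mul_of_dependsOn (ε : ℝ) {X Y : (W → Fin 2) → ℝ} (A : Finset W)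
    (hX : ∀ s s', (∀ i ∈ A, s i = s' i) → X s = X s')
    (hY : ∀ s s', (∀ i ∉ A, s i = s' i) → Y s = Y s') :
    iidExp ε (fun s => X s * Y s) = iidExp ε X * iidExp ε Y := by
  let e : (W → Fin 2) × (W → Fin 2) → (W → Fin 2) × (W → Fin 2) :=
    fun p => (A.piecewise p.1 p.2, A.piecewise p.2 p.1)
  have he : Function.Involutive e := by
    rintro ⟨s, s'⟩
    ext i <;> by_cases h : i ∈ A <;> simp [e, h]
  have hw : ∀ s s', iidWeight ε (A.piecewise s s') * iidWeight ε (A.piecewise s' s) =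
      iidWeight ε s * iidWeight ε s' := by
    intro s s'
    simp only [iidWeight, ← Finset.prod_mul_distrib]
    apply Finset.prod_congr rfl
    intro i _
    by_cases h : i ∈ A
    · simp [h]
    · simp only [h, not_false_eq_true, Finset.piecewise_eq_of_notMem]
      ring
  have h := Equiv.sum_comp he.toPerm (fun p : (W → Fin 2) × (W → Fin 2) =>
    iidWeight ε p.1 * iidWeight ε p.2 * (X p.1 * Y p.1))
  simp only [Function.Involutive.coe_toPerm, e, hw, Fintype.sum_prod_type] at h
  have h1 : ∀ s s', X (A.piecewise s s') = X s := fun s s' =>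
    hX _ _ fun i hi => by simp [hi]
  have h2 : ∀ s s', Y (A.piecewise s s') = Y s' := fun s s' =>
    hY _ _ fun i hi => by simp [hi]
  simp only [h1, h2] at h
  simp only [iidExp]
  rw [Finset.sum_mul_sum]
  calc _ = ∑ s : W → Fin 2, ∑ s' : W → Fin 2,
        iidWeight ε s * iidWeight ε s' * (X s * Y s) := by
        apply Finset.sum_congr rfl
        intro s _
        rw [← Finset.sum_mul, ← Finset.mul_sum, sum_iidWeight, mul_one]
    _ = _ := by
        rw [← h]
        refine Finset.sum_congr rfl fun s _ => Finset.sum_congr rfl fun s' _ => by ring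

end

/-! ### Infidelity -/

/-- The infidelity `1 - ⟨T|M|T⟩`. -/
noncomputable def infidelity (M : Matrix (Fin 2) (Fin 2) ℂ) : ℝ :=
  1 - (star ketT ⬝ᵥ (M *ᵥ ketT)).re

/-- On independent noisy inputs, the infidelity of the output is the average of the infidelities
over the error patterns. -/
theorem infidelity_channel_noisyT {n : ℕ} (D : Circuit n) (ε : ℝ) :
    infidelity (D.channel (prodOp fun _ => noisyT ε)) =
      iidExp ε fun s => infidelity (D.channel (magicState s)) := by
  rw [prodOp_noisyT]
  simp only [← Circuit.channelₗ_apply, map_sum, map_smul, infidelity, iidExp, mul_sub, mul_one,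
    Finset.sum_sub_distrib, sum_iidWeight]
  simp only [Matrix.sum_mulVec, dotProduct_sum, Matrix.smul_mulVec, dotProduct_smul,
    Complex.re_sum, smul_eq_mul, Complex.re_ofReal_mul]

/-! ### A calculus of weakest preconditions -/

namespace Prog

variable {W : Type} [Fintype W] [DecidableEq W]

/-- The vectors that every Kraus operator of the program (one for each sequence of measurement
outcomes) maps into the subspace `Q`. -/
noncomputable def wp : Prog W → Submodule ℂ ((W → Fin 2) → ℂ) → Submodule ℂ ((W → Fin 2) → ℂ)
  | skip, Q => Q
  | had i, Q => Q.comap (onWire i gateH).mulVecLin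
  | phase i, Q => Q.comap (onWire i gateP).mulVecLin
  | cnot i j _, Q => Q.comap (cnotOp i j).mulVecLin
  | meas i k, Q => ⨅ b : Fin 2, ((k b).wp Q).comap (onWire i (Matrix.single b b 1)).mulVecLin
  | seq p q, Q => p.wp (q.wp Q)
  | par p q, Q => p.wp (q.wp Q)

theorem mem_wp_meas {i : W} {k : Fin 2 → Prog W} {Q : Submodule ℂ ((W → Fin 2) → ℂ)}
    {v : (W → Fin 2) → ℂ} :
    v ∈ (meas i k).wp Q ↔ ∀ b, onWire i (Matrix.single b b 1) *ᵥ v ∈ (k b).wp Q := by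
  simp [wp]

theorem wp_mono (p : Prog W) {Q Q' : Submodule ℂ ((W → Fin 2) → ℂ)} (h : Q ≤ Q') :
    p.wp Q ≤ p.wp Q' := by
  induction p generalizing Q Q' with
  | skip => exact h
  | had i => exact Submodule.comap_mono h
  | phase i => exact Submodule.comap_mono h
  | cnot i j _ => exact Submodule.comap_mono h
  | meas i k ih => exact iInf_mono fun b => Submodule.comap_mono (ih b h)
  | seq p q ihp ihq => exact ihp (ihq h)
  | par p q ihp ihq => exact ihp (ihq h)

/-- If the range of `ρ` lies in the weakest precondition of `Q`, then the range of the output lies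
in `Q`. -/
theorem run_mulVec_mem (p : Prog W) {Q : Submodule ℂ ((W → Fin 2) → ℂ)} {ρ : Op W}
    (h : ∀ u, ρ *ᵥ u ∈ p.wp Q) (u : (W → Fin 2) → ℂ) : p.run ρ *ᵥ u ∈ Q := by
  induction p generalizing Q ρ u with
  | skip => exact h u
  | had i =>
    rw [run, ← Matrix.mulVec_mulVec, ← Matrix.mulVec_mulVec]
    exact h _
  | phase i =>
    rw [run, ← Matrix.mulVec_mulVec, ← Matrix.mulVec_mulVec]
    exact h _
  | cnot i j _ =>
    rw [run, ← Matrix.mulVec_mulVec, ← Matrix.mulVec_mulVec]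
    exact h _
  | meas i k ih =>
    rw [run, Matrix.sum_mulVec]
    refine Submodule.sum_mem _ fun b _ => ih b (fun u => ?_) u
    rw [← Matrix.mulVec_mulVec, ← Matrix.mulVec_mulVec]
    exact mem_wp_meas.mp (h _) b
  | seq p q ihp ihq => exact ihq (fun u => ihp h u) u
  | par p q ihp ihq => exact ihq (fun u => ihp h u) u

end Prog

section Gates

variable {W : Type} [Fintype W] [DecidableEq W]

theorem phase_mulVec (i : W) (v : (W → Fin 2) → ℂ) :
    onWire i gateP *ᵥ v = fun x => Complex.I ^ (x i).val * v x := by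
  ext x
  rw [onWire_mulVec, Fin.sum_univ_two]
  have h : ∀ b : Fin 2, b = 0 ∨ b = 1 := by decide
  have hx : Function.update x i (x i) = x := Function.update_eq_self i x
  rcases h (x i) with hb | hb <;> rw [hb] at hx <;> simp [hb, gateP, hx]

theorem measure_mulVec (i : W) (b : Fin 2) (v : (W → Fin 2) → ℂ) :
    onWire i (Matrix.single b b 1) *ᵥ v = fun x => if x i = b then v x else 0 := by
  ext x
  rw [onWire_mulVec]
  split_ifs with h
  · rw [Finset.sum_eq_single b]
    · rw [← h, Function.update_eq_self]
      simp
    · intro c _ hc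
      simp [Ne.symm hc]
    · simp
  · apply Finset.sum_eq_zero
    intro c _
    simp [Ne.symm h]

theorem hadamard_mulVec (i : W) (v : (W → Fin 2) → ℂ) :
    onWire i gateH *ᵥ v = fun x => ((1 / Real.sqrt 2 : ℝ) : ℂ) *
      (v (Function.update x i 0) + (-1) ^ (x i).val * v (Function.update x i 1)) := by
  ext x
  rw [onWire_mulVec, Fin.sum_univ_two]
  have h : ∀ b : Fin 2, b = 0 ∨ b = 1 := by decide
  rcases h (x i) with hb | hb <;> simp [hb, gateH] <;> ring

end Gates

/-! ### Vectors with a known dependence on some of the wires -/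

section PhaseOn

variable {W : Type} [Fintype W] [DecidableEq W]

/-- The vectors that depend on the wires in `S` through the factor `Θ` only (where `Θ` does not
vanish, the quotient by `Θ` does not depend on these wires). -/
def phaseOn (S : Set W) (Θ : (W → Fin 2) → ℂ) : Submodule ℂ ((W → Fin 2) → ℂ) where
  carrier := {v | ∀ x x' : W → Fin 2, (∀ k ∉ S, x k = x' k) → Θ x' * v x = Θ x * v x'}
  zero_mem' := by simp
  add_mem' := by
    intro v v' h h' x x' hx
    simp only [Pi.add_apply, mul_add, h x x' hx, h' x x' hx]
  smul_mem' := by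
    intro c v h x x' hx
    simp only [Pi.smul_apply, smul_eq_mul, mul_left_comm _ c, h x x' hx]

theorem phaseOn_mono {S S' : Set W} (h : S' ⊆ S) (Θ : (W → Fin 2) → ℂ) :
    phaseOn S Θ ≤ phaseOn S' Θ :=
  fun _ hv x x' hx => hv x x' fun k hk => hx k fun hk' => hk (h hk')

/-- The vectors `v ⊗ (|0⟩ + ζ |1⟩)`, with the second factor on the wire `w`. -/
abbrev hasPhase (w : W) (ζ : ℂ) : Submodule ℂ ((W → Fin 2) → ℂ) :=
  phaseOn {w} fun x => ζ ^ (x w).val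

theorem apply_update_one {w : W} {ζ : ℂ} {v : (W → Fin 2) → ℂ} (hv : v ∈ hasPhase w ζ)
    (x : W → Fin 2) : v (Function.update x w 1) = ζ * v (Function.update x w 0) := by
  have := hv (Function.update x w 1) (Function.update x w 0) fun k hk => by
    simp [Function.update_of_ne hk]
  simpa using this

theorem mem_hasPhase_of_phaseOn {S : Set W} {w : W} (hw : w ∈ S) {ζ : ℂ}
    {R : (W → Fin 2) → ℂ} (hR : ∀ x, R x ≠ 0) (hR' : ∀ x b, R (Function.update x w b) = R x)
    {v : (W → Fin 2) → ℂ} (hv : v ∈ phaseOn S fun x => ζ ^ (x w).val * R x) :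
    v ∈ hasPhase w ζ := by
  intro x x' hx
  have h := hv x x' fun k hk => hx k fun h => hk (by rw [h]; exact hw)
  have hxx' : x' = Function.update x w (x' w) := (forall_ne_eq_iff w x x').mp hx
  have hRR : R x' = R x := by rw [hxx', hR']
  simp only [hRR] at h
  apply mul_left_cancel₀ (hR x)
  linear_combination h

/-- A single-qubit operator on a wire outside `S` preserves the dependence on `S`. -/
theorem onWire_mulVec_mem_phaseOn {S : Set W} {Θ : (W → Fin 2) → ℂ} {i : W} (hi : i ∉ S)
    (hΘ : ∀ x b, Θ (Function.update x i b) = Θ x) (G : Matrix (Fin 2) (Fin 2) ℂ)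
    {v : (W → Fin 2) → ℂ} (hv : v ∈ phaseOn S Θ) : onWire i G *ᵥ v ∈ phaseOn S Θ := by
  intro x x' hx
  rw [onWire_mulVec, onWire_mulVec, Finset.mul_sum, Finset.mul_sum]
  apply Finset.sum_congr rfl
  intro c _
  have h := hv (Function.update x i c) (Function.update x' i c) fun k hk => by
    by_cases hki : k = i
    · subst hki; simp
    · simp [hki, hx k hk]
  rw [hΘ, hΘ] at h
  rw [hx i hi]
  linear_combination G (x' i) c * h

theorem cnotOp_mulVec_mem_phaseOn {S : Set W} {Θ : (W → Fin 2) → ℂ} {i j : W} (hij : i ≠ j)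
    (hi : i ∉ S) (hj : j ∉ S) (hΘ : ∀ x b, Θ (Function.update x j b) = Θ x)
    {v : (W → Fin 2) → ℂ} (hv : v ∈ phaseOn S Θ) : cnotOp i j *ᵥ v ∈ phaseOn S Θ := by
  intro x x' hx
  rw [cnotOp_mulVec hij, cnotOp_mulVec hij]
  have h := hv (Function.update x j (x j + x i)) (Function.update x' j (x' j + x' i))
    fun k hk => by
      by_cases hki : k = j
      · subst hki; simp [hx k hk, hx i hi]
      · simp [hki, hx k hk]
  rwa [hΘ, hΘ] at h

/-- Frame rule: a program preserves the state of the wires that it does not touch. -/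
theorem hasPhase_le_wp {p : Prog W} {w : W} (hw : w ∉ p.wires) (ζ : ℂ) :
    hasPhase w ζ ≤ p.wp (hasPhase w ζ) := by
  have hΘ : ∀ i : W, w ≠ i → ∀ (x : W → Fin 2) (b : Fin 2),
      ζ ^ (Function.update x i b w).val = ζ ^ (x w).val := by
    intro i hi x b
    rw [Function.update_of_ne hi]
  induction p with
  | skip => exact le_rfl
  | had i => exact fun v hv => onWire_mulVec_mem_phaseOn (fun h => hw h.symm) (hΘ i hw) _ hv
  | phase i => exact fun v hv => onWire_mulVec_mem_phaseOn (fun h => hw h.symm) (hΘ i hw) _ hv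
  | cnot i j hij =>
    simp only [Prog.wires, Set.mem_insert_iff, Set.mem_singleton_iff, not_or] at hw
    exact fun v hv => cnotOp_mulVec_mem_phaseOn hij (fun h => hw.1 h.symm)
      (fun h => hw.2 h.symm) (hΘ j hw.2) hv
  | meas i k ih =>
    simp only [Prog.wires, Set.mem_union, Set.mem_singleton_iff, Set.mem_iUnion, not_or,
      not_exists] at hw
    refine fun v hv => Prog.mem_wp_meas.mpr fun b => ih b (hw.2 b) ?_
    exact onWire_mulVec_mem_phaseOn (fun h => hw.1 h.symm) (hΘ i hw.1) _ hv
  | seq p q ihp ihq =>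
    simp only [Prog.wires, Set.mem_union, not_or] at hw
    exact (ihp hw.1).trans (p.wp_mono (ihq hw.2))
  | par p q ihp ihq =>
    simp only [Prog.wires, Set.mem_union, not_or] at hw
    exact (ihp hw.1).trans (p.wp_mono (ihq hw.2))

theorem mem_phaseOn_of_forall_hasPhase {ι : Type*} [DecidableEq ι] {w : ι → W}
    (hw : Function.Injective w) {ζ : ι → ℂ} {v : (W → Fin 2) → ℂ} (A : Finset ι)
    (hv : ∀ i ∈ A, v ∈ hasPhase (w i) (ζ i)) :
    v ∈ phaseOn (w '' A) fun x => ∏ i ∈ A, ζ i ^ (x (w i)).val := by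
  induction A using Finset.induction_on with
  | empty =>
    intro x x' hx
    have : x = x' := funext fun k => hx k (by simp)
    simp [this]
  | insert a A ha ih =>
    intro x x' hx
    let z := Function.update x (w a) (x' (w a))
    have h1 := hv a (Finset.mem_insert_self a A) x z fun k hk => by
      simp [z, Function.update_of_ne hk]
    have h2 := ih (fun i hi => hv i (Finset.mem_insert_of_mem hi)) z x' fun k hk => by
      by_cases hka : k = w a
      · subst hka; simp [z]
      · rw [← hx k]
        · simp [z, Function.update_of_ne hka]
        · rintro ⟨i, hi, rfl⟩
          rcases Finset.mem_insert.mp hi with rfl | hi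
          · exact hka rfl
          · exact hk ⟨i, hi, rfl⟩
    have hz : ∏ i ∈ A, ζ i ^ (z (w i)).val = ∏ i ∈ A, ζ i ^ (x (w i)).val := by
      refine Finset.prod_congr rfl fun i hi => ?_
      have : w i ≠ w a := fun h => ha (hw h ▸ hi)
      simp [z, Function.update_of_ne this]
    have hza : z (w a) = x' (w a) := by simp [z]
    simp only [hz, hza] at h1 h2
    simp only [Finset.prod_insert ha]
    linear_combination (∏ i ∈ A, ζ i ^ (x' (w i)).val) * h1 + ζ a ^ (x (w a)).val * h2

end PhaseOn

/-! ### Building blocks of circuits -/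

section Blocks

variable {W : Type}

/-- The programs of a list, one after the other. -/
def seqList (l : List (Prog W)) : Prog W := l.foldr .seq .skip

/-- The programs of a list in parallel. -/
def parList (l : List (Prog W)) : Prog W := l.foldr .par .skip

section

variable [DecidableEq W]

/-- CNOT with control `i` and target `j`, and nothing if `i = j`. -/
def cnotOrSkip (i j : W) : Prog W := if h : i = j then .skip else .cnot i j h

/-- CNOTs from the controls in `l` to the target `a`. -/
def cnots (l : List W) (a : W) : Prog W := seqList (l.map fun i => cnotOrSkip i a)

/-- Adding to the target `a` the sum of the controls in `l`. -/
def addTo (l : List W) (a : W) (x : W → Fin 2) : W → Fin 2 :=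
  Function.update x a (x a + (l.map x).sum)

/-- Rotating by `ζ` on the parity of the wires in `l`, using up a wire `a` in the state
`|0⟩ + ζ|1⟩`, where `ζ² = i`. If the measurement yields `1`, the rotation was by `ζ⁻¹`, up to a
global phase, and is repaired by the Clifford gate `P³` on the parity (up to a global phase,
since it acts on the negated parity). -/
def inject (l : List W) (a : W) : Prog W :=
  .seq (cnots l a) (.meas a fun b => if b = 0 then .skip else
    .seq (cnots l a) (.seq (.phase a) (.seq (.phase a) (.seq (.phase a) (cnots l a)))))

/-- Exchange of two wires. -/
def swapWires (i j : W) : Prog W :=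
  .seq (cnotOrSkip i j) (.seq (cnotOrSkip j i) (cnotOrSkip i j))

/-- Measurement in the `X` basis. -/
def measX (w : W) (k : Fin 2 → Prog W) : Prog W := .seq (.had w) (.meas w k)

end

variable [Fintype W] [DecidableEq W]

theorem mem_wp_cnotOrSkip {i j : W} (hij : i ≠ j) {Q : Submodule ℂ ((W → Fin 2) → ℂ)}
    {v : (W → Fin 2) → ℂ} :
    v ∈ (cnotOrSkip i j).wp Q ↔ (fun x => v (Function.update x j (x j + x i))) ∈ Q := by
  rw [cnotOrSkip, dif_neg hij]
  have : (cnotOp i j).mulVecLin v = fun x => v (Function.update x j (x j + x i)) := by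
    ext x
    exact cnotOp_mulVec hij v x
  simp only [Prog.wp, Submodule.mem_comap, this]

theorem mem_wp_cnots {l : List W} {a : W} (ha : a ∉ l) {Q : Submodule ℂ ((W → Fin 2) → ℂ)}
    {v : (W → Fin 2) → ℂ} : v ∈ (cnots l a).wp Q ↔ (fun x => v (addTo l a x)) ∈ Q := by
  induction l generalizing v with
  | nil =>
    have : (fun x => v (addTo [] a x)) = v := by ext x; simp [addTo]
    rw [this]
    exact Iff.rfl
  | cons i l ih =>
    simp only [List.mem_cons, not_or] at ha
    have h1 : v ∈ (cnots (i :: l) a).wp Q ↔ v ∈ (cnotOrSkip i a).wp ((cnots l a).wp Q) := Iff.rfl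
    rw [h1, mem_wp_cnotOrSkip (Ne.symm ha.1), ih ha.2]
    have h2 : ∀ x, Function.update (addTo l a x) a (addTo l a x a + addTo l a x i) =
        addTo (i :: l) a x := by
      intro x
      simp [addTo, Function.update_of_ne (Ne.symm ha.1), add_comm, add_left_comm]
    simp only [h2]

theorem addTo_addTo {l : List W} {a : W} (ha : a ∉ l) (x : W → Fin 2) :
    addTo l a (addTo l a x) = x := by
  have h : l.map (addTo l a x) = l.map x := by
    apply List.map_congr_left
    intro i hi
    have : i ≠ a := fun h => ha (h ▸ hi)
    simp [addTo, Function.update_of_ne this]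
  have h2 : ∀ a b : Fin 2, a + b + b = a := by decide
  unfold addTo at h ⊢
  rw [h]
  simp [h2]

/-- Correctness of `inject`. -/
theorem mem_wp_inject {l : List W} {a : W} (ha : a ∉ l) {S : Set W} (haS : a ∈ S) {ζ : ℂ}
    (hζ : ζ ^ 2 = Complex.I) {R : (W → Fin 2) → ℂ}
    (hR : ∀ x b, R (Function.update x a b) = R x) {v : (W → Fin 2) → ℂ}
    (hv : v ∈ phaseOn S fun x => ζ ^ (x a).val * R x) :
    v ∈ (inject l a).wp (phaseOn (S \ {a}) fun x => ζ ^ ((l.map x).sum).val * R x) := by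
  have hmap : ∀ x, (l.map (addTo l a x)) = l.map x := by
    intro x
    apply List.map_congr_left
    intro i hi
    have : i ≠ a := fun h => ha (h ▸ hi)
    simp [addTo, Function.update_of_ne this]
  have hself : ∀ x, addTo l a x a = x a + (l.map x).sum := by simp [addTo]
  have hRadd : ∀ x, R (addTo l a x) = R x := fun x => hR _ _
  have key : ∀ x x' : W → Fin 2, (∀ k ∉ S \ {a}, x k = x' k) →
      ζ ^ (x a + (l.map x').sum).val * R x' * v (addTo l a x) =
        ζ ^ (x a + (l.map x).sum).val * R x * v (addTo l a x') := by
    intro x x' hx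
    have hxa : x a = x' a := hx a (by simp)
    have h := hv (addTo l a x) (addTo l a x') fun k hk => by
      have hka : k ≠ a := fun h => hk (h ▸ haS)
      simp [addTo, Function.update_of_ne hka, hx k fun h => hk h.1]
    simpa only [hself, hRadd, ← hxa] using h
  have hcases : ∀ b : Fin 2, b = 0 ∨ b = 1 := by decide
  have h2 : ∀ a b : Fin 2, a + b + b = a := by decide
  rw [inject]
  refine (mem_wp_cnots ha).mpr (Prog.mem_wp_meas.mpr fun b => ?_)
  rw [measure_mulVec]
  rcases hcases b with rfl | rfl
  · rw [if_pos rfl]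
    intro x x' hx
    have hxa : x a = x' a := hx a (by simp)
    dsimp only
    rw [← hxa]
    split_ifs with h0
    · simpa [h0] using key x x' hx
    · simp
  · rw [if_neg one_ne_zero]
    refine (mem_wp_cnots ha).mpr ?_
    simp only [Prog.wp, Submodule.mem_comap, Matrix.mulVecLin_apply, phase_mulVec]
    refine (mem_wp_cnots ha).mpr ?_
    intro x x' hx
    have hxa : x a = x' a := hx a (by simp)
    simp only [addTo_addTo ha, hself, hmap, h2]
    rw [← hxa]
    by_cases h1 : x a = 1
    · have hk := key x x' hx
      rw [h1] at hk ⊢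
      simp only [if_true]
      have hI := Complex.I_mul_I
      rcases hcases (l.map x).sum with hp | hp <;> rcases hcases (l.map x').sum with hp' | hp' <;>
        rw [hp, hp'] at hk ⊢ <;> simp at hk ⊢ <;>
        first
          | linear_combination ζ * hk
          | linear_combination Complex.I ^ 2 * ζ * hk - Complex.I ^ 2 *
              (R x' * v (addTo l a x) - R x * v (addTo l a x')) * hζ
          | linear_combination Complex.I ^ 3 * ζ * hk + R x * v (addTo l a x') *
              (Complex.I ^ 3 * hζ + (Complex.I ^ 2 - 1) * hI)
          | linear_combination Complex.I ^ 3 * ζ * hk - R x' * v (addTo l a x) *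
              (Complex.I ^ 3 * hζ + (Complex.I ^ 2 - 1) * hI)
    · simp [h1]

end Blocks

theorem Fin.eq_zero_or_one (b : Fin 2) : b = 0 ∨ b = 1 := by omega

section Blocks

variable {W : Type} [Fintype W] [DecidableEq W]

/-- On a wire in the state `|0⟩ ± |1⟩` only one outcome of an `X` measurement occurs. -/
theorem mem_wp_measX {w : W} {k : Fin 2 → Prog W} {c : Fin 2}
    {Q : Submodule ℂ ((W → Fin 2) → ℂ)} {v : (W → Fin 2) → ℂ}
    (hv : v ∈ hasPhase w ((-1) ^ c.val))
    (hk : onWire w (Matrix.single c c 1) *ᵥ (onWire w gateH *ᵥ v) ∈ (k c).wp Q) :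
    v ∈ (measX w k).wp Q := by
  refine Prog.mem_wp_meas.mpr fun b => ?_
  by_cases hb : b = c
  · rw [hb]; exact hk
  · convert Submodule.zero_mem _
    simp only [Matrix.mulVecLin_apply, measure_mulVec, hadamard_mulVec]
    ext x
    rw [Pi.zero_apply, ite_eq_right_iff]
    intro hx
    rw [apply_update_one hv, hx]
    rcases Fin.eq_zero_or_one b with rfl | rfl <;> rcases Fin.eq_zero_or_one c with rfl | rfl <;>
      simp at hb ⊢

theorem mem_wp_swapWires {i j : W} (hij : i ≠ j) {ζ : ℂ} {v : (W → Fin 2) → ℂ}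
    (hv : v ∈ hasPhase j ζ) : v ∈ (swapWires i j).wp (hasPhase i ζ) := by
  refine (mem_wp_cnotOrSkip hij).mpr ((mem_wp_cnotOrSkip hij.symm).mpr
    ((mem_wp_cnotOrSkip hij).mpr ?_))
  have h1 : ∀ a b : Fin 2, b + a + (a + (b + a)) = a := by decide
  have h2 : ∀ a b : Fin 2, a + (b + a) = b := by decide
  have h3 : ∀ x : W → Fin 2,
      (Function.update (Function.update (Function.update x j (x j + x i)) i (x i + (x j + x i))) j
        (x j + x i + (x i + (x j + x i)))) = x ∘ Equiv.swap i j := by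
    intro x
    ext1 k
    rw [h1, h2]
    by_cases hkj : k = j
    · subst hkj; simp
    · by_cases hki : k = i
      · subst hki; simp [hkj]
      · simp [hkj, hki, Equiv.swap_apply_of_ne_of_ne hki hkj]
  intro x x' hx
  simp only [Function.update_self, ne_eq, hij, hij.symm, not_false_eq_true,
    Function.update_of_ne, h3]
  have := hv (x ∘ Equiv.swap i j) (x' ∘ Equiv.swap i j) fun k hk => by
    refine hx _ fun h => hk ?_
    simp only [Set.mem_singleton_iff] at h ⊢
    rw [Equiv.swap_apply_eq_iff] at h
    simpa using h
  simpa using this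

theorem wp_seqList_cons (p : Prog W) (l : List (Prog W)) (Q : Submodule ℂ ((W → Fin 2) → ℂ)) :
    (seqList (p :: l)).wp Q = p.wp ((seqList l).wp Q) := rfl

/-- Running `inject` for each wire of a list. -/
theorem mem_wp_seqList_inject {ι : Type*} {w : ι → W} (hw : Function.Injective w)
    {ctl : ι → List W} {ζ : ι → ℂ} (hζ : ∀ g, ζ g ^ 2 = Complex.I) {S : Set W} (L : List ι)
    (hL : L.Nodup) (hLS : ∀ g ∈ L, w g ∉ S) (hctl : ∀ g, ∀ a ∈ ctl g, a ∈ S)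
    {R : (W → Fin 2) → ℂ} (hR : ∀ g ∈ L, ∀ x b, R (Function.update x (w g) b) = R x)
    {v : (W → Fin 2) → ℂ}
    (hv : v ∈ phaseOn (S ∪ {a | ∃ g ∈ L, a = w g}) fun x =>
      (L.map fun g => ζ g ^ (x (w g)).val).prod * R x) :
    v ∈ (seqList (L.map fun g => inject (ctl g) (w g))).wp (phaseOn S fun x =>
      (L.map fun g => ζ g ^ (((ctl g).map x).sum).val).prod * R x) := by
  induction L generalizing R v with
  | nil => simpa [seqList, Prog.wp] using hv
  | cons g L ih =>
    have hgL : g ∉ L := (List.nodup_cons.mp hL).1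
    have hgS : w g ∉ S := hLS g (by simp)
    have hctlg : ∀ g', w g' ∉ S → ∀ (x : W → Fin 2) b,
        (ctl g).map (Function.update x (w g') b) = (ctl g).map x := by
      intro g' hg' x b
      apply List.map_congr_left
      intro a ha
      rw [Function.update_of_ne]
      rintro rfl
      exact hg' (hctl g _ ha)
    have h1 : v ∈ (inject (ctl g) (w g)).wp
        (phaseOn ((S ∪ {a | ∃ g' ∈ g :: L, a = w g'}) \ {w g}) fun x =>
          ζ g ^ (((ctl g).map x).sum).val * ((L.map fun g => ζ g ^ (x (w g)).val).prod * R x)) := by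
      apply mem_wp_inject (fun h => hgS (hctl g _ h)) (Or.inr ⟨g, by simp, rfl⟩) (hζ g)
      · intro x b
        rw [hR g (by simp)]
        congr 2
        apply List.map_congr_left
        intro g' hg'
        have : w g' ≠ w g := fun h => hgL (hw h ▸ hg')
        rw [Function.update_of_ne this]
      · have hΘ : (fun x : W → Fin 2 =>
            ((g :: L).map fun g => ζ g ^ (x (w g)).val).prod * R x) = fun x =>
            ζ g ^ (x (w g)).val * ((L.map fun g => ζ g ^ (x (w g)).val).prod * R x) := by
          ext1 x
          rw [List.map_cons, List.prod_cons, mul_assoc]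
        rw [← hΘ]
        exact hv
    rw [List.map_cons, wp_seqList_cons]
    refine Prog.wp_mono _ ?_ h1
    intro u hu
    have hu' := ih (R := fun x => ζ g ^ (((ctl g).map x).sum).val * R x) (v := u)
      (List.nodup_cons.mp hL).2 (fun g' hg' => hLS g' (by simp [hg'])) ?_ ?_
    · have hΘ : (fun x : W → Fin 2 =>
          ((g :: L).map fun g => ζ g ^ (((ctl g).map x).sum).val).prod * R x) = fun x =>
          (L.map fun g => ζ g ^ (((ctl g).map x).sum).val).prod *
            (ζ g ^ (((ctl g).map x).sum).val * R x) := by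
        ext1 x
        rw [List.map_cons, List.prod_cons]
        ring
      rw [hΘ]
      exact hu'
    · intro g' hg' x b
      simp only [hR g' (by simp [hg']), hctlg g' (hLS g' (by simp [hg']))]
    · simp only [mul_left_comm _ (ζ g ^ _)]
      refine phaseOn_mono ?_ _ hu
      rintro a (ha | ⟨g', hg', rfl⟩)
      · refine ⟨Or.inl ha, ?_⟩
        rintro rfl
        exact hgS ha
      · exact ⟨Or.inr ⟨g', by simp [hg'], rfl⟩, fun h => hgL (hw h ▸ hg')⟩

end Blocks

/-! ### The sixteen-to-one gadget -/

section Gadget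

/-- The linear functionals on `𝔽₂⁴`, given by their coefficients. They index the input wires of
the gadget. -/
abbrev Functional : Type := Fin 4 → Fin 2

/-- The value of the functional `g` at `y`. -/
def Functional.eval (g : Functional) (y : Fin 4 → Fin 2) : Fin 2 := ∑ j, g j * y j

/-- The `j`-th coordinate functional. -/
def coord (j : Fin 4) : Functional := Pi.single j 1

/-- The functionals other than `0` and the sum of the coordinates. -/
def rotations : Finset Functional := {0, 1}ᶜ

/-- The functionals other than `0`, the coordinates and their sum. -/
def supply : Finset Functional := {g ∈ rotations | ∀ j, g ≠ coord j}

/-- The coordinates that occur in `g`. -/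
def coordsOf (g : Functional) : List (Fin 4) := (List.finRange 4).filter fun j => g j = 1

/-- The gadget. The wires `coord j`, in the state `|T⟩`, are turned into an encoded state by one
rotation for each functional in `supply`; one CNOT per check decodes it, and the three checks are
measured. If they find no error, the output is the decoded state, corrected by a phase gate. If
they find an error, the output is the input on the wire `0`, which is not used otherwise. The wire
`1` is idle. -/
noncomputable def gadget {W : Type} [DecidableEq W] (w : Functional → W) : Prog W :=
  .seq (seqList (supply.toList.map fun g =>
      inject ((coordsOf g).map fun j => w (coord j)) (w g)))
    (.seq (cnots [w (coord 1), w (coord 2), w (coord 3)] (w (coord 0)))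
      (measX (w (coord 1)) fun b₁ => measX (w (coord 2)) fun b₂ => measX (w (coord 3)) fun b₃ =>
        if b₁ = 0 ∧ b₂ = 0 ∧ b₃ = 0 then .phase (w (coord 0)) else swapWires (w (coord 0)) (w 0)))

/-- The sum of the functionals whose rotation is affected by an error. -/
def syndrome (s : Functional → Fin 2) : Functional := fun j => ∑ g ∈ rotations, s g * g j

/-- Whether the output of the gadget is `|T^⊥⟩`, as a function of the error pattern of the
input. -/
def errorBit (s : Functional → Fin 2) : Fin 2 :=
  if ∀ j, syndrome s j = syndrome s 0 then syndrome s 0 else s 0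

theorem coord_injective : Function.Injective coord := by
  intro i j h
  by_contra hij
  have := congrFun h i
  simp [coord, hij] at this

/-- The identity on which the gadget rests: in total, the rotations act as `T⁻¹` on the sum of the
coordinates. -/
theorem sum_eval_rotations (y : Fin 4 → Fin 2) :
    ∑ g ∈ rotations, (Functional.eval g y).val + (Functional.eval 1 y).val =
      if y = 0 then 0 else 8 := by
  revert y
  decide +kernel

theorem sum_map_coordsOf (g : Functional) (y : Fin 4 → Fin 2) :
    ((coordsOf g).map y).sum = Functional.eval g y := by
  revert g y
  decide +kernel

theorem eval_coord (j : Fin 4) (y : Fin 4 → Fin 2) : Functional.eval (coord j) y = y j := by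
  revert j y
  decide +kernel

theorem rotations_eq : rotations = supply ∪ Finset.univ.image coord := by
  decide +kernel

theorem disjoint_supply : Disjoint supply (Finset.univ.image coord) := by
  decide +kernel

theorem neg_one_pow_add (a b : Fin 2) :
    (-1 : ℂ) ^ (a + b).val = (-1) ^ a.val * (-1) ^ b.val := by
  rcases Fin.eq_zero_or_one a with rfl | rfl <;> rcases Fin.eq_zero_or_one b with rfl | rfl <;>
    simp

theorem neg_one_pow_mul (a b : Fin 2) :
    (-1 : ℂ) ^ (a * b).val = ((-1) ^ a.val) ^ b.val := by
  rcases Fin.eq_zero_or_one a with rfl | rfl <;> rcases Fin.eq_zero_or_one b with rfl | rfl <;>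
    simp

theorem neg_one_pow_sum {ι : Type*} (A : Finset ι) (f : ι → Fin 2) :
    (-1 : ℂ) ^ (∑ i ∈ A, f i).val = ∏ i ∈ A, (-1 : ℂ) ^ (f i).val := by
  classical
  induction A using Finset.induction_on with
  | empty => simp
  | insert a A ha ih => rw [Finset.sum_insert ha, Finset.prod_insert ha, neg_one_pow_add, ih]

theorem omega_pow_eight : omega ^ 8 = 1 := by
  have : omega ^ 8 = (omega ^ 2) ^ 4 := by ring
  rw [this, omega_sq, Complex.I_pow_four]

open scoped Fin.CommRing in
theorem prod_magicPhase (s : Functional → Fin 2) (y : Fin 4 → Fin 2) :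
    ∏ g ∈ rotations, magicPhase (s g) ^ (Functional.eval g y).val =
      star omega ^ (Functional.eval 1 y).val * (-1) ^ (Functional.eval (syndrome s) y).val := by
  simp only [magicPhase, mul_pow, Finset.prod_mul_distrib, ← neg_one_pow_mul, ← neg_one_pow_sum]
  have h1 : ∑ g ∈ rotations, s g * Functional.eval g y = Functional.eval (syndrome s) y := by
    simp only [Functional.eval, syndrome, Finset.mul_sum, Finset.sum_mul]
    rw [Finset.sum_comm]
    simp only [mul_assoc]
  have h2 : ∏ g ∈ rotations, omega ^ (Functional.eval g y).val =
      star omega ^ (Functional.eval 1 y).val := by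
    rw [Finset.prod_pow_eq_pow_sum]
    have h3 : omega ^ (∑ g ∈ rotations, (Functional.eval g y).val) *
        omega ^ (Functional.eval 1 y).val = 1 := by
      rw [← pow_add, sum_eval_rotations]
      split_ifs
      · simp
      · exact omega_pow_eight
    apply mul_right_cancel₀ (pow_ne_zero (Functional.eval 1 y).val omega_ne_zero)
    rw [h3, ← mul_pow, star_omega_mul_omega, one_pow]
  rw [h1, h2, mul_comm]

theorem magicPhase_sq (s : Fin 2) : magicPhase s ^ 2 = Complex.I := by
  rw [magicPhase, mul_pow, omega_sq, ← pow_mul, mul_comm s.val, pow_mul]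
  simp

/-- The gadget corrects a single error: among the rotations its syndrome is the functional itself,
which is not constant and so selects the unused input; elsewhere the syndrome vanishes. -/
theorem exists_ne_of_errorBit_eq_one {s : Functional → Fin 2} (h : errorBit s = 1) :
    ∃ g g', g ≠ g' ∧ s g = 1 ∧ s g' = 1 := by
  by_contra! hc
  have hs : ∀ g₀, s g₀ = 1 → ∀ g, s g = if g = g₀ then 1 else 0 := by
    intro g₀ h₀ g
    split_ifs with hg
    · rw [hg, h₀]
    · exact (Fin.eq_zero_or_one (s g)).resolve_right fun h1 => hc g g₀ hg h1 h₀
  by_cases hex : ∃ g₀ ∈ rotations, s g₀ = 1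
  · obtain ⟨g₀, hr, h₀⟩ := hex
    have hsyn : syndrome s = g₀ := by
      ext1 j
      simp only [syndrome, hs g₀ h₀, ite_mul, one_mul, zero_mul]
      rw [Finset.sum_ite_eq' rotations g₀ (fun g => g j), if_pos hr]
    have hne : g₀ ≠ 0 ∧ g₀ ≠ 1 := by simpa [rotations] using hr
    rw [errorBit, hsyn] at h
    split_ifs at h with hj
    · exact hne.2 (funext fun j => by rw [hj, h]; rfl)
    · have := hs g₀ h₀ 0
      rw [if_neg (Ne.symm hne.1), h] at this
      exact one_ne_zero this
  · push Not at hex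
    have hsyn : syndrome s = 0 := by
      ext1 j
      refine Finset.sum_eq_zero fun g hg => ?_
      rw [(Fin.eq_zero_or_one (s g)).resolve_right (hex g hg), zero_mul]
    simp [errorBit, hsyn] at h

end Gadget

section

variable {W : Type} [Fintype W] [DecidableEq W]

theorem wp_seq (p q : Prog W) (Q : Submodule ℂ ((W → Fin 2) → ℂ)) :
    (Prog.seq p q).wp Q = p.wp (q.wp Q) := rfl

theorem wp_phase (i : W) (Q : Submodule ℂ ((W → Fin 2) → ℂ)) :
    (Prog.phase i).wp Q = Q.comap (onWire i gateP).mulVecLin := rfl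

theorem phase_mulVec_mem_hasPhase {w : W} {ζ : ℂ} {v : (W → Fin 2) → ℂ}
    (hv : v ∈ hasPhase w ζ) : onWire w gateP *ᵥ v ∈ hasPhase w (Complex.I * ζ) := by
  rw [phase_mulVec]
  intro x x' hx
  have h := hv x x' hx
  simp only [mul_pow] at h ⊢
  linear_combination Complex.I ^ (x w).val * Complex.I ^ (x' w).val * h

open scoped Fin.CommRing in
/-- The last stage of the gadget, applied to the encoded state. -/
theorem mem_wp_checks {d : Fin 4 → W} {f : W} (hd : Function.Injective d) (hf : ∀ j, d j ≠ f)
    {ζ : ℂ} (hζ : ζ ≠ 0) (h : Functional) {v : (W → Fin 2) → ℂ}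
    (hv : v ∈ phaseOn (insert f (Set.range d)) fun x => ζ ^ (x f).val *
      (star omega ^ (Functional.eval 1 fun j => x (d j)).val *
        (-1) ^ (Functional.eval h fun j => x (d j)).val)) :
    v ∈ (Prog.seq (cnots [d 1, d 2, d 3] (d 0))
      (measX (d 1) fun b₁ => measX (d 2) fun b₂ => measX (d 3) fun b₃ =>
        if b₁ = 0 ∧ b₂ = 0 ∧ b₃ = 0 then .phase (d 0) else swapWires (d 0) f)).wp
      (hasPhase (d 0) (if ∀ j, h j = h 0 then magicPhase (h 0) else ζ)) := by
  have hnot : d 0 ∉ [d 1, d 2, d 3] := by simp [hd.eq_iff]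
  rw [wp_seq, mem_wp_cnots hnot]
  set u : (W → Fin 2) → ℂ := fun x => v (addTo [d 1, d 2, d 3] (d 0) x) with hu
  have ho : star omega ≠ 0 := by
    intro h0
    have := star_omega_mul_omega
    rw [h0, zero_mul] at this
    exact zero_ne_one this
  -- After the decoding CNOTs, the amplitude is a product over the wires.
  let α : Fin 4 → ℂ := fun j =>
    if j = 0 then star omega * (-1) ^ (h 0).val else (-1) ^ (h j + h 0).val
  have hα : ∀ j, α j ≠ 0 := by
    intro j
    simp only [α]
    split_ifs
    · exact mul_ne_zero ho (pow_ne_zero _ (by norm_num))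
    · exact pow_ne_zero _ (by norm_num)
  have hu1 : u ∈ phaseOn (insert f (Set.range d)) fun x =>
      ζ ^ (x f).val * ∏ j, α j ^ (x (d j)).val := by
    have hΘ : ∀ x : W → Fin 2, ζ ^ (x f).val * ∏ j, α j ^ (x (d j)).val =
        (fun x => ζ ^ (x f).val *
          (star omega ^ (Functional.eval 1 fun j => x (d j)).val *
          (-1) ^ (Functional.eval h fun j => x (d j)).val)) (addTo [d 1, d 2, d 3] (d 0) x) := by
      intro x
      have hxf : addTo [d 1, d 2, d 3] (d 0) x f = x f := Function.update_of_ne (hf 0).symm _ _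
      have hx0 : addTo [d 1, d 2, d 3] (d 0) x (d 0) =
          x (d 0) + (x (d 1) + (x (d 2) + x (d 3))) := by simp [addTo]
      have hx : ∀ j, j ≠ 0 → addTo [d 1, d 2, d 3] (d 0) x (d j) = x (d j) :=
        fun j hj => Function.update_of_ne (hd.ne hj) _ _
      have h1 : ∀ a b c e : Fin 2, a + (b + (c + e)) + b + c + e = a := by decide
      have e1 : Functional.eval 1 (fun j => addTo [d 1, d 2, d 3] (d 0) x (d j)) = x (d 0) := by
        simp only [Functional.eval, Fin.sum_univ_four, Pi.one_apply, one_mul, hx0]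
        rw [hx 1 (by decide), hx 2 (by decide), hx 3 (by decide), h1]
      have e2 : Functional.eval h (fun j => addTo [d 1, d 2, d 3] (d 0) x (d j)) =
          h 0 * x (d 0) + ((h 1 + h 0) * x (d 1) + ((h 2 + h 0) * x (d 2) +
            (h 3 + h 0) * x (d 3))) := by
        simp only [Functional.eval, Fin.sum_univ_four, hx0]
        rw [hx 1 (by decide), hx 2 (by decide), hx 3 (by decide)]
        ring
      simp only [hxf, e1, e2, neg_one_pow_add, neg_one_pow_mul, Fin.prod_univ_four, α, if_true,
        one_ne_zero, if_false, show (2 : Fin 4) ≠ 0 by decide, show (3 : Fin 4) ≠ 0 by decide,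
        mul_pow]
      ring
    simp only [hΘ]
    intro x x' hx
    refine hv _ _ fun k hk => ?_
    have hk0 : k ≠ d 0 := fun h => hk (h ▸ Or.inr ⟨0, rfl⟩)
    simp [addTo, Function.update_of_ne hk0, hx k hk]
  have huf : u ∈ hasPhase f ζ := by
    refine mem_hasPhase_of_phaseOn (by simp) (fun x => ?_) (fun x b => ?_) hu1
    · exact Finset.prod_ne_zero_iff.mpr fun j _ => pow_ne_zero _ (hα j)
    · simp only [Function.update_of_ne (hf _)]
  have huj : ∀ j, u ∈ hasPhase (d j) (α j) := by
    intro j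
    have hΘ : ∀ x : W → Fin 2, ζ ^ (x f).val * ∏ j, α j ^ (x (d j)).val = α j ^ (x (d j)).val *
        (ζ ^ (x f).val * ∏ j' ∈ Finset.univ.erase j, α j' ^ (x (d j')).val) := by
      intro x
      rw [← Finset.mul_prod_erase Finset.univ _ (Finset.mem_univ j)]
      ring
    simp only [hΘ] at hu1
    refine mem_hasPhase_of_phaseOn (by simp) (fun x => ?_) (fun x b => ?_) hu1
    · exact mul_ne_zero (pow_ne_zero _ hζ)
        (Finset.prod_ne_zero_iff.mpr fun j _ => pow_ne_zero _ (hα j))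
    · rw [Function.update_of_ne (hf j).symm]
      congr 1
      refine Finset.prod_congr rfl fun j' hj' => ?_
      rw [Function.update_of_ne (hd.ne (Finset.ne_of_mem_erase hj'))]
  have huc : ∀ j, j ≠ 0 → u ∈ hasPhase (d j) ((-1) ^ (h j + h 0).val) := by
    intro j hj
    have hαj : α j = (-1) ^ (h j + h 0).val := if_neg hj
    rw [← hαj]
    exact huj j
  have frame : ∀ {i k : W} {β : ℂ} {v : (W → Fin 2) → ℂ} (c : Fin 2), k ≠ i → v ∈ hasPhase k β →
      onWire i (Matrix.single c c 1) *ᵥ (onWire i gateH *ᵥ v) ∈ hasPhase k β := by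
    intro i k β v c hik hv
    have hΘ : ∀ (x : W → Fin 2) b, β ^ (Function.update x i b k).val = β ^ (x k).val := by
      intro x b
      rw [Function.update_of_ne hik]
    exact onWire_mulVec_mem_phaseOn (fun h => hik h.symm) hΘ _
      (onWire_mulVec_mem_phaseOn (fun h => hik h.symm) hΘ _ hv)
  refine mem_wp_measX (c := h 1 + h 0) (huc 1 (by decide)) ?_
  refine mem_wp_measX (c := h 2 + h 0) (frame _ (hd.ne (by decide)) (huc 2 (by decide))) ?_
  refine mem_wp_measX (c := h 3 + h 0)
    (frame _ (hd.ne (by decide)) (frame _ (hd.ne (by decide)) (huc 3 (by decide)))) ?_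
  have hiff : (h 1 + h 0 = 0 ∧ h 2 + h 0 = 0 ∧ h 3 + h 0 = 0) ↔ ∀ j, h j = h 0 := by
    have h2 : ∀ a b : Fin 2, a + b = 0 ↔ a = b := by decide
    simp [h2, Fin.forall_fin_succ]
  simp only [hiff]
  split_ifs with hh
  · have h0 := frame (h 3 + h 0) (hd.ne (show (0 : Fin 4) ≠ 3 by decide))
      (frame (h 2 + h 0) (hd.ne (show (0 : Fin 4) ≠ 2 by decide))
      (frame (h 1 + h 0) (hd.ne (show (0 : Fin 4) ≠ 1 by decide)) (huj 0)))
    have hP := phase_mulVec_mem_hasPhase h0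
    have hm : Complex.I * α 0 = magicPhase (h 0) := by
      simp only [α, if_true, magicPhase, ← omega_sq]
      linear_combination omega * (-1) ^ (h 0).val * star_omega_mul_omega
    rw [hm] at hP
    rw [wp_phase, Submodule.mem_comap]
    exact hP
  · exact mem_wp_swapWires (hf 0) (frame _ (hf 3).symm (frame _ (hf 2).symm
      (frame _ (hf 1).symm huf)))

end

/-- On magic basis states with error pattern `s`, every sequence of measurement outcomes leaves the
output wire of the gadget in the magic basis state `errorBit s`. -/
theorem mem_wp_gadget {W : Type} [Fintype W] [DecidableEq W] {w : Functional → W}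
    (hw : Function.Injective w) {s : Functional → Fin 2} {v : (W → Fin 2) → ℂ}
    (hv : ∀ g, v ∈ hasPhase (w g) (magicPhase (s g))) :
    v ∈ (gadget w).wp (hasPhase (w (coord 0)) (magicPhase (errorBit s))) := by
  have hmem : ∀ g, g ∈ rotations ↔ g ≠ 0 ∧ g ≠ 1 := by simp [rotations]
  have hc0 : ∀ j, coord j ≠ 0 := by decide
  let B : Finset Functional := insert 0 (Finset.univ.image coord)
  have hB : Disjoint supply B := by decide +kernel
  have h1 := mem_phaseOn_of_forall_hasPhase hw (supply ∪ B) (fun g _ => hv g)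
  have h2 := mem_wp_seqList_inject hw (ζ := fun g => magicPhase (s g))
    (ctl := fun g => (coordsOf g).map fun j => w (coord j)) (S := w '' B)
    (fun g => magicPhase_sq _) supply.toList supply.nodup_toList
    (fun g hg => ?_) (fun g a ha => ?_) (R := fun x => ∏ g ∈ B, magicPhase (s g) ^ (x (w g)).val)
    (fun g hg x b => ?_) (v := v) ?_
  · have hΘ : ∀ x : W → Fin 2, (supply.toList.map fun g => magicPhase (s g) ^
          ((((coordsOf g).map fun j => w (coord j)).map x).sum).val).prod *
          ∏ g ∈ B, magicPhase (s g) ^ (x (w g)).val =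
        magicPhase (s 0) ^ (x (w 0)).val *
          (star omega ^ (Functional.eval 1 fun j => x (w (coord j))).val *
          (-1) ^ (Functional.eval (syndrome s) fun j => x (w (coord j))).val) := by
      intro x
      rw [← prod_magicPhase, rotations_eq, Finset.prod_union disjoint_supply,
        Finset.prod_image coord_injective.injOn, Finset.prod_map_toList, Finset.prod_insert
          (by simp [hc0]), Finset.prod_image coord_injective.injOn]
      simp only [eval_coord, List.map_map]
      simp only [Function.comp_def, sum_map_coordsOf _ fun j => x (w (coord j))]
      ring
    simp only [hΘ] at h2
    have hS : w '' (B : Set Functional) = insert (w 0) (Set.range fun j => w (coord j)) := by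
      simp [B, Set.image_insert_eq, ← Set.range_comp, Function.comp_def]
    rw [hS] at h2
    rw [gadget, wp_seq]
    refine Prog.wp_mono _ ?_ h2
    intro u hu
    exact mem_wp_checks (hw.comp coord_injective) (fun j => hw.ne (hc0 j)) (magicPhase_ne_zero _)
      (syndrome s) hu |> fun h => by
        rw [errorBit]
        split_ifs at h ⊢ <;> exact h
  · rintro ⟨g', hg', h⟩
    rw [hw h] at hg'
    exact Finset.disjoint_left.mp hB (Finset.mem_toList.mp hg) hg'
  · obtain ⟨j, -, rfl⟩ := List.mem_map.mp ha
    exact ⟨coord j, by simp [B], rfl⟩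
  · refine Finset.prod_congr rfl fun g' hg' => ?_
    rw [Function.update_of_ne]
    intro h
    rw [hw h] at hg'
    exact Finset.disjoint_left.mp hB (Finset.mem_toList.mp hg) hg'
  · have hΘ : ∀ x : W → Fin 2, (supply.toList.map fun g => magicPhase (s g) ^ (x (w g)).val).prod *
          ∏ g ∈ B, magicPhase (s g) ^ (x (w g)).val =
          ∏ g ∈ supply ∪ B, magicPhase (s g) ^ (x (w g)).val := by
      intro x
      rw [Finset.prod_map_toList, Finset.prod_union hB]
    simp only [hΘ]
    refine phaseOn_mono ?_ _ h1
    rintro a (⟨g, hg, rfl⟩ | ⟨g, hg, rfl⟩)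
    · exact ⟨g, by simp at hg ⊢; exact Or.inr hg, rfl⟩
    · exact ⟨g, by simp at hg ⊢; exact Or.inl hg, rfl⟩

/-! ### Wires and sizes of the building blocks -/

namespace Prog

theorem cnotDepth_le_size {W : Type} (p : Prog W) : p.cnotDepth ≤ p.size := by
  induction p with
  | skip => exact le_rfl
  | had i => exact Nat.zero_le _
  | phase i => exact Nat.zero_le _
  | cnot i j h => exact le_rfl
  | meas i k ih =>
    simp only [cnotDepth, size]
    have := ih 0
    have := ih 1
    omega
  | seq p q ihp ihq => exact Nat.add_le_add ihp ihq
  | par p q ihp ihq => simp only [cnotDepth, size]; omega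

end Prog

section Wires

variable {W : Type}

theorem wires_seqList_subset {S : Set W} {l : List (Prog W)} (h : ∀ p ∈ l, p.wires ⊆ S) :
    (seqList l).wires ⊆ S := by
  induction l with
  | nil => exact Set.empty_subset _
  | cons p l ih => exact Set.union_subset (h p (by simp)) (ih fun q hq => h q (by simp [hq]))

theorem wires_parList_subset {S : Set W} {l : List (Prog W)} (h : ∀ p ∈ l, p.wires ⊆ S) :
    (parList l).wires ⊆ S := by
  induction l with
  | nil => exact Set.empty_subset _
  | cons p l ih => exact Set.union_subset (h p (by simp)) (ih fun q hq => h q (by simp [hq]))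

theorem wellFormed_seqList {l : List (Prog W)} (h : ∀ p ∈ l, p.WellFormed) :
    (seqList l).WellFormed := by
  induction l with
  | nil => trivial
  | cons p l ih => exact ⟨h p (by simp), ih fun q hq => h q (by simp [hq])⟩

theorem wellFormed_parList {l : List (Prog W)} (h : ∀ p ∈ l, p.WellFormed)
    (hd : l.Pairwise fun p q => Disjoint p.wires q.wires) : (parList l).WellFormed := by
  induction l with
  | nil => trivial
  | cons p l ih =>
    rw [List.pairwise_cons] at hd
    refine ⟨h p (by simp), ih (fun q hq => h q (by simp [hq])) hd.2, ?_⟩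
    apply Set.disjoint_of_subset_right
      (wires_parList_subset (S := (p.wires)ᶜ) fun q hq => (hd.1 q hq).subset_compl_left)
    exact disjoint_compl_right

theorem size_seqList_le {l : List (Prog W)} {c : ℕ} (h : ∀ p ∈ l, p.size ≤ c) :
    (seqList l).size ≤ l.length * c := by
  induction l with
  | nil => simp [seqList, Prog.size]
  | cons p l ih =>
    have h1 := ih fun q hq => h q (by simp [hq])
    have h2 := h p (by simp)
    have h3 : (seqList (p :: l)).size = p.size + (seqList l).size := rfl
    rw [h3, List.length_cons, add_mul]
    omega

theorem size_parList_le {l : List (Prog W)} {c : ℕ} (h : ∀ p ∈ l, p.size ≤ c) :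
    (parList l).size ≤ l.length * c := by
  induction l with
  | nil => simp [parList, Prog.size]
  | cons p l ih =>
    have h1 := ih fun q hq => h q (by simp [hq])
    have h2 := h p (by simp)
    have h3 : (parList (p :: l)).size = p.size + (parList l).size := rfl
    rw [h3, List.length_cons, add_mul]
    omega

theorem cnotDepth_parList_le {l : List (Prog W)} {c : ℕ} (h : ∀ p ∈ l, p.cnotDepth ≤ c) :
    (parList l).cnotDepth ≤ c := by
  induction l with
  | nil => simp [parList, Prog.cnotDepth]
  | cons p l ih => exact max_le (h p (by simp)) (ih fun q hq => h q (by simp [hq]))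

variable [DecidableEq W]

theorem wires_cnotOrSkip_subset (i j : W) : (cnotOrSkip i j).wires ⊆ {i, j} := by
  rw [cnotOrSkip]
  split_ifs
  · exact Set.empty_subset _
  · exact le_rfl

theorem size_cnotOrSkip_le (i j : W) : (cnotOrSkip i j).size ≤ 1 := by
  rw [cnotOrSkip]
  split_ifs <;> simp [Prog.size]

theorem wellFormed_cnotOrSkip (i j : W) : (cnotOrSkip i j).WellFormed := by
  rw [cnotOrSkip]
  split_ifs <;> trivial

theorem wires_cnots_subset {S : Set W} {l : List W} {a : W} (hl : ∀ i ∈ l, i ∈ S) (ha : a ∈ S) :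
    (cnots l a).wires ⊆ S := by
  refine wires_seqList_subset fun p hp => ?_
  obtain ⟨i, hi, rfl⟩ := List.mem_map.mp hp
  refine (wires_cnotOrSkip_subset i a).trans ?_
  rintro x (rfl | rfl)
  · exact hl _ hi
  · exact ha

theorem size_cnots_le (l : List W) (a : W) : (cnots l a).size ≤ l.length := by
  have := size_seqList_le (l := l.map fun i => cnotOrSkip i a) (c := 1) fun p hp => by
    obtain ⟨i, -, rfl⟩ := List.mem_map.mp hp
    exact size_cnotOrSkip_le i a
  rwa [List.length_map, mul_one] at this

theorem wellFormed_cnots (l : List W) (a : W) : (cnots l a).WellFormed :=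
  wellFormed_seqList fun p hp => by
    obtain ⟨i, -, rfl⟩ := List.mem_map.mp hp
    exact wellFormed_cnotOrSkip i a

theorem wires_inject_subset {S : Set W} {l : List W} {a : W} (hl : ∀ i ∈ l, i ∈ S)
    (ha : a ∈ S) : (inject l a).wires ⊆ S := by
  have h := wires_cnots_subset hl ha
  have ha' : ({a} : Set W) ⊆ S := Set.singleton_subset_iff.mpr ha
  refine Set.union_subset h (Set.union_subset ha' (Set.iUnion_subset fun b => ?_))
  dsimp only
  split_ifs
  · exact Set.empty_subset _
  · exact Set.union_subset h (Set.union_subset ha' (Set.union_subset ha'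
      (Set.union_subset ha' h)))

theorem size_inject_le (l : List W) (a : W) : (inject l a).size ≤ 3 * l.length + 4 := by
  have := size_cnots_le l a
  simp only [inject, Prog.size, if_true, one_ne_zero, if_false]
  omega

theorem wellFormed_inject (l : List W) (a : W) : (inject l a).WellFormed := by
  have h := wellFormed_cnots l a
  refine ⟨h, fun b => ?_⟩
  dsimp only
  split_ifs
  · trivial
  · exact ⟨h, trivial, trivial, trivial, h⟩

theorem wires_swapWires_subset (i j : W) : (swapWires i j).wires ⊆ {i, j} := by
  have h := wires_cnotOrSkip_subset i j
  have h' := wires_cnotOrSkip_subset j i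
  rw [Set.pair_comm] at h'
  exact Set.union_subset h (Set.union_subset h' h)

theorem wires_measX_subset {S : Set W} {w : W} {k : Fin 2 → Prog W} (hw : w ∈ S)
    (hk : ∀ b, (k b).wires ⊆ S) : (measX w k).wires ⊆ S := by
  have hw' : ({w} : Set W) ⊆ S := Set.singleton_subset_iff.mpr hw
  exact Set.union_subset hw' (Set.union_subset hw' (Set.iUnion_subset hk))

theorem size_measX_le {w : W} {k : Fin 2 → Prog W} {c : ℕ} (hk : ∀ b, (k b).size ≤ c) :
    (measX w k).size ≤ c + 2 := by
  have := hk 0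
  have := hk 1
  simp only [measX, Prog.size]
  omega

theorem wires_gadget_subset (w : Functional → W) : (gadget w).wires ⊆ Set.range w := by
  have hw : ∀ g, w g ∈ Set.range w := fun g => ⟨g, rfl⟩
  refine Set.union_subset (wires_seqList_subset fun p hp => ?_) (Set.union_subset
    (wires_cnots_subset (by simp) (hw _))
    (wires_measX_subset (hw _) fun b₁ => wires_measX_subset (hw _) fun b₂ =>
      wires_measX_subset (hw _) fun b₃ => ?_))
  · obtain ⟨g, -, rfl⟩ := List.mem_map.mp hp
    exact wires_inject_subset (by simp) (hw _)
  · split_ifs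
    · exact Set.singleton_subset_iff.mpr (hw _)
    · refine (wires_swapWires_subset _ _).trans ?_
      rintro x (rfl | rfl) <;> exact hw _

theorem wellFormed_gadget (w : Functional → W) : (gadget w).WellFormed := by
  refine ⟨wellFormed_seqList fun p hp => ?_, wellFormed_cnots _ _, trivial, fun b₁ =>
    ⟨trivial, fun b₂ => ⟨trivial, fun b₃ => ?_⟩⟩⟩
  · obtain ⟨g, -, rfl⟩ := List.mem_map.mp hp
    exact wellFormed_inject _ _
  · dsimp only
    split_ifs
    · trivial
    · exact ⟨wellFormed_cnotOrSkip _ _, wellFormed_cnotOrSkip _ _, wellFormed_cnotOrSkip _ _⟩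

theorem size_gadget_le (w : Functional → W) : (gadget w).size ≤ 300 := by
  have h1 : (seqList (supply.toList.map fun g =>
      inject ((coordsOf g).map fun j => w (coord j)) (w g))).size ≤ 10 * 16 := by
    have hlen : (supply.toList.map fun g =>
      inject ((coordsOf g).map fun j => w (coord j)) (w g)).length = 10 := by
      rw [List.length_map, Finset.length_toList]
      decide +kernel
    rw [← hlen]
    refine size_seqList_le fun p hp => ?_
    obtain ⟨g, -, rfl⟩ := List.mem_map.mp hp
    have h2 := size_inject_le ((coordsOf g).map fun j => w (coord j)) (w g)
    have h3 : (coordsOf g).length ≤ 4 :=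
      (List.length_filter_le _ _).trans (by simp)
    rw [List.length_map] at h2
    omega
  have h2 := size_cnots_le [w (coord 1), w (coord 2), w (coord 3)] (w (coord 0))
  have h3 : ∀ i j : W, (swapWires i j).size ≤ 3 := by
    intro i j
    have := size_cnotOrSkip_le i j
    have := size_cnotOrSkip_le j i
    simp only [swapWires, Prog.size]
    omega
  have h4 : (measX (w (coord 1)) fun b₁ => measX (w (coord 2)) fun b₂ =>
      measX (w (coord 3)) fun b₃ => if b₁ = 0 ∧ b₂ = 0 ∧ b₃ = 0 then .phase (w (coord 0))
        else swapWires (w (coord 0)) (w 0)).size ≤ 3 + 2 + 2 + 2 := by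
    refine size_measX_le fun b₁ => size_measX_le fun b₂ => size_measX_le fun b₃ => ?_
    split_ifs
    · simp [Prog.size]
    · exact h3 _ _
  simp only [gadget, Prog.size] at h4 ⊢
  simp only [List.length_cons, List.length_nil] at h2
  omega

end Wires

/-! ### Concatenation -/

section Concatenation

/-- The address of the output wire of the `k`-fold concatenation. -/
def outAddr (k : ℕ) : Fin k → Functional := fun _ => coord 0

/-- The `k`-fold concatenation of the gadget, on `16 ^ k` wires. -/
noncomputable def distillProg {W : Type} [DecidableEq W] :
    (k : ℕ) → ((Fin k → Functional) → W) → Prog W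
  | 0, _ => .skip
  | k + 1, w => .seq
      (parList ((Finset.univ : Finset Functional).toList.map fun g =>
        distillProg k fun a => w (Fin.cons g a)))
      (gadget fun g => w (Fin.cons g (outAddr k)))

/-- Whether the output of the `k`-fold concatenation is `|T^⊥⟩`, as a function of the error pattern
of the input. -/
def concatErrorBit : (k : ℕ) → ((Fin k → Functional) → Fin 2) → Fin 2
  | 0, s => s (outAddr 0)
  | k + 1, s => errorBit fun g => concatErrorBit k fun a => s (Fin.cons g a)

theorem cons_injective_right {k : ℕ} (g : Functional) :
    Function.Injective fun a : Fin k → Functional => (Fin.cons g a : Fin (k + 1) → Functional) :=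
  fun _ _ h => (Fin.cons_injective2 h).2

section

variable {W : Type} [DecidableEq W]

theorem wires_distillProg_subset (k : ℕ) (w : (Fin k → Functional) → W) :
    (distillProg k w).wires ⊆ Set.range w := by
  induction k with
  | zero => exact Set.empty_subset _
  | succ k ih =>
    refine Set.union_subset (wires_parList_subset fun p hp => ?_)
      ((wires_gadget_subset _).trans ?_)
    · obtain ⟨g, -, rfl⟩ := List.mem_map.mp hp
      refine (ih _).trans ?_
      rintro _ ⟨a, rfl⟩
      exact ⟨_, rfl⟩
    · rintro _ ⟨g, rfl⟩
      exact ⟨_, rfl⟩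

theorem disjoint_wires_distillProg {k : ℕ} {w : (Fin (k + 1) → Functional) → W}
    (hw : Function.Injective w) {g g' : Functional} (h : g ≠ g') :
    Disjoint (distillProg k fun a => w (Fin.cons g a)).wires
      (distillProg k fun a => w (Fin.cons g' a)).wires := by
  refine Set.disjoint_of_subset (wires_distillProg_subset _ _) (wires_distillProg_subset _ _) ?_
  rw [Set.disjoint_left]
  rintro _ ⟨a, rfl⟩ ⟨a', ha'⟩
  exact h (congrFun (hw ha') 0).symm

theorem wellFormed_distillProg (k : ℕ) {w : (Fin k → Functional) → W}
    (hw : Function.Injective w) : (distillProg k w).WellFormed := by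
  induction k with
  | zero => trivial
  | succ k ih =>
    refine ⟨wellFormed_parList (fun p hp => ?_) ?_, wellFormed_gadget _⟩
    · obtain ⟨g, -, rfl⟩ := List.mem_map.mp hp
      exact ih (hw.comp (cons_injective_right g))
    · refine List.Pairwise.map _ (fun g g' h => ?_) (Finset.nodup_toList Finset.univ)
      exact disjoint_wires_distillProg hw h

theorem card_functional : Fintype.card Functional = 16 := by simp

theorem size_distillProg_le (k : ℕ) (w : (Fin k → Functional) → W) :
    (distillProg k w).size + 300 ≤ 300 * 16 ^ k := by
  induction k with
  | zero => simp [distillProg, Prog.size]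
  | succ k ih =>
    have h1 := size_gadget_le fun g => w (Fin.cons g (outAddr k))
    have h2 := size_parList_le (l := (Finset.univ : Finset Functional).toList.map fun g =>
      distillProg k fun a => w (Fin.cons g a)) (c := 300 * 16 ^ k - 300) fun p hp => by
        obtain ⟨g, -, rfl⟩ := List.mem_map.mp hp
        exact Nat.le_sub_of_add_le (ih _)
    rw [List.length_map, Finset.length_toList, Finset.card_univ, card_functional] at h2
    have h3 : 1 ≤ 16 ^ k := Nat.one_le_pow _ _ (by norm_num)
    simp only [distillProg, Prog.size]
    rw [pow_succ]
    omega

theorem cnotDepth_distillProg_le (k : ℕ) (w : (Fin k → Functional) → W) :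
    (distillProg k w).cnotDepth ≤ k * 300 := by
  induction k with
  | zero => simp [distillProg, Prog.cnotDepth]
  | succ k ih =>
    have h1 := (Prog.cnotDepth_le_size _).trans
      (size_gadget_le fun g => w (Fin.cons g (outAddr k)))
    have h2 := cnotDepth_parList_le (l := (Finset.univ : Finset Functional).toList.map fun g =>
      distillProg k fun a => w (Fin.cons g a)) (c := k * 300) fun p hp => by
        obtain ⟨g, -, rfl⟩ := List.mem_map.mp hp
        exact ih _
    simp only [distillProg, Prog.cnotDepth]
    omega

end

variable {W : Type} [Fintype W] [DecidableEq W]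

theorem Prog.mem_wp_iInf {ι : Sort*} (p : Prog W) {Q : ι → Submodule ℂ ((W → Fin 2) → ℂ)}
    {v : (W → Fin 2) → ℂ} (h : ∀ i, v ∈ p.wp (Q i)) : v ∈ p.wp (⨅ i, Q i) := by
  induction p generalizing v Q with
  | skip => exact (Submodule.mem_iInf _).mpr h
  | had i => exact (Submodule.mem_iInf _).mpr h
  | phase i => exact (Submodule.mem_iInf _).mpr h
  | cnot i j _ => exact (Submodule.mem_iInf _).mpr h
  | meas i k ih => exact mem_wp_meas.mpr fun b => ih b fun i => mem_wp_meas.mp (h i) b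
  | seq p q ihp ihq =>
    refine Prog.wp_mono p (fun u hu => ihq fun i => ?_) (ihp (Q := fun i => q.wp (Q i)) h)
    exact (Submodule.mem_iInf _).mp hu i
  | par p q ihp ihq =>
    refine Prog.wp_mono p (fun u hu => ihq fun i => ?_) (ihp (Q := fun i => q.wp (Q i)) h)
    exact (Submodule.mem_iInf _).mp hu i

theorem wp_parList_cons (p : Prog W) (l : List (Prog W)) (Q : Submodule ℂ ((W → Fin 2) → ℂ)) :
    (parList (p :: l)).wp Q = p.wp ((parList l).wp Q) := rfl

/-- Correctness of the concatenated gadget. -/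
theorem mem_wp_distillProg (k : ℕ) {w : (Fin k → Functional) → W} (hw : Function.Injective w)
    {s : (Fin k → Functional) → Fin 2} {v : (W → Fin 2) → ℂ}
    (hv : ∀ a, v ∈ hasPhase (w a) (magicPhase (s a))) :
    v ∈ (distillProg k w).wp (hasPhase (w (outAddr k)) (magicPhase (concatErrorBit k s))) := by
  induction k generalizing v with
  | zero => exact hv _
  | succ k ih =>
    -- One block computes its output, and the other blocks do not touch its wires.
    have hout : ∀ g g' : Functional, g' ≠ g → ∀ a,
        w (Fin.cons g a) ∉ (distillProg k fun a => w (Fin.cons g' a)).wires := by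
      rintro g g' hne a h
      obtain ⟨a', ha'⟩ := wires_distillProg_subset _ _ h
      exact hne (congrFun (hw ha') 0)
    have hblock : ∀ (g : Functional) (L : List Functional), L.Nodup → g ∈ L →
        (⨅ a, hasPhase (w (Fin.cons g a)) (magicPhase (s (Fin.cons g a)))) ≤
        (parList (L.map fun g' => distillProg k fun a => w (Fin.cons g' a))).wp
          (hasPhase (w (Fin.cons g (outAddr k)))
            (magicPhase (concatErrorBit k fun a => s (Fin.cons g a)))) := by
      intro g L
      induction L with
      | nil => simp
      | cons g' L ihL =>
        intro hL hg u hu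
        rw [Submodule.mem_iInf] at hu
        rw [List.map_cons, wp_parList_cons]
        rw [List.nodup_cons] at hL
        by_cases hgg : g' = g
        · subst hgg
          refine Prog.wp_mono _ ?_ (ih (hw.comp (cons_injective_right g')) hu)
          refine hasPhase_le_wp (fun h => ?_) _
          have hsub := wires_parList_subset (S := {w (Fin.cons g' (outAddr k))}ᶜ)
            (l := L.map fun g' => distillProg k fun a => w (Fin.cons g' a)) fun p hp => by
              obtain ⟨g, hg, rfl⟩ := List.mem_map.mp hp
              refine Set.subset_compl_singleton_iff.mpr (hout _ _ ?_ _)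
              exact fun h => hL.1 (h ▸ hg)
          exact hsub h rfl
        · refine Prog.wp_mono _ (ihL hL.2 ((List.mem_cons.mp hg).resolve_left (Ne.symm hgg))) ?_
          exact Prog.mem_wp_iInf _ fun a => hasPhase_le_wp (hout _ _ hgg a) _ (hu a)
    rw [distillProg, wp_seq]
    have h1 := Prog.mem_wp_iInf _ fun g => hblock g (Finset.univ : Finset Functional).toList
      (Finset.nodup_toList _) (Finset.mem_toList.mpr (Finset.mem_univ g))
      ((Submodule.mem_iInf _).mpr fun a => hv _)
    refine Prog.wp_mono _ ?_ h1
    intro u hu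
    rw [Submodule.mem_iInf] at hu
    have hinj : Function.Injective fun g => w (Fin.cons g (outAddr k)) :=
      fun _ _ h => congrFun (hw h) 0
    have h2 := mem_wp_gadget hinj hu
    have h3 : (Fin.cons (coord 0) (outAddr k) : Fin (k + 1) → Functional) = outAddr (k + 1) := by
      ext1 j
      refine Fin.cases ?_ (fun j => ?_) j <;> rfl
    rw [h3] at h2
    exact h2

end Concatenation

/-! ### The error probability of the concatenated gadget -/

section ErrorProbability

variable {W : Type} [Fintype W] [DecidableEq W]

theorem iidExp_coord (ε : ℝ) (w : W) : iidExp ε (fun s => ((s w).val : ℝ)) = ε := by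
  have h : ∀ s : W → Fin 2, iidWeight ε s * ((s w).val : ℝ) =
      ∏ i, if i = w then (if s i = 0 then 0 else ε) else (if s i = 0 then 1 - ε else ε) := by
    intro s
    rw [iidWeight, ← Finset.mul_prod_erase Finset.univ _ (Finset.mem_univ w),
      ← Finset.mul_prod_erase Finset.univ (fun i => if i = w then (if s i = 0 then 0 else ε)
        else (if s i = 0 then 1 - ε else ε)) (Finset.mem_univ w), if_pos rfl]
    have h2 : ∏ i ∈ Finset.univ.erase w, (if i = w then (if s i = 0 then 0 else ε)
        else (if s i = 0 then 1 - ε else ε)) =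
        ∏ i ∈ Finset.univ.erase w, (if s i = 0 then 1 - ε else ε) :=
      Finset.prod_congr rfl fun i hi => if_neg (Finset.ne_of_mem_erase hi)
    rw [h2]
    rcases Fin.eq_zero_or_one (s w) with h | h <;> simp [h]
  simp only [iidExp, h]
  rw [← Fintype.piFinset_univ, ← Finset.prod_univ_sum (fun _ => Finset.univ)
    (fun (i : W) (b : Fin 2) => if i = w then (if b = 0 then 0 else ε)
      else (if b = 0 then 1 - ε else ε))]
  rw [Finset.prod_eq_single w]
  · simp
  · intro i _ hi
    simp [hi]
  · simp

/-- An error of the gadget needs two errors among its inputs. -/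
theorem errorBit_le (s : Functional → Fin 2) : ((errorBit s).val : ℝ) ≤
    ∑ p ∈ (Finset.univ : Finset (Functional × Functional)) with p.1 ≠ p.2,
      ((s p.1).val : ℝ) * ((s p.2).val : ℝ) := by
  have hnn : ∀ p ∈ (Finset.univ : Finset (Functional × Functional)).filter (fun p => p.1 ≠ p.2),
      0 ≤ ((s p.1).val : ℝ) * ((s p.2).val : ℝ) := fun p _ => by positivity
  rcases Fin.eq_zero_or_one (errorBit s) with h | h
  · rw [h]
    simpa using Finset.sum_nonneg hnn
  · obtain ⟨g, g', hne, hg, hg'⟩ := exists_ne_of_errorBit_eq_one h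
    refine le_trans ?_ (Finset.single_le_sum hnn (a := (g, g')) (by simpa using hne))
    simp [h, hg, hg']

/-- The `k`-fold concatenation turns the error probability `ε` into at most
`(256 ε) ^ (2 ^ k) / 256`. -/
theorem iidExp_concatErrorBit_le {ε : ℝ} (h0 : 0 ≤ ε) (h1 : ε ≤ 1) (k : ℕ)
    {w : (Fin k → Functional) → W} (hw : Function.Injective w) :
    256 * iidExp ε (fun s => ((concatErrorBit k fun a => s (w a)).val : ℝ)) ≤
      (256 * ε) ^ 2 ^ k := by
  induction k with
  | zero => simp [concatErrorBit, iidExp_coord]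
  | succ k ih =>
    let X : Functional → (W → Fin 2) → ℝ := fun g s =>
      ((concatErrorBit k fun a => s (w (Fin.cons g a))).val : ℝ)
    have hX0 : ∀ g, 0 ≤ iidExp ε (X g) := fun g => by
      rw [← iidExp_const (W := W) ε 0]
      exact iidExp_mono h0 h1 fun s => by positivity
    have hX : ∀ g, 256 * iidExp ε (X g) ≤ (256 * ε) ^ 2 ^ k := fun g =>
      ih (hw.comp (cons_injective_right g))
    have hpair : ∀ g g', g ≠ g' → iidExp ε (fun s => X g s * X g' s) =
        iidExp ε (X g) * iidExp ε (X g') := by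
      intro g g' hne
      refine iidExp_mul_of_dependsOn ε
        (Finset.univ.image fun a : Fin k → Functional => w (Fin.cons g a)) ?_ ?_
      · intro s s' h
        have : (fun a => s (w (Fin.cons g a))) = fun a => s' (w (Fin.cons g a)) :=
          funext fun a => h _ (Finset.mem_image_of_mem _ (Finset.mem_univ a))
        simp only [X, this]
      · intro s s' h
        have : (fun a => s (w (Fin.cons g' a))) = fun a => s' (w (Fin.cons g' a)) := by
          refine funext fun a => h _ fun hmem => ?_
          obtain ⟨a', -, ha'⟩ := Finset.mem_image.mp hmem
          exact hne (congrFun (hw ha') 0)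
        simp only [X, this]
    calc 256 * iidExp ε (fun s => ((concatErrorBit (k + 1) fun a => s (w a)).val : ℝ))
        ≤ 256 * iidExp ε (fun s =>
            ∑ p ∈ (Finset.univ : Finset (Functional × Functional)) with p.1 ≠ p.2,
              X p.1 s * X p.2 s) := by
          refine mul_le_mul_of_nonneg_left (iidExp_mono h0 h1 fun s => ?_) (by norm_num)
          exact errorBit_le fun g => concatErrorBit k fun a => s (w (Fin.cons g a))
      _ = 256 * ∑ p ∈ (Finset.univ : Finset (Functional × Functional)) with p.1 ≠ p.2,
            iidExp ε (X p.1) * iidExp ε (X p.2) := by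
          rw [iidExp_sum]
          congr 1
          exact Finset.sum_congr rfl fun p hp => hpair _ _ (Finset.mem_filter.mp hp).2
      _ ≤ 256 * ∑ p : Functional × Functional, iidExp ε (X p.1) * iidExp ε (X p.2) := by
          refine mul_le_mul_of_nonneg_left (Finset.sum_le_sum_of_subset_of_nonneg
            (Finset.filter_subset _ _) fun p _ _ => mul_nonneg (hX0 _) (hX0 _)) (by norm_num)
      _ ≤ 256 * ∑ p : Functional × Functional, ((256 * ε) ^ 2 ^ k / 256) ^ 2 := by
          refine mul_le_mul_of_nonneg_left (Finset.sum_le_sum fun p _ => ?_) (by norm_num)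
          rw [sq]
          refine mul_le_mul ?_ ?_ (hX0 _) (by positivity)
          · linarith [hX p.1]
          · linarith [hX p.2]
      _ = (256 * ε) ^ 2 ^ (k + 1) := by
          rw [Finset.sum_const, Finset.card_univ, Fintype.card_prod, card_functional, pow_succ 2,
            pow_mul]
          simp
          ring

end ErrorProbability

/-! ### A distilling family -/

section Family

/-- A state on `W` whose range consists of vectors with `magicKet r` on the wire `o` has infidelity
`r` on that wire. -/
theorem infidelity_reduceTo {W : Type} [Fintype W] [DecidableEq W] {R : Op W} {o : W} {r : Fin 2}
    (hR : ∀ u, R *ᵥ u ∈ hasPhase o (magicPhase r)) (htr : R.trace = 1) :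
    infidelity (Circuit.reduceTo o R) = (r.val : ℝ) := by
  have hrow : ∀ b, Circuit.reduceTo o R 1 b = magicPhase r * Circuit.reduceTo o R 0 b := by
    intro b
    simp only [Circuit.reduceTo_eq_sum, Matrix.smul_apply, Matrix.sum_apply, Matrix.submatrix_apply,
      smul_eq_mul]
    rw [mul_left_comm, Finset.mul_sum _ _ (magicPhase r)]
    congr 1
    refine Finset.sum_congr rfl fun x _ => ?_
    have := apply_update_one (hR (Pi.single (Function.update x o b) 1)) x
    simpa using this
  have htr' := Circuit.trace_reduceTo o R
  rw [htr, Matrix.trace, Fin.sum_univ_two] at htr'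
  simp only [Matrix.diag, hrow] at htr'
  have hT0 : ketT 0 = ((1 / Real.sqrt 2 : ℝ) : ℂ) := magicKet_zero_apply 0
  have hT1 : ketT 1 = omega * ((1 / Real.sqrt 2 : ℝ) : ℂ) := by
    have := magicKet_one_apply 0
    simpa [magicKet, magicPhase] using this
  have hin : star ketT ⬝ᵥ (Circuit.reduceTo o R *ᵥ ketT) = 1 - (r.val : ℂ) := by
    have h2 := inv_sqrt_two_mul_self
    have ho := star_omega_mul_omega
    simp only [Matrix.mulVec, dotProduct, Fin.sum_univ_two, Pi.star_apply, hT0, hT1, hrow,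
      map_mul, Complex.star_def, Complex.conj_ofReal] at ho ⊢
    set c := ((1 / Real.sqrt 2 : ℝ) : ℂ)
    set a := Circuit.reduceTo o R 0 0
    set b := Circuit.reduceTo o R 0 1
    rcases Fin.eq_zero_or_one r with rfl | rfl
    · simp only [magicPhase, Fin.val_zero, pow_zero, one_mul, Nat.cast_zero, sub_zero] at htr' ⊢
      linear_combination (a + b * omega) * (1 + (starRingEnd ℂ) omega * omega) * h2 +
        (a + b * omega) * (1 / 2) * ho + htr'
    · simp only [magicPhase, Fin.val_one, pow_one, Nat.cast_one, sub_self] at htr' ⊢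
      linear_combination (a + b * omega) * (1 - (starRingEnd ℂ) omega * omega) * h2 -
        (a + b * omega) * (1 / 2) * ho
  rw [infidelity, hin]
  simp

theorem addAncillas_magicState_mulVec_mem {n a : ℕ} (s : Fin n → Fin 2) (i : Fin n)
    (u : (Fin n ⊕ Fin a → Fin 2) → ℂ) :
    Circuit.addAncillas a (magicState s) *ᵥ u ∈ hasPhase (Sum.inl i) (magicPhase (s i)) := by
  intro x x' hx
  simp only [Matrix.mulVec, dotProduct, Finset.mul_sum]
  refine Finset.sum_congr rfl fun y _ => ?_
  rw [← mul_assoc, ← mul_assoc]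
  congr 1
  have hxr : (∀ k, x (Sum.inr k) = 0) ↔ ∀ k, x' (Sum.inr k) = 0 :=
    forall_congr' fun k => by rw [hx (Sum.inr k) (by simp)]
  simp only [Circuit.addAncillas, hxr]
  split_ifs
  · simp only [magicState, prodOp, Function.comp_apply]
    rw [← Finset.mul_prod_erase Finset.univ _ (Finset.mem_univ i),
      ← Finset.mul_prod_erase Finset.univ
        (fun j => proj (magicKet (s j)) (x' (Sum.inl j)) (y (Sum.inl j))) (Finset.mem_univ i)]
    have herase : ∏ j ∈ Finset.univ.erase i,
        proj (magicKet (s j)) (x (Sum.inl j)) (y (Sum.inl j)) =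
        ∏ j ∈ Finset.univ.erase i,
          proj (magicKet (s j)) (x' (Sum.inl j)) (y (Sum.inl j)) :=
      Finset.prod_congr rfl fun j hj => by
        rw [hx (Sum.inl j) (by simpa using Finset.ne_of_mem_erase hj)]
    have hket : ∀ b, magicKet (s i) b = magicPhase (s i) ^ b.val * magicKet (s i) 0 := by
      intro b
      rcases Fin.eq_zero_or_one b with rfl | rfl
      · simp
      · rw [magicKet_one_apply, magicKet_zero_apply]; simp
    rw [herase]
    simp only [proj, Matrix.vecMulVec_apply]
    rw [hket (x (Sum.inl i)), hket (x' (Sum.inl i))]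
    ring
  · simp

theorem exists_embedding (n : ℕ) (hn : n ≠ 0) :
    Nonempty ((Fin (Nat.log 16 n) → Functional) ↪ Fin n) := by
  apply Function.Embedding.nonempty_of_card_le
  rw [Fintype.card_fun, card_functional, Fintype.card_fin, Fintype.card_fin]
  exact Nat.pow_log_le_self 16 hn

/-- The circuit on `n ≥ 1` inputs runs the concatenated gadget on the largest power of `16` that
fits; without inputs the output is `|0⟩`. -/
noncomputable def distillCircuit (n : ℕ) : Circuit n :=
  if hn : n = 0 then ⟨1, .skip, trivial, Sum.inr 0⟩ else
    let w := Classical.choice (exists_embedding n hn)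
    { anc := 0
      prog := distillProg (Nat.log 16 n) fun a => Sum.inl (w a)
      wellFormed := wellFormed_distillProg _ (Sum.inl_injective.comp w.injective)
      out := Sum.inl (w (outAddr _)) }

theorem size_distillCircuit_le {n : ℕ} (hn : n ≠ 0) : (distillCircuit n).size ≤ 300 * n := by
  rw [distillCircuit, dif_neg hn, Circuit.size]
  have h := size_distillProg_le (Nat.log 16 n)
    fun a => (Sum.inl (Classical.choice (exists_embedding n hn) a) : Fin n ⊕ Fin 0)
  have h2 := Nat.pow_log_le_self 16 hn
  dsimp only
  omega

theorem cnotDepth_distillCircuit_le {n : ℕ} (hn : n ≠ 0) :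
    (distillCircuit n).cnotDepth ≤ Nat.log 16 n * 300 := by
  rw [distillCircuit, dif_neg hn, Circuit.cnotDepth]
  exact cnotDepth_distillProg_le _ _

theorem infidelity_distillCircuit_le {n : ℕ} (hn : n ≠ 0) {ε : ℝ} (h0 : 0 ≤ ε) (h1 : ε ≤ 1) :
    infidelity ((distillCircuit n).channel (prodOp fun _ => noisyT ε)) ≤
      (256 * ε) ^ 2 ^ Nat.log 16 n := by
  rw [infidelity_channel_noisyT]
  have hinj := (Classical.choice (exists_embedding n hn)).injective
  have hs : ∀ s, infidelity ((distillCircuit n).channel (magicState s)) =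
      ((concatErrorBit (Nat.log 16 n)
        fun a => s (Classical.choice (exists_embedding n hn) a)).val : ℝ) := by
    intro s
    rw [distillCircuit, dif_neg hn, Circuit.channel]
    refine infidelity_reduceTo (fun u => ?_) ?_
    · refine Prog.run_mulVec_mem _ (fun u => ?_) u
      exact mem_wp_distillProg _ (Sum.inl_injective.comp hinj)
        fun a => addAncillas_magicState_mulVec_mem s _ u
    · rw [Prog.trace_run, Circuit.trace_addAncillas, trace_magicState]
  simp only [hs]
  have h := iidExp_concatErrorBit_le h0 h1 (Nat.log 16 n) hinj
  have h2 : 0 ≤ iidExp ε fun s : Fin n → Fin 2 => ((concatErrorBit (Nat.log 16 n)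
        fun a => s (Classical.choice (exists_embedding n hn) a)).val : ℝ) := by
    rw [← iidExp_const (W := Fin n) ε 0]
    exact iidExp_mono h0 h1 fun s => by positivity
  linarith

theorem half_rpow_le_two_pow_log (n : ℕ) :
    1 / 2 * (n : ℝ) ^ (1 / 4 : ℝ) ≤ ((2 ^ Nat.log 16 n : ℕ) : ℝ) := by
  have h : (n : ℝ) ≤ 16 ^ (Nat.log 16 n + 1) := by
    exact_mod_cast (Nat.lt_pow_succ_log_self (by norm_num) n).le
  have h2 : (n : ℝ) ^ (1 / 4 : ℝ) ≤ 2 ^ (Nat.log 16 n + 1) := by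
    calc (n : ℝ) ^ (1 / 4 : ℝ) ≤ ((16 : ℝ) ^ (Nat.log 16 n + 1)) ^ (1 / 4 : ℝ) :=
          Real.rpow_le_rpow (by positivity) h (by norm_num)
      _ = (((2 : ℝ) ^ (Nat.log 16 n + 1)) ^ (4 : ℝ)) ^ (1 / 4 : ℝ) := by
          congr 1
          rw [show (4 : ℝ) = ((4 : ℕ) : ℝ) by norm_num, Real.rpow_natCast, ← pow_mul, mul_comm,
            pow_mul]
          norm_num
      _ = 2 ^ (Nat.log 16 n + 1) := by
          rw [← Real.rpow_mul (by positivity)]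
          norm_num
  rw [pow_succ] at h2
  push_cast
  linarith

theorem distills_distillCircuit : Distills distillCircuit (1 / 4) (1 / 2) 1 256 (1 / 512) where
  c_pos := by norm_num
  a_pos := by norm_num
  A_pos := by norm_num
  B_pos := by norm_num
  δ_pos := by norm_num
  Bδ_lt_one := by norm_num
  infidelity_le := by
    intro n ε h0 h1
    change infidelity _ ≤ _
    rw [one_mul]
    by_cases hn : n = 0
    · subst hn
      have h : infidelity ((distillCircuit 0).channel (prodOp fun _ => noisyT ε)) ≤ 1 := by
        rw [infidelity, sub_le_self_iff]
        have hpos : (noisyT ε).PosSemidef := by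
          refine Matrix.PosSemidef.add ((proj_posSemidef _).smul ?_) ((proj_posSemidef _).smul ?_)
          · exact_mod_cast (by linarith : (0 : ℝ) ≤ 1 - ε)
          · exact_mod_cast h0
        have hout := (distillCircuit 0).posSemidef_channel (posSemidef_prodOp fun _ => hpos)
        have := hout.re_dotProduct_nonneg ketT
        simpa using this
      simpa using h
    · refine (infidelity_distillCircuit_le hn h0 (by linarith)).trans ?_
      rw [← Real.rpow_natCast]
      refine Real.rpow_le_rpow_of_exponent_ge' (by linarith) (by linarith) (by positivity) ?_
      exact half_rpow_le_two_pow_log n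

theorem exists_distilling_family :
    ∃ (D : (n : ℕ) → Circuit n) (c a A B δ : ℝ), Distills D c a A B δ ∧
      (∃ d : ℝ, ∀ n : ℕ, 2 ≤ n → ((D n).cnotDepth : ℝ) ≤ d * Real.log n) ∧
      (∃ s q : ℕ, ∀ n : ℕ, 1 ≤ n → (D n).size ≤ s * n ^ q) := by
  refine ⟨distillCircuit, _, _, _, _, _, distills_distillCircuit, ⟨300 / Real.log 16, ?_⟩,
    300, 1, ?_⟩
  · intro n hn
    have h1 : ((distillCircuit n).cnotDepth : ℝ) ≤ Nat.log 16 n * 300 := by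
      exact_mod_cast cnotDepth_distillCircuit_le (by omega)
    have h2 : (Nat.log 16 n : ℝ) * Real.log 16 ≤ Real.log n := by
      rw [← Real.log_pow]
      apply Real.log_le_log (by positivity)
      exact_mod_cast Nat.pow_log_le_self 16 (by omega)
    have h3 : 0 < Real.log 16 := Real.log_pos (by norm_num)
    refine h1.trans ?_
    rw [div_mul_eq_mul_div, le_div_iff₀ h3]
    linarith
  · intro n hn
    rw [pow_one]
    exact size_distillCircuit_le (by omega)

end Family

/-! ### The trace norm -/

section TraceNorm

variable {ι : Type} [Fintype ι] [DecidableEq ι]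

open scoped Matrix.Norms.L2Operator

/-- The trace norm is attained as `Re Tr(S A)` for a contraction `S`. With `Aᴴ A = U diag(d) Uᴴ`,
the contraction is `U diag(d)^{-1/2} Uᴴ Aᴴ`, where `0⁻¹ = 0`. -/
theorem exists_traceNorm_eq (A : Matrix ι ι ℂ) :
    ∃ S : Matrix ι ι ℂ, ‖S‖ ≤ 1 ∧ traceNorm A = ((S * A).trace).re := by
  have hH := Matrix.isHermitian_conjTranspose_mul_self A
  set d := hH.eigenvalues with hd
  have hd0 : ∀ i, 0 ≤ d i := Matrix.eigenvalues_conjTranspose_mul_self_nonneg A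
  let U : Matrix ι ι ℂ := hH.eigenvectorUnitary
  have hU : Uᴴ * U = 1 := Unitary.coe_star_mul_self hH.eigenvectorUnitary
  have hspec : Aᴴ * A = U * Matrix.diagonal (fun i => (d i : ℂ)) * Uᴴ := by
    have := hH.spectral_theorem
    rw [Unitary.conjStarAlgAut_apply] at this
    exact this
  let g : ι → ℂ := fun i => (((Real.sqrt (d i))⁻¹ : ℝ) : ℂ)
  let G : Matrix ι ι ℂ := Matrix.diagonal g
  have hG : Gᴴ = G := by
    rw [Matrix.diagonal_conjTranspose]
    congr 1
    ext i
    simp [g]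
  refine ⟨U * G * Uᴴ * Aᴴ, ?_, ?_⟩
  · have h1 : (U * G * Uᴴ * Aᴴ) * (U * G * Uᴴ * Aᴴ)ᴴ =
        U * Matrix.diagonal (fun i => g i * d i * g i) * Uᴴ := by
      calc (U * G * Uᴴ * Aᴴ) * (U * G * Uᴴ * Aᴴ)ᴴ
          = U * G * Uᴴ * (Aᴴ * A) * (U * G * Uᴴ) := by
            simp only [Matrix.conjTranspose_mul, Matrix.conjTranspose_conjTranspose, hG,
              Matrix.mul_assoc]
        _ = U * G * (Uᴴ * U) * Matrix.diagonal (fun i => (d i : ℂ)) * (Uᴴ * U) * G * Uᴴ := by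
            rw [hspec]
            simp only [Matrix.mul_assoc]
        _ = _ := by
            rw [hU, Matrix.mul_one, Matrix.mul_one, Matrix.mul_assoc U, Matrix.mul_assoc U]
            simp only [G, Matrix.diagonal_mul_diagonal]
    have hUn : ‖U‖ ≤ 1 := by
      have h := Matrix.l2_opNorm_conjTranspose_mul_self U
      rw [hU] at h
      have h2 : ‖(1 : Matrix ι ι ℂ)‖ ≤ 1 := by
        rw [← Matrix.diagonal_one, Matrix.l2_opNorm_diagonal]
        exact (pi_norm_le_iff_of_nonneg zero_le_one).mpr fun i => by simp
      nlinarith [norm_nonneg U]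
    have hDn : ‖Matrix.diagonal (fun i => g i * d i * g i)‖ ≤ 1 := by
      rw [Matrix.l2_opNorm_diagonal]
      refine (pi_norm_le_iff_of_nonneg zero_le_one).mpr fun i => ?_
      simp only [g, ← Complex.ofReal_mul, Complex.norm_real, Real.norm_eq_abs]
      by_cases h0 : d i = 0
      · simp [h0]
      · have hs : Real.sqrt (d i) ≠ 0 := (Real.sqrt_pos.mpr (lt_of_le_of_ne (hd0 i)
          (Ne.symm h0))).ne'
        have : (Real.sqrt (d i))⁻¹ * d i * (Real.sqrt (d i))⁻¹ = 1 := by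
          nth_rewrite 2 [← Real.mul_self_sqrt (hd0 i)]
          field_simp
        rw [this, abs_one]
    have h2 := Matrix.l2_opNorm_conjTranspose_mul_self (U * G * Uᴴ * Aᴴ)ᴴ
    rw [Matrix.conjTranspose_conjTranspose, h1, Matrix.l2_opNorm_conjTranspose] at h2
    have h3 : ‖U * Matrix.diagonal (fun i => g i * d i * g i) * Uᴴ‖ ≤ 1 := by
      refine (Matrix.l2_opNorm_mul _ _).trans ?_
      rw [Matrix.l2_opNorm_conjTranspose]
      refine mul_le_one₀ ((Matrix.l2_opNorm_mul _ _).trans ?_) (norm_nonneg _) hUn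
      exact mul_le_one₀ hUn (norm_nonneg _) hDn
    nlinarith [norm_nonneg (U * G * Uᴴ * Aᴴ)]
  · have h1 : (U * G * Uᴴ * Aᴴ * A).trace = ∑ i, ((Real.sqrt (d i) : ℝ) : ℂ) := by
      rw [Matrix.mul_assoc _ Aᴴ, hspec]
      calc (U * G * Uᴴ * (U * Matrix.diagonal (fun i => (d i : ℂ)) * Uᴴ)).trace
          = (U * (G * (Uᴴ * U) * Matrix.diagonal (fun i => (d i : ℂ)) * Uᴴ)).trace := by
            simp only [Matrix.mul_assoc]
        _ = (G * Matrix.diagonal (fun i => (d i : ℂ))).trace := by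
            rw [Matrix.trace_mul_comm, hU, Matrix.mul_one, Matrix.mul_assoc _ Uᴴ U, hU,
              Matrix.mul_one]
        _ = _ := by
            simp only [G, Matrix.diagonal_mul_diagonal, Matrix.trace_diagonal, g,
              ← Complex.ofReal_mul]
            refine Finset.sum_congr rfl fun i _ => ?_
            congr 1
            by_cases h0 : d i = 0
            · simp [h0]
            · have hs : Real.sqrt (d i) ≠ 0 := (Real.sqrt_pos.mpr (lt_of_le_of_ne (hd0 i)
                (Ne.symm h0))).ne'
              nth_rewrite 2 [← Real.mul_self_sqrt (hd0 i)]
              field_simp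
    rw [h1, ← Complex.ofReal_sum, Complex.ofReal_re]
    rfl

/-- The Euclidean norm of a vector. -/
noncomputable abbrev euclNorm (x : ι → ℂ) : ℝ := ‖(WithLp.toLp 2 x : EuclideanSpace ℂ ι)‖

theorem star_dotProduct_self (x : ι → ℂ) : star x ⬝ᵥ x = ((euclNorm x ^ 2 : ℝ) : ℂ) := by
  rw [euclNorm, dotProduct_comm, ← EuclideanSpace.inner_toLp_toLp, inner_self_eq_norm_sq_to_K]
  norm_cast

theorem norm_star_dotProduct_mulVec_le {S : Matrix ι ι ℂ} (hS : ‖S‖ ≤ 1) (x y : ι → ℂ) :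
    ‖star x ⬝ᵥ S *ᵥ y‖ ≤ euclNorm x * euclNorm y := by
  rw [dotProduct_comm, ← EuclideanSpace.inner_toLp_toLp]
  refine (norm_inner_le_norm _ _).trans (mul_le_mul_of_nonneg_left ?_ (norm_nonneg _))
  refine (Matrix.l2_opNorm_mulVec S (WithLp.toLp 2 y)).trans ?_
  exact mul_le_of_le_one_left (norm_nonneg _) hS

/-- The distinguishability of a state `ρ` and a pure state `ψ` of infidelity `η` is `O(√η)`. The
vectors `w k` of a decomposition of `ρ` split into multiples of `ψ` and remainders that are
orthogonal to `ψ` and have total weight `η`. -/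
theorem re_trace_mul_sub_le {S : Matrix ι ι ℂ} (hS : ‖S‖ ≤ 1) {ρ : Matrix ι ι ℂ}
    (hρ : IsState ρ) {ψ : ι → ℂ} (hψ : star ψ ⬝ᵥ ψ = 1) :
    ((S * (ρ - Matrix.vecMulVec ψ (star ψ))).trace).re ≤
      4 * Real.sqrt (1 - (star ψ ⬝ᵥ (ρ *ᵥ ψ)).re) := by
  obtain ⟨m, w, hw⟩ := Matrix.posSemidef_iff_eq_sum_vecMulVec.mp hρ.1
  let c : Fin m → ℂ := fun k => star ψ ⬝ᵥ w k
  let u : Fin m → ι → ℂ := fun k => w k - c k • ψ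
  have hψu : ∀ k, star ψ ⬝ᵥ u k = 0 := by
    intro k
    simp only [u, dotProduct_sub, dotProduct_smul, hψ, smul_eq_mul, mul_one, c, sub_self]
  have huψ : ∀ k, star (u k) ⬝ᵥ ψ = 0 := by
    intro k
    rw [Matrix.star_dotProduct, hψu, star_zero]
  have hwu : ∀ k, w k = c k • ψ + u k := fun k => by simp [u]
  have hψn : euclNorm ψ = 1 := by
    rw [star_dotProduct_self] at hψ
    have h : euclNorm ψ ^ 2 = 1 := by exact_mod_cast hψ
    nlinarith [norm_nonneg (WithLp.toLp 2 ψ : EuclideanSpace ℂ ι)]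
  have htr : ∀ (M : Matrix ι ι ℂ) (x : ι → ℂ),
      (M * Matrix.vecMulVec x (star x)).trace = star x ⬝ᵥ (M *ᵥ x) := by
    intro M x
    rw [Matrix.mul_vecMulVec, Matrix.trace_vecMulVec, dotProduct_comm]
  have hnorm : ∀ k, euclNorm (w k) ^ 2 = ‖c k‖ ^ 2 + euclNorm (u k) ^ 2 := by
    intro k
    have h1 : star (w k) ⬝ᵥ w k = ((‖c k‖ ^ 2 + euclNorm (u k) ^ 2 : ℝ) : ℂ) := by
      nth_rewrite 1 2 [hwu k]
      rw [star_add, star_smul, add_dotProduct, dotProduct_add, dotProduct_add]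
      simp only [smul_dotProduct, dotProduct_smul, hψ, hψu, huψ, star_dotProduct_self (u k)]
      have h2 : star (c k) * c k = ((‖c k‖ ^ 2 : ℝ) : ℂ) := by
        rw [Complex.star_def, mul_comm, Complex.mul_conj, Complex.normSq_eq_norm_sq]
      simp only [smul_eq_mul, mul_one, mul_zero, add_zero, zero_add]
      rw [mul_comm (c k), h2]
      push_cast
      ring
    rw [star_dotProduct_self] at h1
    exact_mod_cast h1
  have hsum : ∑ k, euclNorm (w k) ^ 2 = 1 := by
    have h1 := hρ.2
    rw [hw, Matrix.trace_sum] at h1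
    simp only [Matrix.trace_vecMulVec, dotProduct_comm (w _), star_dotProduct_self] at h1
    exact_mod_cast h1
  have hfid : (star ψ ⬝ᵥ (ρ *ᵥ ψ)).re = ∑ k, ‖c k‖ ^ 2 := by
    rw [hw, Matrix.sum_mulVec, dotProduct_sum, Complex.re_sum]
    refine Finset.sum_congr rfl fun k _ => ?_
    rw [Matrix.vecMulVec_mulVec, op_smul_eq_smul, dotProduct_smul, smul_eq_mul,
      Matrix.star_dotProduct (w k) ψ]
    change (star (c k) * c k).re = _
    rw [Complex.star_def, mul_comm, Complex.mul_conj, Complex.normSq_eq_norm_sq]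
    exact Complex.ofReal_re _
  set η := 1 - (star ψ ⬝ᵥ (ρ *ᵥ ψ)).re with hη
  have hu2 : ∑ k, euclNorm (u k) ^ 2 = η := by
    simp only [hnorm, Finset.sum_add_distrib] at hsum
    rw [hη, hfid]
    linarith
  have hη0 : 0 ≤ η := hu2 ▸ Finset.sum_nonneg fun k _ => sq_nonneg _
  have hη1 : η ≤ 1 := by
    rw [hη, hfid, sub_le_self_iff]
    exact Finset.sum_nonneg fun k _ => sq_nonneg _
  have hterm : ∀ k, (star (w k) ⬝ᵥ (S *ᵥ w k)).re ≤
      ‖c k‖ ^ 2 * (star ψ ⬝ᵥ (S *ᵥ ψ)).re + 2 * (‖c k‖ * euclNorm (u k)) +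
        euclNorm (u k) ^ 2 := by
    intro k
    have hexp : star (w k) ⬝ᵥ (S *ᵥ w k) = star (c k) * c k * (star ψ ⬝ᵥ (S *ᵥ ψ)) +
        star (c k) * (star ψ ⬝ᵥ (S *ᵥ u k)) + c k * (star (u k) ⬝ᵥ (S *ᵥ ψ)) +
        star (u k) ⬝ᵥ (S *ᵥ u k) := by
      nth_rewrite 1 2 [hwu k]
      simp only [star_add, star_smul, add_dotProduct, Matrix.mulVec_add, Matrix.mulVec_smul,
        dotProduct_add, smul_dotProduct, dotProduct_smul, smul_eq_mul]
      ring
    have h2 : star (c k) * c k = ((‖c k‖ ^ 2 : ℝ) : ℂ) := by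
      rw [Complex.star_def, mul_comm, Complex.mul_conj, Complex.normSq_eq_norm_sq]
    have b1 := norm_star_dotProduct_mulVec_le hS ψ (u k)
    have b2 := norm_star_dotProduct_mulVec_le hS (u k) ψ
    have b3 := norm_star_dotProduct_mulVec_le hS (u k) (u k)
    rw [hψn] at b1 b2
    have c1 : (star (c k) * (star ψ ⬝ᵥ (S *ᵥ u k))).re ≤ ‖c k‖ * euclNorm (u k) := by
      refine (Complex.re_le_norm _).trans ?_
      rw [norm_mul, norm_star]
      exact mul_le_mul_of_nonneg_left (by linarith) (norm_nonneg _)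
    have c2 : (c k * (star (u k) ⬝ᵥ (S *ᵥ ψ))).re ≤ ‖c k‖ * euclNorm (u k) := by
      refine (Complex.re_le_norm _).trans ?_
      rw [norm_mul]
      exact mul_le_mul_of_nonneg_left (by linarith) (norm_nonneg _)
    have c3 := (Complex.re_le_norm (star (u k) ⬝ᵥ (S *ᵥ u k))).trans b3
    rw [hexp, h2]
    simp only [Complex.add_re, Complex.re_ofReal_mul]
    nlinarith
  have hcs : ∑ k, ‖c k‖ * euclNorm (u k) ≤ Real.sqrt η := by
    refine (Real.sum_mul_le_sqrt_mul_sqrt _ _ _).trans ?_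
    rw [hu2]
    refine mul_le_of_le_one_left (Real.sqrt_nonneg _) (Real.sqrt_le_one.mpr ?_)
    rw [← hfid]
    linarith
  have hψS : -1 ≤ (star ψ ⬝ᵥ (S *ᵥ ψ)).re := by
    have b := norm_star_dotProduct_mulVec_le hS ψ ψ
    rw [hψn, mul_one] at b
    linarith [(abs_le.mp (Complex.abs_re_le_norm (star ψ ⬝ᵥ (S *ᵥ ψ)))).1]
  have hηs : η ≤ Real.sqrt η := Real.le_sqrt_of_sq_le (by nlinarith)
  have hmain : ((S * (ρ - Matrix.vecMulVec ψ (star ψ))).trace).re =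
      ∑ k, (star (w k) ⬝ᵥ (S *ᵥ w k)).re - (star ψ ⬝ᵥ (S *ᵥ ψ)).re := by
    rw [Matrix.mul_sub, Matrix.trace_sub, htr, Complex.sub_re]
    nth_rewrite 1 [hw]
    rw [Matrix.mul_sum, Matrix.trace_sum, Complex.re_sum]
    simp only [htr]
  rw [hmain]
  have h1 := Finset.sum_le_sum fun k (_ : k ∈ Finset.univ) => hterm k
  rw [Finset.sum_add_distrib, Finset.sum_add_distrib, ← Finset.sum_mul, ← Finset.mul_sum, hu2,
    ← hfid] at h1
  have h2 : (star ψ ⬝ᵥ (ρ *ᵥ ψ)).re = 1 - η := by rw [hη]; ring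
  rw [h2] at h1
  nlinarith

end TraceNorm

/-! ### The magic basis of a register -/

section MagicBasis

variable {W : Type} [Fintype W] [DecidableEq W]

/-- The unitary with columns `|T⟩` and `|T^⊥⟩`. -/
noncomputable def magicUnitary₁ : Matrix (Fin 2) (Fin 2) ℂ := Matrix.of fun b s => magicKet s b

/-- The unitary whose columns are the products of `|T⟩` and `|T^⊥⟩`. -/
noncomputable def magicUnitary (W : Type) [Fintype W] : Op W := prodOp fun _ => magicUnitary₁

theorem magicUnitary₁_conjTranspose_mul_self : magicUnitary₁ᴴ * magicUnitary₁ = 1 := by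
  ext s s'
  rw [Matrix.one_apply, ← star_magicKet_dotProduct]
  rfl

theorem magicUnitary_conjTranspose_mul_self :
    (magicUnitary W)ᴴ * magicUnitary W = 1 := by
  rw [magicUnitary, prodOp_conjTranspose, prodOp_mul, magicUnitary₁_conjTranspose_mul_self,
    prodOp_one]

theorem magicUnitary_mul_conjTranspose :
    magicUnitary W * (magicUnitary W)ᴴ = 1 :=
  mul_eq_one_comm.mp magicUnitary_conjTranspose_mul_self

theorem magicUnitary_mul_diagonal_mul (f : (W → Fin 2) → ℂ) :
    magicUnitary W * Matrix.diagonal f * (magicUnitary W)ᴴ = ∑ s, f s • magicState s := by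
  ext x y
  rw [Matrix.sum_apply, Matrix.mul_apply]
  simp only [Matrix.mul_diagonal, Matrix.conjTranspose_apply, Matrix.smul_apply,
    smul_eq_mul, magicState, magicUnitary, prodOp, magicUnitary₁, Matrix.of_apply, proj,
    Matrix.vecMulVec_apply, Finset.prod_mul_distrib, Pi.star_apply, star_prod]
  exact Finset.sum_congr rfl fun s _ => by ring

theorem magicUnitary_mulVec_single (s : W → Fin 2) :
    magicUnitary W *ᵥ Pi.single s 1 = prodVec fun i => magicKet (s i) := by
  ext x
  simp [magicUnitary, prodOp, magicUnitary₁, prodVec]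

/-- The matrix of `ρ` in the magic basis. -/
noncomputable def magicMatrix (ρ : Op W) : Op W := (magicUnitary W)ᴴ * ρ * magicUnitary W

theorem eq_magicUnitary_mul (ρ : Op W) :
    ρ = magicUnitary W * magicMatrix ρ * (magicUnitary W)ᴴ := by
  calc ρ = (magicUnitary W * (magicUnitary W)ᴴ) * ρ * (magicUnitary W * (magicUnitary W)ᴴ) := by
        rw [magicUnitary_mul_conjTranspose, one_mul, mul_one]
    _ = _ := by simp only [magicMatrix, mul_assoc]

/-- The probability of the outcome `s` when `ρ` is measured in the magic basis. -/
noncomputable def magicProb (ρ : Op W) (s : W → Fin 2) : ℝ := (magicMatrix ρ s s).re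

theorem magicMatrix_posSemidef {ρ : Op W} (hρ : IsState ρ) : (magicMatrix ρ).PosSemidef := by
  have := hρ.1.mul_mul_conjTranspose_same (magicUnitary W)ᴴ
  rwa [Matrix.conjTranspose_conjTranspose] at this

theorem magicProb_nonneg {ρ : Op W} (hρ : IsState ρ) (s : W → Fin 2) : 0 ≤ magicProb ρ s :=
  (Complex.le_def.mp ((magicMatrix_posSemidef hρ).diag_nonneg (i := s))).1

theorem magicMatrix_diag {ρ : Op W} (hρ : IsState ρ) (s : W → Fin 2) :
    magicMatrix ρ s s = (magicProb ρ s : ℂ) := by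
  apply Complex.ext
  · rfl
  · exact (Complex.le_def.mp ((magicMatrix_posSemidef hρ).diag_nonneg (i := s))).2.symm

theorem sum_magicProb {ρ : Op W} (hρ : IsState ρ) : ∑ s, magicProb ρ s = 1 := by
  have h : (magicMatrix ρ).trace = 1 := by
    rw [magicMatrix, Matrix.trace_mul_comm, ← mul_assoc, magicUnitary_mul_conjTranspose, one_mul,
      hρ.2]
  simp only [Matrix.trace, Matrix.diag, magicMatrix_diag hρ] at h
  exact_mod_cast h

end MagicBasis

/-! ### Dephasing, permuting and distilling block by block -/

section Procedure

theorem gateZhat_mul_magicUnitary₁ :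
    gateZhat * magicUnitary₁ = magicUnitary₁ * Matrix.diagonal magicPhase := by
  have ho := omega_sq
  ext b s
  rw [Matrix.mul_diagonal]
  rcases Fin.eq_zero_or_one b with rfl | rfl
  · simp [gateZhat, gateP, gateX, magicUnitary₁, Matrix.mul_apply, Fin.sum_univ_two,
      magicKet_zero_apply, magicKet_one_apply]
    ring
  · have h := magicPhase_sq s
    simp only [gateZhat, gateP, gateX, magicUnitary₁, Matrix.mul_apply, Fin.sum_univ_two,
      Matrix.of_apply, magicKet_zero_apply, magicKet_one_apply]
    simp
    linear_combination (-(Real.sqrt 2 : ℂ)⁻¹) * h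

theorem gateZhat_pow_mul_magicUnitary₁ (k : ℕ) :
    gateZhat ^ k * magicUnitary₁ = magicUnitary₁ * Matrix.diagonal fun b => magicPhase b ^ k := by
  induction k with
  | zero => simp
  | succ k ih =>
    rw [pow_succ, mul_assoc, gateZhat_mul_magicUnitary₁, ← mul_assoc, ih, mul_assoc,
      Matrix.diagonal_mul_diagonal]
    simp only [pow_succ]

theorem prodOp_diagonal {W : Type} [Fintype W] [DecidableEq W] (f : W → Fin 2 → ℂ) :
    prodOp (fun i => Matrix.diagonal (f i)) = Matrix.diagonal fun x => ∏ i, f i (x i) := by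
  ext x y
  rw [Matrix.diagonal_apply]
  split_ifs with h
  · subst h
    simp [prodOp]
  · obtain ⟨i, hi⟩ := Function.ne_iff.mp h
    exact Finset.prod_eq_zero (Finset.mem_univ i) (Matrix.diagonal_apply_ne _ hi)

theorem magicPhase_mul_star (a b : Fin 2) :
    magicPhase a * star (magicPhase b) = if a = b then 1 else -1 := by
  have h := omega_mul_star_omega
  rw [Complex.star_def] at *
  rcases Fin.eq_zero_or_one a with rfl | rfl <;> rcases Fin.eq_zero_or_one b with rfl | rfl <;>
    simp [magicPhase, h]

/-- `Ẑ` is diagonal in the magic basis with distinct eigenvalues, so that dephasing keeps the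
diagonal of the state in this basis and removes the rest. -/
theorem dephase_eq {m : ℕ} (ρ : Op (Fin m)) :
    dephase ρ = ∑ s, magicMatrix ρ s s • magicState s := by
  have hZ : ∀ s : Fin m → Fin 2, prodOp (fun i => gateZhat ^ (s i : ℕ)) * magicUnitary (Fin m) =
      magicUnitary (Fin m) * Matrix.diagonal fun x => ∏ i, magicPhase (x i) ^ (s i : ℕ) := by
    intro s
    rw [magicUnitary, prodOp_mul, ← prodOp_diagonal fun i b => magicPhase b ^ (s i : ℕ),
      prodOp_mul]
    simp only [gateZhat_pow_mul_magicUnitary₁]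
  have hterm : ∀ s : Fin m → Fin 2,
      prodOp (fun i => gateZhat ^ (s i : ℕ)) * ρ * (prodOp fun i => gateZhat ^ (s i : ℕ))ᴴ =
      magicUnitary (Fin m) * ((Matrix.diagonal fun x => ∏ i, magicPhase (x i) ^ (s i : ℕ)) *
        magicMatrix ρ * (Matrix.diagonal fun x => ∏ i, magicPhase (x i) ^ (s i : ℕ))ᴴ) *
        (magicUnitary (Fin m))ᴴ := by
    intro s
    calc _ = (prodOp (fun i => gateZhat ^ (s i : ℕ)) * magicUnitary (Fin m)) * magicMatrix ρ *
          (prodOp (fun i => gateZhat ^ (s i : ℕ)) * magicUnitary (Fin m))ᴴ := by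
          nth_rewrite 1 [eq_magicUnitary_mul ρ]
          simp only [Matrix.conjTranspose_mul, mul_assoc]
      _ = _ := by
          rw [hZ]
          simp only [Matrix.conjTranspose_mul, mul_assoc]
  rw [← magicUnitary_mul_diagonal_mul]
  simp only [dephase, hterm]
  rw [← Finset.sum_mul, ← Finset.mul_sum, ← Matrix.smul_mul, ← Matrix.mul_smul]
  congr 2
  ext x y
  rw [Matrix.smul_apply, Matrix.sum_apply, Matrix.diagonal_apply]
  simp only [Matrix.diagonal_conjTranspose, Matrix.mul_diagonal, Matrix.diagonal_mul,
    Pi.star_apply, star_prod, star_pow]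
  have hsum : ∑ s : Fin m → Fin 2, (∏ i, magicPhase (x i) ^ (s i : ℕ)) * magicMatrix ρ x y *
      ∏ i, star (magicPhase (y i)) ^ (s i : ℕ) =
      magicMatrix ρ x y * ∏ i, (1 + magicPhase (x i) * star (magicPhase (y i))) := by
    have h1 : ∀ i, 1 + magicPhase (x i) * star (magicPhase (y i)) =
        ∑ b : Fin 2, (magicPhase (x i) * star (magicPhase (y i))) ^ (b : ℕ) := by
      intro i
      simp [Fin.sum_univ_two]
    simp only [h1]
    rw [Finset.prod_univ_sum, Fintype.piFinset_univ, Finset.mul_sum]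
    refine Finset.sum_congr rfl fun s _ => ?_
    simp only [mul_pow, Finset.prod_mul_distrib]
    ring
  rw [hsum]
  split_ifs with hxy
  · subst hxy
    have h2 : ∀ i, 1 + magicPhase (x i) * star (magicPhase (x i)) = 2 := by
      intro i
      rw [magicPhase_mul_star, if_pos rfl]
      norm_num
    simp only [h2, Finset.prod_const, Finset.card_univ, Fintype.card_fin, smul_eq_mul]
    field_simp
  · obtain ⟨i, hi⟩ := Function.ne_iff.mp hxy
    rw [Finset.prod_eq_zero (Finset.mem_univ i), mul_zero, smul_zero]
    rw [magicPhase_mul_star, if_neg hi]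
    norm_num

theorem permOp_mulVec {W : Type} [Fintype W] [DecidableEq W] (π : Equiv.Perm W)
    (v : (W → Fin 2) → ℂ) : permOp π *ᵥ v = fun x => v (x ∘ π.symm) := by
  ext x
  simp [Matrix.mulVec, dotProduct, permOp]

theorem permOp_mul_mul {W : Type} [Fintype W] [DecidableEq W] (π : Equiv.Perm W) (M : Op W) :
    permOp π * M * (permOp π)ᴴ = M.submatrix (fun x => x ∘ π.symm) fun x => x ∘ π.symm := by
  ext x y
  simp [Matrix.mul_apply, permOp]

theorem permOp_mul_magicState {W : Type} [Fintype W] [DecidableEq W] (π : Equiv.Perm W)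
    (s : W → Fin 2) : permOp π * magicState s * (permOp π)ᴴ = magicState (s ∘ π) := by
  rw [permOp_mul_mul]
  ext x y
  simp only [magicState, prodOp, Matrix.submatrix_apply, Function.comp_apply]
  rw [← Equiv.prod_comp π]
  simp

variable {t n : ℕ}

theorem blockwise_sum {ι : Type*} (Φ : Op (Fin n) → Matrix (Fin 2) (Fin 2) ℂ) (A : Finset ι)
    (c : ι → ℂ) (M : ι → Op (Fin (t * n))) :
    blockwise Φ (∑ k ∈ A, c k • M k) = ∑ k ∈ A, c k • blockwise Φ (M k) := by
  ext u v
  rw [Matrix.sum_apply]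
  simp only [blockwise, Matrix.smul_apply, Matrix.sum_apply, smul_eq_mul, Finset.sum_mul,
    Finset.mul_sum]
  conv_rhs => rw [Finset.sum_comm]
  refine Finset.sum_congr rfl fun x _ => ?_
  conv_rhs => rw [Finset.sum_comm]
  refine Finset.sum_congr rfl fun y _ => Finset.sum_congr rfl fun k _ => by ring

/-- Bit strings of length `t n` as `t` blocks of length `n`. -/
def blockEquiv (t n : ℕ) : (Fin (t * n) → Fin 2) ≃ (Fin t → Fin n → Fin 2) where
  toFun := block
  invFun σ i := σ (finProdFinEquiv.symm i).1 (finProdFinEquiv.symm i).2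
  left_inv x := by
    ext1 i
    exact congrArg x (finProdFinEquiv.apply_symm_apply i)
  right_inv σ := by
    ext1 b
    ext1 j
    simp [block]

theorem blockwise_prodOp (Φ : Op (Fin n) →ₗ[ℂ] Matrix (Fin 2) (Fin 2) ℂ)
    (A : Fin (t * n) → Matrix (Fin 2) (Fin 2) ℂ) :
    blockwise Φ (prodOp A) =
      prodOp fun b => Φ (prodOp fun j => A (finProdFinEquiv (b, j))) := by
  have hΦ : ∀ (M : Op (Fin n)) (b b' : Fin 2),
      Φ M b b' = ∑ α, ∑ β, M α β * Φ (Matrix.single α β 1) b b' := by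
    intro M b b'
    conv_lhs => rw [Matrix.matrix_eq_sum_single M]
    simp only [map_sum, Matrix.sum_apply]
    refine Finset.sum_congr rfl fun α _ => Finset.sum_congr rfl fun β _ => ?_
    have : Matrix.single α β (M α β) = M α β • Matrix.single α β (1 : ℂ) := by
      rw [Matrix.smul_single, smul_eq_mul, mul_one]
    rw [this, map_smul, Matrix.smul_apply, smul_eq_mul]
  ext u v
  have hprod : ∀ x y : Fin (t * n) → Fin 2, prodOp A x y =
      ∏ b : Fin t, prodOp (fun j => A (finProdFinEquiv (b, j))) (block x b) (block y b) := by
    intro x y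
    simp only [prodOp, block]
    rw [← Equiv.prod_comp finProdFinEquiv, Fintype.prod_prod_type]
  simp only [blockwise, hprod, ← Finset.prod_mul_distrib]
  have h1 := Equiv.sum_comp (blockEquiv t n) fun σ => ∑ τ : Fin t → Fin n → Fin 2, ∏ b,
    prodOp (fun j => A (finProdFinEquiv (b, j))) (σ b) (τ b) *
      Φ (Matrix.single (σ b) (τ b) 1) (u b) (v b)
  have h2 : ∀ x : Fin (t * n) → Fin 2, ∑ y : Fin (t * n) → Fin 2, ∏ b,
      prodOp (fun j => A (finProdFinEquiv (b, j))) (block x b) (block y b) *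
      Φ (Matrix.single (block x b) (block y b) 1) (u b) (v b) = ∑ τ : Fin t → Fin n → Fin 2, ∏ b,
      prodOp (fun j => A (finProdFinEquiv (b, j))) (block x b) (τ b) *
      Φ (Matrix.single (block x b) (τ b) 1) (u b) (v b) := fun x =>
    Equiv.sum_comp (blockEquiv t n) fun τ => ∏ b,
      prodOp (fun j => A (finProdFinEquiv (b, j))) (block x b) (τ b) *
      Φ (Matrix.single (block x b) (τ b) 1) (u b) (v b)
  simp only [h2]
  refine h1.trans ?_
  conv_rhs => rw [prodOp]
  rw [Finset.prod_congr rfl fun b _ => hΦ _ (u b) (v b)]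
  rw [Finset.prod_univ_sum, Fintype.piFinset_univ]
  refine Finset.sum_congr rfl fun σ _ => ?_
  rw [Finset.prod_univ_sum, Fintype.piFinset_univ]

/-- The output of the circuit in each of the blocks, on the error pattern `s`. -/
noncomputable def blockOutput (D : Circuit n) (s : Fin (t * n) → Fin 2) : Op (Fin t) :=
  prodOp fun b => D.channel (magicState (block s b))

theorem distill_eq (D : (n : ℕ) → Circuit n) (ρ : Op (Fin (t * n))) :
    distill D t n ρ = ∑ s, magicMatrix ρ s s • (((t * n).factorial : ℂ))⁻¹ •
      ∑ π : Equiv.Perm (Fin (t * n)), blockOutput (D n) (s ∘ π) := by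
  have h1 : randomPermute (dephase ρ) = ∑ s, magicMatrix ρ s s •
      ∑ π : Equiv.Perm (Fin (t * n)), (((t * n).factorial : ℂ))⁻¹ • magicState (s ∘ π) := by
    rw [dephase_eq, randomPermute]
    simp only [Matrix.mul_sum, Matrix.sum_mul, Matrix.mul_smul, Matrix.smul_mul,
      permOp_mul_magicState]
    rw [Finset.sum_comm]
    simp only [Finset.smul_sum, smul_comm (magicMatrix ρ _ _)]
  have h2 : ∀ M : Op (Fin (t * n)),
      blockwise (D n).channel M = blockwise (D n).channelₗ M := fun _ => rfl
  rw [distill, h1, blockwise_sum]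
  refine Finset.sum_congr rfl fun s _ => ?_
  rw [blockwise_sum, ← Finset.smul_sum]
  congr 2
  refine Finset.sum_congr rfl fun π _ => ?_
  rw [h2, magicState, blockwise_prodOp]
  rfl

end Procedure

/-! ### Averages over permutations and over independent errors -/

section Averages

/-- The number of `1`s in a bit string. -/
def weight {W : Type} [Fintype W] (s : W → Fin 2) : ℕ :=
  (Finset.univ.filter fun i => s i = 1).card

/-- The terms of the binomial distribution with mean `w` increase up to `w` and decrease from `w`
on. -/
theorem choose_mul_pow_le {m w : ℕ} (hw : w ≤ m) (j : ℕ) :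
    m.choose j * w ^ j * (m - w) ^ (m - j) ≤ m.choose w * w ^ w * (m - w) ^ (m - w) := by
  obtain ⟨v, rfl⟩ := Nat.exists_eq_add_of_le hw
  have hv : w + v - w = v := by omega
  rw [hv]
  let a : ℕ → ℕ := fun j => (w + v).choose j * w ^ j * v ^ (w + v - j)
  -- The ratio of consecutive terms is `(m - j) w / ((j + 1) (m - w))`.
  have hratio : ∀ j, j < w + v → ∃ e, (j + 1) * a (j + 1) = (w + v - j) * w * e ∧
      (j + 1) * a j = (j + 1) * v * e := by
    intro j hj
    refine ⟨(w + v).choose j * w ^ j * v ^ (w + v - (j + 1)), ?_, ?_⟩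
    · have := Nat.choose_succ_right_eq (w + v) j
      simp only [a]
      calc (j + 1) * ((w + v).choose (j + 1) * w ^ (j + 1) * v ^ (w + v - (j + 1)))
          = ((w + v).choose (j + 1) * (j + 1)) * w ^ (j + 1) * v ^ (w + v - (j + 1)) := by ring
        _ = _ := by rw [this]; ring
    · simp only [a]
      rw [show w + v - j = w + v - (j + 1) + 1 by omega]
      ring
  have hup : ∀ d, d ≤ w → a (w - d) ≤ a w := by
    intro d
    induction d with
    | zero => simp
    | succ d ih =>
      intro hd
      refine le_trans ?_ (ih (by omega))
      obtain ⟨e, h1, h2⟩ := hratio (w - (d + 1)) (by omega)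
      rw [show w - d = w - (d + 1) + 1 by omega]
      refine Nat.le_of_mul_le_mul_left (c := w - (d + 1) + 1) ?_ (by omega)
      rw [h1, h2]
      refine Nat.mul_le_mul_right _ ?_
      obtain ⟨j, hj⟩ : ∃ j, w = j + (d + 1) := ⟨w - (d + 1), by omega⟩
      rw [show w - (d + 1) = j by omega, show w + v - j = v + (d + 1) by omega, hj]
      nlinarith
  have hdown : ∀ d, a (w + d) ≤ a w := by
    intro d
    induction d with
    | zero => simp
    | succ d ih =>
      by_cases hd : w + d < w + v
      · refine le_trans ?_ ih
        obtain ⟨e, h1, h2⟩ := hratio (w + d) hd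
        refine Nat.le_of_mul_le_mul_left (c := w + d + 1) ?_ (by omega)
        rw [← add_assoc, h1, h2]
        refine Nat.mul_le_mul_right _ ?_
        obtain ⟨q, hq⟩ : ∃ q, v = d + q := ⟨v - d, by omega⟩
        rw [show w + v - (w + d) = q by omega, hq]
        nlinarith
      · simp only [a]
        rw [Nat.choose_eq_zero_of_lt (by omega : w + v < w + (d + 1))]
        simp
  change a j ≤ _
  have hgoal : a w = (w + v).choose w * w ^ w * v ^ v := by simp [a]
  rw [← hgoal]
  rcases le_total j w with h | h
  · have := hup (w - j) (by omega)
    rwa [show w - (w - j) = j by omega] at this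
  · have := hdown (j - w)
    rwa [show w + (j - w) = j by omega] at this

theorem one_le_succ_mul_binomial {m w : ℕ} (hm : m ≠ 0) (hw : w ≤ m) :
    1 ≤ ((m : ℝ) + 1) * (m.choose w * ((w : ℝ) / m) ^ w * (1 - (w : ℝ) / m) ^ (m - w)) := by
  have hm' : (m : ℝ) ≠ 0 := by exact_mod_cast hm
  have h1 : m ^ m ≤ (m + 1) * (m.choose w * w ^ w * (m - w) ^ (m - w)) := by
    calc m ^ m = (w + (m - w)) ^ m := by rw [Nat.add_sub_cancel' hw]
      _ = ∑ j ∈ Finset.range (m + 1), w ^ j * (m - w) ^ (m - j) * m.choose j := by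
          rw [add_pow]; rfl
      _ ≤ ∑ j ∈ Finset.range (m + 1), m.choose w * w ^ w * (m - w) ^ (m - w) := by
          refine Finset.sum_le_sum fun j _ => ?_
          refine le_trans (le_of_eq ?_) (choose_mul_pow_le hw j)
          ring
      _ = _ := by simp
  have h2 : ((m : ℝ) + 1) * (m.choose w * ((w : ℝ) / m) ^ w * (1 - (w : ℝ) / m) ^ (m - w)) =
      (((m + 1) * (m.choose w * w ^ w * (m - w) ^ (m - w)) : ℕ) : ℝ) / ((m ^ m : ℕ) : ℝ) := by
    have h3 : (m : ℝ) ^ m = (m : ℝ) ^ w * (m : ℝ) ^ (m - w) := by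
      rw [← pow_add, Nat.add_sub_cancel' hw]
    rw [one_sub_div hm', div_pow, div_pow]
    push_cast [Nat.cast_sub hw]
    rw [h3]
    field_simp
  rw [h2, one_le_div (by positivity)]
  exact_mod_cast h1

variable {W : Type} [Fintype W] [DecidableEq W]

theorem iidWeight_eq (ε : ℝ) (s : W → Fin 2) :
    iidWeight ε s = ε ^ weight s * (1 - ε) ^ (Fintype.card W - weight s) := by
  have h : ∀ i, (if s i = 0 then 1 - ε else ε) = if s i = 1 then ε else 1 - ε := by
    intro i
    rcases Fin.eq_zero_or_one (s i) with h | h <;> simp [h]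
  simp only [iidWeight, h]
  rw [Finset.prod_ite, Finset.prod_const, Finset.prod_const, weight, Finset.filter_not,
    Finset.card_sdiff_of_subset (Finset.filter_subset _ _), Finset.card_univ]

theorem weight_comp (s : W → Fin 2) (π : Equiv.Perm W) : weight (s ∘ π) = weight s :=
  Finset.card_bijective π π.bijective (by simp)

theorem weight_le (s : W → Fin 2) : weight s ≤ Fintype.card W := Finset.card_le_univ _

theorem card_weight_eq (w : ℕ) :
    ((Finset.univ : Finset (W → Fin 2)).filter fun s => weight s = w).card =
      (Fintype.card W).choose w := by
  rw [← Finset.card_univ, ← Finset.card_powersetCard]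
  refine Finset.card_nbij' (fun s => Finset.univ.filter fun i => s i = 1)
    (fun A i => if i ∈ A then 1 else 0) ?_ ?_ ?_ ?_
  · intro s hs
    have h : weight s = w := (Finset.mem_filter.mp (Finset.mem_coe.mp hs)).2
    exact Finset.mem_coe.mpr (Finset.mem_powersetCard.mpr ⟨Finset.subset_univ _, h⟩)
  · intro A hA
    have h := (Finset.mem_powersetCard.mp (Finset.mem_coe.mp hA)).2
    exact Finset.mem_coe.mpr (Finset.mem_filter.mpr ⟨Finset.mem_univ _, by simpa [weight] using h⟩)
  · intro s _
    ext1 i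
    rcases Fin.eq_zero_or_one (s i) with h | h <;> simp [h]
  · intro A _
    ext i
    simp

theorem exists_perm_of_weight_eq {s s' : W → Fin 2} (h : weight s = weight s') :
    ∃ σ : Equiv.Perm W, s' = s ∘ σ := by
  have hcard : Fintype.card {i // s' i = 1} = Fintype.card {i // s i = 1} := by
    rw [Fintype.card_subtype, Fintype.card_subtype]
    exact h.symm
  let e := Fintype.equivOfCardEq hcard
  refine ⟨e.extendSubtype, funext fun i => ?_⟩
  by_cases hi : s' i = 1
  · rw [hi, Function.comp_apply, e.extendSubtype_mem i hi]
  · have h1 := e.extendSubtype_not_mem i hi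
    rw [(Fin.eq_zero_or_one _).resolve_right hi, Function.comp_apply,
      (Fin.eq_zero_or_one _).resolve_right h1]

theorem iidExp_comp_perm (ε : ℝ) (X : (W → Fin 2) → ℝ) (π : Equiv.Perm W) :
    iidExp ε (fun s => X (s ∘ π)) = iidExp ε X := by
  have h := Equiv.sum_comp (Equiv.arrowCongr π.symm (Equiv.refl (Fin 2)))
    (fun s => iidWeight ε s * X s)
  rw [iidExp, iidExp, ← h]
  refine Finset.sum_congr rfl fun s _ => ?_
  have : (Equiv.arrowCongr π.symm (Equiv.refl (Fin 2))) s = s ∘ π := by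
    ext1 i
    simp
  rw [this, iidWeight_eq, iidWeight_eq, weight_comp]

/-- The average of `X` over the rearrangements of `s`. -/
noncomputable def permAvg (X : (W → Fin 2) → ℝ) (s : W → Fin 2) : ℝ :=
  ((Fintype.card W).factorial : ℝ)⁻¹ * ∑ π : Equiv.Perm W, X (s ∘ π)

theorem permAvg_mono {X Y : (W → Fin 2) → ℝ} (h : ∀ s, X s ≤ Y s) (s : W → Fin 2) :
    permAvg X s ≤ permAvg Y s :=
  mul_le_mul_of_nonneg_left (Finset.sum_le_sum fun _ _ => h _) (by positivity)

theorem permAvg_const (c : ℝ) (s : W → Fin 2) : permAvg (fun _ => c) s = c := by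
  rw [permAvg, Finset.sum_const, Finset.card_univ, Fintype.card_perm, nsmul_eq_mul,
    ← mul_assoc, inv_mul_cancel₀ (by positivity), one_mul]

theorem permAvg_const_mul (c : ℝ) (X : (W → Fin 2) → ℝ) (s : W → Fin 2) :
    permAvg (fun s => c * X s) s = c * permAvg X s := by
  simp only [permAvg, ← Finset.mul_sum]
  ring

theorem permAvg_sqrt_le {X : (W → Fin 2) → ℝ} (hX : ∀ s, 0 ≤ X s) (s : W → Fin 2) :
    permAvg (fun s => Real.sqrt (X s)) s ≤ Real.sqrt (permAvg X s) := by
  refine Real.le_sqrt_of_sq_le ?_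
  rw [permAvg, permAvg, mul_pow]
  have h := sq_sum_le_card_mul_sum_sq (s := (Finset.univ : Finset (Equiv.Perm W)))
    (f := fun π => Real.sqrt (X (s ∘ π)))
  simp only [Real.sq_sqrt (hX _), Finset.card_univ, Fintype.card_perm] at h
  have hpos : (0 : ℝ) < ((Fintype.card W).factorial : ℝ) := by positivity
  calc _ ≤ (((Fintype.card W).factorial : ℝ)⁻¹) ^ 2 *
        (((Fintype.card W).factorial : ℝ) * ∑ π : Equiv.Perm W, X (s ∘ π)) :=
        mul_le_mul_of_nonneg_left h (by positivity)
    _ = _ := by field_simp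

/-- The uniform distribution on the strings of weight `w` is at most `m + 1` times the
distribution of `m` independent bits of mean `w / m`, since `w` is the most likely of the `m + 1`
possible weights of the latter. -/
theorem permAvg_le_iidExp [Nonempty W] {X : (W → Fin 2) → ℝ} (hX : ∀ s, 0 ≤ X s)
    (s : W → Fin 2) :
    permAvg X s ≤ ((Fintype.card W : ℝ) + 1) *
      iidExp ((weight s : ℝ) / Fintype.card W) X := by
  set m := Fintype.card W with hm
  set w := weight s with hw
  set ε : ℝ := (w : ℝ) / m with hε
  have hm0 : m ≠ 0 := Fintype.card_ne_zero
  have hwm : w ≤ m := weight_le s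
  have h0 : 0 ≤ ε := by positivity
  have h1 : ε ≤ 1 := div_le_one_of_le₀ (by exact_mod_cast hwm) (by positivity)
  have hX' : ∀ s, 0 ≤ permAvg X s := fun s =>
    mul_nonneg (by positivity) (Finset.sum_nonneg fun _ _ => hX _)
  have havg : iidExp ε (permAvg X) = iidExp ε X := by
    change iidExp ε (fun s => ((Fintype.card W).factorial : ℝ)⁻¹ *
      ∑ π : Equiv.Perm W, X (s ∘ π)) = _
    rw [iidExp_const_mul, iidExp_sum]
    simp only [iidExp_comp_perm]
    rw [Finset.sum_const, Finset.card_univ, Fintype.card_perm, nsmul_eq_mul, ← mul_assoc,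
      inv_mul_cancel₀ (by positivity), one_mul]
  have hinv : ∀ s', weight s' = w → permAvg X s' = permAvg X s := by
    intro s' hs'
    obtain ⟨σ, rfl⟩ := exists_perm_of_weight_eq (hw.symm.trans hs'.symm)
    rw [permAvg, permAvg]
    congr 1
    exact Equiv.sum_comp (Equiv.mulLeft σ) fun π : Equiv.Perm W => X (s ∘ π)
  have hlow : m.choose w * ε ^ w * (1 - ε) ^ (m - w) * permAvg X s ≤ iidExp ε X := by
    rw [← havg, iidExp]
    calc _ = ∑ s' ∈ (Finset.univ : Finset (W → Fin 2)).filter fun s => weight s = w,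
          iidWeight ε s' * permAvg X s' := by
          rw [Finset.sum_congr rfl (g := fun _ => ε ^ w * (1 - ε) ^ (m - w) * permAvg X s),
            Finset.sum_const, card_weight_eq, nsmul_eq_mul]
          · ring
          · intro s' hs'
            have hs'' := (Finset.mem_filter.mp hs').2
            rw [iidWeight_eq, hinv s' hs'', hs'']
      _ ≤ _ := Finset.sum_le_sum_of_subset_of_nonneg (Finset.filter_subset _ _)
          fun s' _ _ => mul_nonneg (iidWeight_nonneg h0 h1 s') (hX' s')
  have hone := one_le_succ_mul_binomial hm0 hwm
  calc permAvg X s = 1 * permAvg X s := (one_mul _).symm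
    _ ≤ ((m : ℝ) + 1) * (m.choose w * ε ^ w * (1 - ε) ^ (m - w)) * permAvg X s :=
        mul_le_mul_of_nonneg_right hone (hX' s)
    _ = ((m : ℝ) + 1) * (m.choose w * ε ^ w * (1 - ε) ^ (m - w) * permAvg X s) := by ring
    _ ≤ _ := mul_le_mul_of_nonneg_left hlow (by positivity)

/-- The coordinates selected by an injection are again independent: exchanging them with an
independent sample preserves the joint weight. -/
theorem iidExp_comp_injective {V : Type} [Fintype V] [DecidableEq V] (ε : ℝ) {e : V → W}
    (he : Function.Injective e) (X : (V → Fin 2) → ℝ) :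
    iidExp ε (fun s : W → Fin 2 => X (s ∘ e)) = iidExp ε X := by
  let f : (W → Fin 2) × (V → Fin 2) → (W → Fin 2) × (V → Fin 2) :=
    fun p => (Function.extend e p.2 p.1, p.1 ∘ e)
  have hf : Function.Involutive f := by
    rintro ⟨s, r⟩
    refine Prod.ext (funext fun i => ?_) (funext fun v => ?_)
    · by_cases hi : ∃ v, e v = i
      · obtain ⟨v, rfl⟩ := hi
        simp [f, he.extend_apply]
      · simp [f, Function.extend_apply' _ _ _ hi]
    · simp [f, he.extend_apply]
  have hsplit : ∀ s : W → Fin 2, iidWeight ε s = iidWeight ε (s ∘ e) *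
      ∏ i ∈ (Finset.univ.image e)ᶜ, if s i = 0 then 1 - ε else ε := by
    intro s
    rw [iidWeight, ← Finset.prod_mul_prod_compl (Finset.univ.image e),
      Finset.prod_image he.injOn]
    rfl
  have hw : ∀ s r, iidWeight ε (Function.extend e r s) * iidWeight ε (s ∘ e) =
      iidWeight ε s * iidWeight ε r := by
    intro s r
    rw [hsplit (Function.extend e r s), hsplit s, Function.extend_comp he r s]
    have : ∏ i ∈ (Finset.univ.image e)ᶜ, (if Function.extend e r s i = 0 then 1 - ε else ε) =
        ∏ i ∈ (Finset.univ.image e)ᶜ, if s i = 0 then 1 - ε else ε := by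
      refine Finset.prod_congr rfl fun i hi => ?_
      rw [Function.extend_apply']
      rintro ⟨v, rfl⟩
      simp at hi
    rw [this]
    ring
  have h := Equiv.sum_comp hf.toPerm
    (fun p : (W → Fin 2) × (V → Fin 2) => iidWeight ε p.1 * iidWeight ε p.2 * X p.2)
  simp only [Function.Involutive.coe_toPerm, f, hw, Fintype.sum_prod_type] at h
  calc iidExp ε (fun s : W → Fin 2 => X (s ∘ e))
      = ∑ s : W → Fin 2, ∑ r : V → Fin 2, iidWeight ε s * iidWeight ε r * X (s ∘ e) := by
        refine Finset.sum_congr rfl fun s _ => ?_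
        rw [← Finset.sum_mul, ← Finset.mul_sum, sum_iidWeight, mul_one]
    _ = ∑ s : W → Fin 2, ∑ r : V → Fin 2, iidWeight ε s * iidWeight ε r * X r := h
    _ = iidExp ε X := by
        rw [Finset.sum_comm, iidExp]
        refine Finset.sum_congr rfl fun r _ => ?_
        rw [← Finset.sum_mul, ← Finset.sum_mul, sum_iidWeight, one_mul]

end Averages

/-! ### The low-weight subspace in the magic basis -/

section LowWeight

variable {m : ℕ}

/-- The orthogonal projector onto the span of the magic basis vectors of weight at most `ℓ`. -/
noncomputable def magicLowProj (m ℓ : ℕ) : Op (Fin m) :=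
  magicUnitary (Fin m) * Matrix.diagonal (fun s => if weight s ≤ ℓ then 1 else 0) *
    (magicUnitary (Fin m))ᴴ

theorem magicLowProj_conjTranspose (m ℓ : ℕ) : (magicLowProj m ℓ)ᴴ = magicLowProj m ℓ := by
  rw [magicLowProj, Matrix.conjTranspose_mul, Matrix.conjTranspose_mul,
    Matrix.conjTranspose_conjTranspose, Matrix.diagonal_conjTranspose, ← mul_assoc]
  congr 3
  ext s
  simp only [Pi.star_apply]
  split_ifs <;> simp

theorem magicLowProj_mul_self (m ℓ : ℕ) :
    magicLowProj m ℓ * magicLowProj m ℓ = magicLowProj m ℓ := by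
  rw [magicLowProj]
  calc _ = magicUnitary (Fin m) * Matrix.diagonal (fun s => if weight s ≤ ℓ then 1 else 0) *
        ((magicUnitary (Fin m))ᴴ * magicUnitary (Fin m)) *
        Matrix.diagonal (fun s => if weight s ≤ ℓ then 1 else 0) * (magicUnitary (Fin m))ᴴ := by
        simp only [mul_assoc]
    _ = _ := by
        rw [magicUnitary_conjTranspose_mul_self, mul_one, mul_assoc (magicUnitary (Fin m)),
          Matrix.diagonal_mul_diagonal]
        simp only [mul_ite, mul_one, mul_zero, ← ite_and, and_self]

theorem magicLowProj_mulVec {ℓ : ℕ} {s : Fin m → Fin 2} (h : weight s ≤ ℓ) :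
    magicLowProj m ℓ *ᵥ (prodVec fun i => magicKet (s i)) = prodVec fun i => magicKet (s i) := by
  rw [← magicUnitary_mulVec_single, magicLowProj, Matrix.mulVec_mulVec, mul_assoc, mul_assoc,
    magicUnitary_conjTranspose_mul_self, mul_one, ← Matrix.mulVec_mulVec,
    Matrix.diagonal_mulVec_single, if_pos h, one_mul]

theorem re_trace_magicLowProj_mul (ℓ : ℕ) (ρ : Op (Fin m)) :
    ((magicLowProj m ℓ * ρ).trace).re =
      ∑ s, if weight s ≤ ℓ then magicProb ρ s else 0 := by
  have h : (magicLowProj m ℓ * ρ).trace =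
      (Matrix.diagonal (fun s => if weight s ≤ ℓ then 1 else 0) * magicMatrix ρ).trace := by
    rw [magicLowProj, magicMatrix, mul_assoc, mul_assoc, Matrix.trace_mul_comm]
    simp only [mul_assoc]
  rw [h, Matrix.trace, Complex.re_sum]
  refine Finset.sum_congr rfl fun s _ => ?_
  rw [Matrix.diag_apply, Matrix.diagonal_mul]
  split_ifs <;> simp [magicProb]

theorem toEuclideanLin_lowWeightProj (m ℓ : ℕ) :
    Matrix.toEuclideanLin (lowWeightProj m ℓ) =
      ((lowWeight m ℓ).starProjection : EuclideanSpace ℂ (Fin m → Fin 2) →ₗ[ℂ]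
        EuclideanSpace ℂ (Fin m → Fin 2)) :=
  LinearEquiv.apply_symm_apply _ _

theorem lowWeightProj_conjTranspose (m ℓ : ℕ) : (lowWeightProj m ℓ)ᴴ = lowWeightProj m ℓ := by
  have h := (lowWeight m ℓ).starProjection_isSymmetric
  rw [← toEuclideanLin_lowWeightProj] at h
  exact Matrix.isSymmetric_toEuclideanLin_iff.mp h

theorem lowWeightProj_mulVec_mem (m ℓ : ℕ) (v : (Fin m → Fin 2) → ℂ) :
    WithLp.toLp 2 (lowWeightProj m ℓ *ᵥ v) ∈ lowWeight m ℓ := by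
  have h : WithLp.toLp 2 (lowWeightProj m ℓ *ᵥ v) =
      Matrix.toEuclideanLin (lowWeightProj m ℓ) (WithLp.toLp 2 v) := rfl
  rw [h, toEuclideanLin_lowWeightProj]
  exact Submodule.starProjection_apply_mem _ _

theorem lowWeightProj_mul_self (m ℓ : ℕ) :
    lowWeightProj m ℓ * lowWeightProj m ℓ = lowWeightProj m ℓ := by
  refine Matrix.ext_of_mulVec_single fun s => ?_
  rw [← Matrix.mulVec_mulVec]
  have h : WithLp.toLp 2 (lowWeightProj m ℓ *ᵥ (lowWeightProj m ℓ *ᵥ Pi.single s 1)) =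
      Matrix.toEuclideanLin (lowWeightProj m ℓ)
        (WithLp.toLp 2 (lowWeightProj m ℓ *ᵥ Pi.single s 1)) := rfl
  rw [toEuclideanLin_lowWeightProj] at h
  refine WithLp.toLp_injective 2 (h.trans ?_)
  exact Submodule.starProjection_eq_self_iff.mpr (lowWeightProj_mulVec_mem m ℓ _)

/-- The generators of the low-weight subspace are magic basis vectors of weight at most `ℓ`. -/
theorem magicLowProj_mulVec_of_mem {ℓ : ℕ} {v : EuclideanSpace ℂ (Fin m → Fin 2)}
    (hv : v ∈ lowWeight m ℓ) : magicLowProj m ℓ *ᵥ (WithLp.ofLp v) = WithLp.ofLp v := by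
  induction hv using Submodule.span_induction with
  | mem v hv =>
    obtain ⟨w, π, hwℓ, hwm, rfl⟩ := hv
    let r : Fin m → Fin 2 := fun i => if (i : ℕ) < m - w then 0 else 1
    have hr : weight (r ∘ π) ≤ ℓ := by
      rw [weight_comp]
      refine le_trans (le_of_eq ?_) hwℓ
      have h1 : weight r = ((Finset.univ : Finset (Fin m)).filter
          fun i : Fin m => ¬ (i : ℕ) < m - w).card := by
        rw [weight]
        congr 1
        ext i
        simp only [r, Finset.mem_filter, Finset.mem_univ, true_and]
        split_ifs <;> simp_all
      rw [h1, Finset.filter_not, Finset.card_sdiff_of_subset (Finset.filter_subset _ _),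
        Finset.card_univ, Fintype.card_fin, Fin.card_filter_val_lt]
      omega
    have hv : permOp π *ᵥ (prodVec fun i : Fin m =>
        if (i : ℕ) < m - w then ketT else ketTperp) = prodVec fun i => magicKet ((r ∘ π) i) := by
      rw [permOp_mulVec]
      ext x
      simp only [prodVec, Function.comp_apply]
      rw [← Equiv.prod_comp π]
      refine Finset.prod_congr rfl fun i _ => ?_
      rw [Equiv.symm_apply_apply]
      simp only [r]
      split_ifs <;> simp [magicKet]
    change magicLowProj m ℓ *ᵥ (permOp π *ᵥ _) = permOp π *ᵥ _
    rw [hv, magicLowProj_mulVec hr]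
  | zero => exact Matrix.mulVec_zero _
  | add u v _ _ hu hv =>
    rw [WithLp.ofLp_add, Matrix.mulVec_add, hu, hv]
  | smul c v _ hv =>
    rw [WithLp.ofLp_smul, Matrix.mulVec_smul, hv]

theorem magicLowProj_mul_lowWeightProj (m ℓ : ℕ) :
    magicLowProj m ℓ * lowWeightProj m ℓ = lowWeightProj m ℓ := by
  refine Matrix.ext_of_mulVec_single fun s => ?_
  rw [← Matrix.mulVec_mulVec]
  exact magicLowProj_mulVec_of_mem (lowWeightProj_mulVec_mem m ℓ _)

theorem re_trace_lowWeightProj_mul_le (ℓ : ℕ) {ρ : Op (Fin m)} (hρ : IsState ρ) :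
    ((lowWeightProj m ℓ * ρ).trace).re ≤ ∑ s, if weight s ≤ ℓ then magicProb ρ s else 0 := by
  rw [← re_trace_magicLowProj_mul]
  set Q := magicLowProj m ℓ
  set L := lowWeightProj m ℓ
  have hQL : Q * L = L := magicLowProj_mul_lowWeightProj m ℓ
  have hQ : Qᴴ = Q := magicLowProj_conjTranspose m ℓ
  have hL : Lᴴ = L := lowWeightProj_conjTranspose m ℓ
  have hLQ : L * Q = L := by
    have h := congrArg Matrix.conjTranspose hQL
    rwa [Matrix.conjTranspose_mul, hQ, hL] at h
  have hR : (Q - L)ᴴ * (Q - L) = Q - L := by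
    rw [Matrix.conjTranspose_sub, hQ, hL, sub_mul, mul_sub, mul_sub, hQL, hLQ,
      magicLowProj_mul_self, lowWeightProj_mul_self]
    abel
  have h0 : 0 ≤ (((Q - L) * ρ * (Q - L)ᴴ).trace).re :=
    (Complex.le_def.mp (hρ.1.mul_mul_conjTranspose_same (Q - L)).trace_nonneg).1
  rw [Matrix.trace_mul_comm, ← mul_assoc, hR, sub_mul, Matrix.trace_sub, Complex.sub_re] at h0
  linarith

theorem sum_magicProb_high_le {ℓ : ℕ} {ε : ℝ} {ρ : Op (Fin m)} (hρ : IsState ρ)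
    (h : 1 - ε ≤ ((lowWeightProj m ℓ * ρ).trace).re) :
    (∑ s, if weight s ≤ ℓ then 0 else magicProb ρ s) ≤ ε := by
  have h1 := re_trace_lowWeightProj_mul_le ℓ hρ
  have h2 := sum_magicProb hρ
  have h3 : ∑ s, magicProb ρ s = (∑ s, if weight s ≤ ℓ then magicProb ρ s else 0) +
      ∑ s, if weight s ≤ ℓ then 0 else magicProb ρ s := by
    rw [← Finset.sum_add_distrib]
    refine Finset.sum_congr rfl fun s _ => ?_
    split_ifs <;> simp
  linarith

end LowWeight

/-! ### The output of the blocks -/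

section BlockOutput

theorem proj_magicKet_add : proj (magicKet 0) + proj (magicKet 1) = 1 := by
  have h : magicUnitary₁ * magicUnitary₁ᴴ = 1 :=
    mul_eq_one_comm.mp magicUnitary₁_conjTranspose_mul_self
  rw [← h]
  ext b b'
  simp [Matrix.mul_apply, magicUnitary₁, proj, Matrix.vecMulVec_apply]

theorem fidelity_add {M : Matrix (Fin 2) (Fin 2) ℂ} :
    star ketT ⬝ᵥ (M *ᵥ ketT) + star ketTperp ⬝ᵥ (M *ᵥ ketTperp) = M.trace := by
  have htr : ∀ ψ : Fin 2 → ℂ, star ψ ⬝ᵥ (M *ᵥ ψ) = (M * proj ψ).trace := by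
    intro ψ
    rw [proj, Matrix.mul_vecMulVec, Matrix.trace_vecMulVec, dotProduct_comm]
  rw [htr, htr, ← Matrix.trace_add, ← mul_add]
  have h := proj_magicKet_add
  simp only [magicKet, if_pos, one_ne_zero, if_false] at h
  rw [h, mul_one]

theorem infidelity_nonneg {M : Matrix (Fin 2) (Fin 2) ℂ} (hM : IsState M) : 0 ≤ infidelity M := by
  have h := congrArg Complex.re (fidelity_add (M := M))
  have h1 := (Complex.le_def.mp (hM.1.dotProduct_mulVec_nonneg ketTperp)).1
  rw [hM.2, Complex.add_re, Complex.one_re] at h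
  rw [Complex.zero_re] at h1
  rw [infidelity]
  linarith

theorem infidelity_le_one {M : Matrix (Fin 2) (Fin 2) ℂ} (hM : IsState M) :
    infidelity M ≤ 1 := by
  have h1 := (Complex.le_def.mp (hM.1.dotProduct_mulVec_nonneg ketT)).1
  rw [Complex.zero_re] at h1
  rw [infidelity]
  linarith

theorem fidelity_eq {M : Matrix (Fin 2) (Fin 2) ℂ} (hM : IsState M) :
    star ketT ⬝ᵥ (M *ᵥ ketT) = ((1 - infidelity M : ℝ) : ℂ) := by
  apply Complex.ext
  · simp [infidelity]
  · have h1 := (Complex.le_def.mp (hM.1.dotProduct_mulVec_nonneg ketT)).2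
    simpa using h1.symm

theorem one_sub_prod_le {ι : Type*} (A : Finset ι) {η : ι → ℝ} (h0 : ∀ i, 0 ≤ η i)
    (h1 : ∀ i, η i ≤ 1) : 1 - ∏ i ∈ A, (1 - η i) ≤ ∑ i ∈ A, η i := by
  classical
  induction A using Finset.induction_on with
  | empty => simp
  | insert i A hi ih =>
    rw [Finset.prod_insert hi, Finset.sum_insert hi]
    have h2 : ∏ j ∈ A, (1 - η j) ≤ 1 :=
      Finset.prod_le_one (fun j _ => sub_nonneg.mpr (h1 j)) fun j _ => sub_le_self _ (h0 j)
    nlinarith [mul_le_mul_of_nonneg_left h2 (h0 i)]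

theorem prodOp_proj {W : Type} [Fintype W] [DecidableEq W] (ψ : W → Fin 2 → ℂ) :
    prodOp (fun i => proj (ψ i)) = Matrix.vecMulVec (prodVec ψ) (star (prodVec ψ)) := by
  ext x y
  simp [prodOp, proj, Matrix.vecMulVec_apply, prodVec, Finset.prod_mul_distrib, star_prod]

theorem star_prodVec_dotProduct {W : Type} [Fintype W] [DecidableEq W] (ψ φ : W → Fin 2 → ℂ) :
    star (prodVec ψ) ⬝ᵥ prodVec φ = ∏ i, star (ψ i) ⬝ᵥ φ i := by
  simp only [dotProduct, prodVec, Pi.star_apply, star_prod, ← Finset.prod_mul_distrib]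
  rw [Finset.prod_univ_sum, Fintype.piFinset_univ]

theorem prodOp_mulVec_prodVec {W : Type} [Fintype W] [DecidableEq W]
    (A : W → Matrix (Fin 2) (Fin 2) ℂ) (ψ : W → Fin 2 → ℂ) :
    prodOp A *ᵥ prodVec ψ = prodVec fun i => A i *ᵥ ψ i := by
  ext x
  simp only [Matrix.mulVec, dotProduct, prodOp, prodVec, ← Finset.prod_mul_distrib]
  rw [Finset.prod_univ_sum, Fintype.piFinset_univ]

theorem isState_channel_magicState {n : ℕ} (D : Circuit n) (s : Fin n → Fin 2) :
    IsState (D.channel (magicState s)) :=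
  ⟨D.posSemidef_channel (magicState_posSemidef s), by rw [D.trace_channel, trace_magicState]⟩

variable {t n : ℕ}

theorem isState_blockOutput (D : Circuit n) (s : Fin (t * n) → Fin 2) :
    IsState (blockOutput D s) := by
  refine ⟨posSemidef_prodOp fun b => (isState_channel_magicState D _).1, ?_⟩
  rw [blockOutput, trace_prodOp]
  exact Finset.prod_eq_one fun b _ => (isState_channel_magicState D _).2

/-- The infidelity of the joint output of the blocks on the error pattern `s`. -/
noncomputable def blockInfidelity (D : Circuit n) (s : Fin (t * n) → Fin 2) : ℝ :=
  1 - ∏ b : Fin t, (1 - infidelity (D.channel (magicState (block s b))))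

theorem blockInfidelity_nonneg (D : Circuit n) (s : Fin (t * n) → Fin 2) :
    0 ≤ blockInfidelity D s := by
  rw [blockInfidelity, sub_nonneg]
  exact Finset.prod_le_one
    (fun _ _ => sub_nonneg.mpr (infidelity_le_one (isState_channel_magicState D _)))
    fun _ _ => sub_le_self _ (infidelity_nonneg (isState_channel_magicState D _))

theorem blockInfidelity_le_one (D : Circuit n) (s : Fin (t * n) → Fin 2) :
    blockInfidelity D s ≤ 1 :=
  sub_le_self _ (Finset.prod_nonneg
    fun _ _ => sub_nonneg.mpr (infidelity_le_one (isState_channel_magicState D _)))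

theorem blockInfidelity_le_sum (D : Circuit n) (s : Fin (t * n) → Fin 2) :
    blockInfidelity D s ≤ ∑ b : Fin t, infidelity (D.channel (magicState (block s b))) :=
  one_sub_prod_le _ (fun _ => infidelity_nonneg (isState_channel_magicState D _))
    fun _ => infidelity_le_one (isState_channel_magicState D _)

open scoped Matrix.Norms.L2Operator in
theorem re_trace_mul_blockOutput_sub_le {S : Op (Fin t)} (hS : ‖S‖ ≤ 1) (D : Circuit n)
    (s : Fin (t * n) → Fin 2) :
    ((S * (blockOutput D s - prodOp fun _ => proj ketT)).trace).re ≤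
      4 * Real.sqrt (blockInfidelity D s) := by
  have hT : star ketT ⬝ᵥ ketT = 1 := star_magicKet_dotProduct 0 0
  have hψ : star (prodVec fun _ : Fin t => ketT) ⬝ᵥ prodVec (fun _ : Fin t => ketT) = 1 := by
    rw [star_prodVec_dotProduct]
    exact Finset.prod_eq_one fun _ _ => hT
  have h := re_trace_mul_sub_le hS (isState_blockOutput D s) hψ
  rw [← prodOp_proj] at h
  refine h.trans (le_of_eq ?_)
  rw [blockOutput, prodOp_mulVec_prodVec, star_prodVec_dotProduct, blockInfidelity]
  simp only [fidelity_eq (isState_channel_magicState D _), ← Complex.ofReal_prod,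
    Complex.ofReal_re]

/-- Union bound over the blocks, for independent errors. -/
theorem iidExp_blockInfidelity_le (D : Circuit n) {ε : ℝ} (h0 : 0 ≤ ε) (h1 : ε ≤ 1) :
    iidExp ε (blockInfidelity (t := t) D) ≤
      t * infidelity (D.channel (prodOp fun _ => noisyT ε)) := by
  refine (iidExp_mono h0 h1 (blockInfidelity_le_sum D)).trans (le_of_eq ?_)
  rw [iidExp_sum, infidelity_channel_noisyT]
  have h : ∀ b : Fin t, iidExp ε (fun s : Fin (t * n) → Fin 2 =>
      infidelity (D.channel (magicState (block s b)))) =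
      iidExp ε fun r => infidelity (D.channel (magicState r)) := fun b =>
    iidExp_comp_injective ε (e := fun j : Fin n => finProdFinEquiv (b, j))
      (fun j j' hj => (Prod.ext_iff.mp (finProdFinEquiv.injective hj)).2)
      fun r => infidelity (D.channel (magicState r))
  simp only [h, Finset.sum_const, Finset.card_univ, Fintype.card_fin, nsmul_eq_mul]

open scoped Matrix.Norms.L2Operator in
/-- The error of the procedure is at most the average, over the number of `|T^⊥⟩` states found
in the input, of the error on a random arrangement of these. -/
theorem traceNorm_distill_sub_le (D : (n : ℕ) → Circuit n) {ρ : Op (Fin (t * n))}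
    (hρ : IsState ρ) :
    traceNorm (distill D t n ρ - prodOp fun _ => proj ketT) ≤
      ∑ s, magicProb ρ s * (4 * Real.sqrt (permAvg (blockInfidelity (D n)) s)) := by
  obtain ⟨S, hS, hSA⟩ := exists_traceNorm_eq (distill D t n ρ - prodOp fun _ => proj ketT)
  set P : Op (Fin t) := prodOp fun _ => proj ketT
  have hf : (((t * n).factorial : ℕ) : ℂ) ≠ 0 := by exact_mod_cast (Nat.factorial_pos _).ne'
  have hP : P = ∑ s, magicMatrix ρ s s • (((t * n).factorial : ℂ))⁻¹ •
      ∑ _π : Equiv.Perm (Fin (t * n)), P := by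
    rw [Finset.sum_const, Finset.card_univ, Fintype.card_perm, Fintype.card_fin,
      ← Nat.cast_smul_eq_nsmul ℂ, inv_smul_smul₀ hf, ← Finset.sum_smul]
    simp only [magicMatrix_diag hρ, ← Complex.ofReal_sum, sum_magicProb hρ, Complex.ofReal_one,
      one_smul]
  have hdiff : distill D t n ρ - P = ∑ s, (magicProb ρ s : ℂ) •
      ((((t * n).factorial : ℝ)⁻¹ : ℝ) : ℂ) •
      ∑ π : Equiv.Perm (Fin (t * n)), (blockOutput (D n) (s ∘ π) - P) := by
    conv_lhs => rw [hP]
    rw [distill_eq, ← Finset.sum_sub_distrib]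
    refine Finset.sum_congr rfl fun s _ => ?_
    rw [← smul_sub, ← smul_sub, ← Finset.sum_sub_distrib, magicMatrix_diag hρ]
    push_cast
    rfl
  rw [hSA, hdiff, Matrix.mul_sum, Matrix.trace_sum, Complex.re_sum]
  refine Finset.sum_le_sum fun s _ => ?_
  rw [Matrix.mul_smul, Matrix.trace_smul, smul_eq_mul, Complex.re_ofReal_mul, Matrix.mul_smul,
    Matrix.trace_smul, smul_eq_mul, Complex.re_ofReal_mul, Matrix.mul_sum, Matrix.trace_sum,
    Complex.re_sum]
  refine mul_le_mul_of_nonneg_left ?_ (magicProb_nonneg hρ s)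
  have h1 := permAvg_sqrt_le (blockInfidelity_nonneg (t := t) (D n)) s
  have h2 := permAvg_const_mul 4 (fun s => Real.sqrt (blockInfidelity (t := t) (D n) s)) s
  have h3 := permAvg_mono (fun s => re_trace_mul_blockOutput_sub_le (t := t) hS (D n) s) s
  rw [h2] at h3
  have h4 : permAvg (fun s => ((S * (blockOutput (D n) s - P)).trace).re) s =
      ((t * n).factorial : ℝ)⁻¹ * ∑ π : Equiv.Perm (Fin (t * n)),
        ((S * (blockOutput (D n) (s ∘ π) - P)).trace).re := by
    rw [permAvg, Fintype.card_fin]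
  rw [← h4]
  linarith

end BlockOutput

/-! ### The error of the procedure -/

section ErrorBound

/-- The constant `B` is absorbed into the exponent: the graph of `K ↦ x ^ K` is adjusted to pass
`(B δ) ^ a` at `x = δ` if `B > 1`. -/
theorem exists_mul_rpow_le {a B δ : ℝ} (ha : 0 < a) (hB : 0 < B) (hδ : 0 < δ) (hBδ : B * δ < 1) :
    ∃ K : ℝ, 0 < K ∧ ∀ x : ℝ, 0 ≤ x → x < δ → (B * x) ^ a ≤ x ^ K := by
  rcases le_or_gt B 1 with hB1 | hB1
  · exact ⟨a, ha, fun x hx _ => Real.rpow_le_rpow (by positivity)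
      (mul_le_of_le_one_left hx hB1) ha.le⟩
  · have hδ1 : δ < 1 := by nlinarith
    have hlδ : Real.log δ < 0 := Real.log_neg hδ hδ1
    have hlBδ : Real.log (B * δ) < 0 := Real.log_neg (by positivity) hBδ
    have hlB : 0 < Real.log B := Real.log_pos hB1
    have hK : 0 < a * Real.log (B * δ) / Real.log δ :=
      div_pos_of_neg_of_neg (mul_neg_of_pos_of_neg ha hlBδ) hlδ
    refine ⟨a * Real.log (B * δ) / Real.log δ, hK, fun x hx hxδ => ?_⟩
    rcases hx.eq_or_lt with rfl | hx
    · rw [mul_zero, Real.zero_rpow ha.ne', Real.zero_rpow hK.ne']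
    · rw [Real.rpow_def_of_pos (by positivity), Real.rpow_def_of_pos hx, Real.exp_le_exp,
        Real.log_mul hB.ne' hx.ne', Real.log_mul hB.ne' hδ.ne']
      have hlx : Real.log x ≤ Real.log δ := Real.log_le_log hx hxδ.le
      rw [mul_div_assoc', le_div_iff_of_neg hlδ]
      nlinarith [mul_le_mul_of_nonneg_left hlx (mul_nonneg ha.le hlB.le)]

variable {t n : ℕ}

/-- On patterns with at most `ℓ` errors the bound for independent errors carries over. -/
theorem permAvg_blockInfidelity_le {D : (n : ℕ) → Circuit n} {c a A B δ K : ℝ}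
    (hD : Distills D c a A B δ)
    (hK : ∀ x : ℝ, 0 ≤ x → x < δ → (B * x) ^ a ≤ x ^ K) (htn : 0 < t * n) {ℓ : ℕ}
    (hℓ : (ℓ : ℝ) / (t * n : ℕ) < δ) {s : Fin (t * n) → Fin 2} (hs : weight s ≤ ℓ) :
    permAvg (blockInfidelity (D n)) s ≤ 2 * (t * n : ℕ) * (t * (A *
      ((ℓ : ℝ) / (t * n : ℕ)) ^ (K * (n : ℝ) ^ c))) := by
  have : Nonempty (Fin (t * n)) := ⟨⟨0, htn⟩⟩
  have hN : (1 : ℝ) ≤ ((t * n : ℕ) : ℝ) := by exact_mod_cast htn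
  set N : ℝ := ((t * n : ℕ) : ℝ) with hNdef
  have hperm := permAvg_le_iidExp (blockInfidelity_nonneg (t := t) (D n)) s
  rw [Fintype.card_fin, ← hNdef] at hperm
  set ε : ℝ := (weight s : ℝ) / N with hε
  set x : ℝ := (ℓ : ℝ) / N with hx
  have h0 : 0 ≤ ε := by positivity
  have hw : (weight s : ℝ) ≤ N := by
    have h := weight_le s
    rw [Fintype.card_fin] at h
    exact Nat.cast_le.mpr h
  have h1 : ε ≤ 1 := div_le_one_of_le₀ hw (by positivity)
  have hεx : ε ≤ x := div_le_div_of_nonneg_right (by exact_mod_cast hs) (by positivity)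
  have hx0 : 0 ≤ x := h0.trans hεx
  have hB := hD.B_pos
  have ha := hD.a_pos
  have hA := hD.A_pos
  have hinf : infidelity ((D n).channel (prodOp fun _ => noisyT ε)) ≤
      A * x ^ (K * (n : ℝ) ^ c) := by
    refine (hD.infidelity_le n ε h0 (hεx.trans_lt hℓ)).trans ?_
    refine mul_le_mul_of_nonneg_left ?_ hA.le
    calc (B * ε) ^ (a * (n : ℝ) ^ c) ≤ (B * x) ^ (a * (n : ℝ) ^ c) :=
          Real.rpow_le_rpow (by positivity) (mul_le_mul_of_nonneg_left hεx hB.le) (by positivity)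
      _ = ((B * x) ^ a) ^ ((n : ℝ) ^ c) := Real.rpow_mul (by positivity) _ _
      _ ≤ (x ^ K) ^ ((n : ℝ) ^ c) :=
          Real.rpow_le_rpow (by positivity) (hK x hx0 hℓ) (by positivity)
      _ = x ^ (K * (n : ℝ) ^ c) := (Real.rpow_mul hx0 _ _).symm
  refine hperm.trans (mul_le_mul (by linarith) ?_ ?_ (by positivity))
  · exact (iidExp_blockInfidelity_le (D n) h0 h1).trans
      (mul_le_mul_of_nonneg_left hinf (by positivity))
  · refine Finset.sum_nonneg fun s _ => mul_nonneg (iidWeight_nonneg h0 h1 s) ?_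
    exact blockInfidelity_nonneg (D n) s

/-- Patterns of weight at most `ℓ` contribute through the union bound; the others have total
probability `ε` and contribute at most `4` each. -/
theorem traceNorm_distill_sub_le_of_lowWeight {D : (n : ℕ) → Circuit n} {c a A B δ K : ℝ}
    (hD : Distills D c a A B δ)
    (hK : ∀ x : ℝ, 0 ≤ x → x < δ → (B * x) ^ a ≤ x ^ K) (htn : 0 < t * n) {ℓ : ℕ} {ε : ℝ}
    (hℓ : (ℓ : ℝ) / (t * n : ℕ) < δ) {ρ : Op (Fin (t * n))} (hρ : IsState ρ)
    (hlow : 1 - ε ≤ ((lowWeightProj (t * n) ℓ * ρ).trace).re) :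
    traceNorm (distill D t n ρ - prodOp fun _ => proj ketT) ≤
      (4 * Real.sqrt (2 * A) + 4) * ((t * n : ℕ) * Real.sqrt t *
        ((ℓ : ℝ) / (t * n : ℕ)) ^ (K * (n : ℝ) ^ c / 2) + ε) := by
  have hN : (1 : ℝ) ≤ ((t * n : ℕ) : ℝ) := by exact_mod_cast htn
  set N : ℝ := ((t * n : ℕ) : ℝ) with hNdef
  set x : ℝ := (ℓ : ℝ) / N with hx
  have hx0 : 0 ≤ x := by positivity
  have hA := hD.A_pos
  have hhigh := sum_magicProb_high_le hρ hlow
  have hhigh0 : 0 ≤ ∑ s, if weight s ≤ ℓ then 0 else magicProb ρ s := by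
    refine Finset.sum_nonneg fun s _ => ?_
    split_ifs
    exacts [le_rfl, magicProb_nonneg hρ s]
  set β : ℝ := N * Real.sqrt t * x ^ (K * (n : ℝ) ^ c / 2) with hβ
  have hβ0 : 0 ≤ β := by positivity
  have hlowterm : ∀ s : Fin (t * n) → Fin 2, weight s ≤ ℓ →
      Real.sqrt (permAvg (blockInfidelity (D n)) s) ≤ Real.sqrt (2 * A) * β := by
    intro s hs
    refine Real.sqrt_le_iff.mpr ⟨by positivity,
      (permAvg_blockInfidelity_le hD hK htn hℓ hs).trans ?_⟩
    rw [← hNdef, ← hx]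
    have h2 : x ^ (K * (n : ℝ) ^ c) = (x ^ (K * (n : ℝ) ^ c / 2)) ^ 2 := by
      rw [← Real.rpow_natCast, ← Real.rpow_mul hx0]
      congr 1
      push_cast
      ring
    rw [h2, hβ, mul_pow, mul_pow, mul_pow, Real.sq_sqrt (by positivity),
      Real.sq_sqrt (by positivity)]
    have h3 : 0 ≤ A * t * (x ^ (K * (n : ℝ) ^ c / 2)) ^ 2 := by positivity
    nlinarith [mul_le_mul_of_nonneg_left (show N ≤ N ^ 2 by nlinarith) h3]
  have hterm : ∀ s, magicProb ρ s * (4 * Real.sqrt (permAvg (blockInfidelity (D n)) s)) ≤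
      magicProb ρ s * (4 * (Real.sqrt (2 * A) * β)) +
        4 * if weight s ≤ ℓ then 0 else magicProb ρ s := by
    intro s
    have hp := magicProb_nonneg hρ s
    split_ifs with hs
    · rw [mul_zero, add_zero]
      exact mul_le_mul_of_nonneg_left
        (mul_le_mul_of_nonneg_left (hlowterm s hs) (by norm_num)) hp
    · have h1 : permAvg (blockInfidelity (D n)) s ≤ 1 :=
        (permAvg_mono (blockInfidelity_le_one (D n)) s).trans_eq (permAvg_const 1 s)
      have h2 := Real.sqrt_le_one.mpr h1
      have h3 : 0 ≤ magicProb ρ s * (4 * (Real.sqrt (2 * A) * β)) := by positivity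
      nlinarith
  have hsum := (traceNorm_distill_sub_le D hρ).trans (Finset.sum_le_sum fun s _ => hterm s)
  rw [Finset.sum_add_distrib, ← Finset.sum_mul, sum_magicProb hρ, ← Finset.mul_sum] at hsum
  have hr := Real.sqrt_nonneg (2 * A)
  nlinarith [mul_nonneg hr (hhigh0.trans hhigh)]

end ErrorBound

end MagicDistillation

/-- First part: distilling Clifford circuit families exist, of polynomial size and logarithmic
CNOT-depth. Second part: the output of the procedure built from any such family, run on
`m = t n` qubits with block size `n = m / t`. -/
theorem mainTheorem7 :
    (∃ (D : (n : ℕ) → Circuit n) (c a A B δ : ℝ), Distills D c a A B δ ∧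
      (∃ d : ℝ, ∀ n : ℕ, 2 ≤ n → ((D n).cnotDepth : ℝ) ≤ d * Real.log n) ∧
      (∃ s q : ℕ, ∀ n : ℕ, 1 ≤ n → (D n).size ≤ s * n ^ q)) ∧
    (∀ c a A B δ : ℝ, ∃ K C : ℝ, 0 < K ∧ 0 < C ∧
      ∀ D : (n : ℕ) → Circuit n, Distills D c a A B δ →
      ∀ (t n m ℓ : ℕ) (ε : ℝ) (ρ : Op (Fin (t * n))),
        m = t * n → 0 < t → t < m → (ℓ : ℝ) / m < δ →
        IsState ρ → 1 - ε ≤ (Matrix.trace (lowWeightProj (t * n) ℓ * ρ)).re →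
        traceNorm (distill D t n ρ - prodOp fun _ => proj ketT) ≤
          C * (m * Real.sqrt t * ((ℓ : ℝ) / m) ^ (K * ((m : ℝ) / t) ^ c / 2) + ε)) := by
  refine ⟨exists_distilling_family, fun c a A B δ => ?_⟩
  by_cases hpos : 0 < a ∧ 0 < B ∧ 0 < δ ∧ B * δ < 1
  · obtain ⟨ha, hB, hδ, hBδ⟩ := hpos
    obtain ⟨K, hK0, hK⟩ := exists_mul_rpow_le ha hB hδ hBδ
    refine ⟨K, 4 * Real.sqrt (2 * A) + 4, hK0, by positivity, ?_⟩
    rintro D hD t n m ℓ ε ρ rfl ht htm hℓ hρ hlow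
    have hnt : (((t * n : ℕ) : ℝ)) / t = n := by
      have : (t : ℝ) ≠ 0 := by exact_mod_cast ht.ne'
      push_cast
      field_simp
    rw [hnt]
    exact traceNorm_distill_sub_le_of_lowWeight hD hK (ht.trans htm) hℓ hρ hlow
  -- For other constants there are no distilling families.
  · refine ⟨1, 1, one_pos, one_pos, fun D hD => ?_⟩
    exact absurd ⟨hD.a_pos, hD.B_pos, hD.δ_pos, hD.Bδ_lt_one⟩ hpos
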